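/- **Conventions.** Let $\mathbb{K}=\mathbb{R}$ or $\mathbb{C}$. A *clct space* is a complete Hausdorff locally convex topological $\mathbb{K}$-vector space, and $E\mathbin{\hat\otimes}F$ is the completed projective tensor product, the Hausdorff completion of $E\otimes F$ for the seminorms $(p\otimes q)(v)=\inf\{\sum_a p(e_a)q(f_a) : v=\sum_a e_a\otimes f_a\}$ with $p,q$ continuous seminorms on $E,F$. A graded clct space $(M^n)_{n\in\mathbb{Z}}$ is identified with $M=\prod_n M^n$ (product topology), and $(M\mathbin{\hat\otimes}N)^n=\prod_{a+b=n}M^a\mathbin{\hat\otimes}N^b$. A *clct dg-algebra* $A$ is a cochain complex of clct spaces with a continuous, associative, unital multiplication $A\mathbin{\hat\otimes}A\to A$ of degree $0$ satisfying the graded Leibniz rule. A (right) *clct dg-module* over $A$ is a cochain complex $M$ of clct spaces with a continuous, associative, unital action $M\mathbin{\hat\otimes}A\to M$ of degree $0$ with $d(ma)=d(m)a+(-1)^{|m|}m\,d(a)$. Right dg-modules form a dg-category $A\text{-Mod}$, with closed morphisms of degree $0$ forming $Z^0(A\text{-Mod})$ and homotopy category $H^0(A\text{-Mod})$. We write $A^\#$,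 $M^\#$ for the underlying graded objects without differential. A sequence $0\to K\to L\to M\to 0$ of graded $A^\#$-modules, or in $Z^0(A\text{-Mod})$, is called *exact* if in each degree it is split exact as a sequence of clct spaces, i.e. has a continuous $\mathbb{K}$-linear contracting homotopy. Let $\mathrm{Ac}^{\mathrm{ctr}}(A)\subseteq H^0(A\text{-Mod})$ be the smallest thick triangulated subcategory which contains the totalizations of all exact sequences in $Z^0(A\text{-Mod})$ and is closed under products. The *contraderived category* is the Verdier quotient $D^{\mathrm{ctr}}(A)=H^0(A\text{-Mod})/\mathrm{Ac}^{\mathrm{ctr}}(A)$, and $M$ is *contraacyclic* if it is zero in $D^{\mathrm{ctr}}(A)$. A dg-module $P$ is *graded-projective* if $P^\#$ is projective for the above exact structure on graded $A^\#$-modules. It is *graded-free* if $P^\#\cong W\mathbin{\hat\otimes}A^\#$ as graded $A^\#$-modules for a graded clct space $W$. Suppose that $A$ is concentrated in non-negative degrees ($A^n=0$ for $n<0$). Regard $A^0$ as a clct dg-algebra with zero differential; then the projection $\pi_0:A\to A^0$ is a morphism of clct dg-algebras. For a dg-module $M$ let $M\mathbin{\hat\otimes}_A A^0$ be the cokernel,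 in clct spaces, of the difference $M\mathbin{\hat\otimes}A\mathbin{\hat\otimes}A^0\to M\mathbin{\hat\otimes}A^0$ of the two actions, with its induced differential and right $A^0$-action. A *derived extension of scalars* is a functor $(-)\mathbin{\hat\otimes}^L_A A^0:D^{\mathrm{ctr}}(A)\to D^{\mathrm{ctr}}(A^0)$ whose restriction to the full subcategory of graded-projective modules in $H^0(A\text{-Mod})$ is naturally isomorphic to $P\mapsto P\mathbin{\hat\otimes}_A A^0$. **Proposition.** Let $A$ be a clct dg-algebra concentrated in non-negative degrees. 1. A derived extension of scalars functor $(-)\mathbin{\hat\otimes}^L_A A^0:D^{\mathrm{ctr}}(A)\to D^{\mathrm{ctr}}(A^0)$ exists, and every such functor reflects isomorphisms. 2. Let $N=(W\mathbin{\hat\otimes}A^\#,\,d=d_0+d_1+\cdots)$ be a graded-free right clct dg-module over $A$, where $W$ is a graded clct space and $d_k$ is determined by the component $W\to W\mathbin{\hat\otimes}A^k$ of $d|_W$. Thus $d_0$ on $W\mathbin{\hat\otimes}A^0$ is the component of $d$ which maps $W\mathbin{\hat\otimes}A^0$ to itself, and $(W\mathbin{\hat\otimes}A^0,d_0)$ is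 a dg-module over $A^0$. Then $N$ is contraacyclic over $A$ if and only if $(W\mathbin{\hat\otimes}A^0,d_0)$ is contraacyclic over $A^0$. -/

import Mathlib

open CategoryTheory Topology Filter TensorProduct UniformSpace
open scoped RightActions

universe v u

/-! ## Complete locally convex spaces and gradings -/

section Spaces

/-- Complete Hausdorff locally convex topological vector spaces over `𝕜` (`ℝ` or `ℂ`). -/
class Clct (𝕜 : Type v) [RCLike 𝕜] (E : Type u) [AddCommGroup E] [Module 𝕜 E]
    [UniformSpace E] : Prop extends
    IsUniformAddGroup E, PolynormableSpace 𝕜 E, CompleteSpace E, T2Space E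

instance (priority := 50) Clct.continuousSMul (𝕜 : Type v) [RCLike 𝕜] (E : Type u)
    [AddCommGroup E] [Module 𝕜 E] [UniformSpace E] [Clct 𝕜 E] : ContinuousSMul 𝕜 E :=
  (PolynormableSpace.withSeminorms 𝕜 E).continuousSMul

/-- A grading of a clct space `E`, i.e. a decomposition of `E` as a topological product
`∏ n : ℤ, E n` of clct spaces, recorded by the projections `proj n : E → E n ⊆ E`.
In this way a graded clct space `(E n)_n` is viewed as the single space `∏ n, E n` with the
product topology. The topology of `E` is that of the product (`inducing`); that every family of
components comes from an element is then automatic, see `Grading.existsUnique`. -/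
structure Grading (𝕜 : Type v) [RCLike 𝕜] (E : Type u) [AddCommGroup E] [Module 𝕜 E]
    [UniformSpace E] where
  proj : ℤ → E →L[𝕜] E
  proj_proj : ∀ i j x, proj i (proj j x) = if i = j then proj j x else 0
  inducing : IsInducing (fun (x : E) (n : ℤ) => proj n x)

variable {𝕜 : Type v} [RCLike 𝕜] {E : Type u} [AddCommGroup E] [Module 𝕜 E] [UniformSpace E]

/-- `x` lies in the degree `n` component. -/
def Grading.Homog (g : Grading 𝕜 E) (n : ℤ) (x : E) : Prop := g.proj n x = x

theorem Grading.homog_proj (g : Grading 𝕜 E) (n : ℤ) (x : E) : g.Homog n (g.proj n x) := by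
  simp [Grading.Homog, g.proj_proj]

theorem Grading.Homog.proj_eq {g : Grading 𝕜 E} {n : ℤ} {x : E} (h : g.Homog n x) (m : ℤ) :
    g.proj m x = if m = n then x else 0 := by
  have h' : g.proj n x = x := h
  rw [← h', g.proj_proj, h']

theorem Grading.proj_sum (g : Grading 𝕜 E) (s : Finset ℤ) (y : ℤ → E)
    (hy : ∀ n, g.Homog n (y n)) (m : ℤ) :
    g.proj m (∑ n ∈ s, y n) = if m ∈ s then y m else 0 := by
  rw [map_sum]
  simp_rw [fun n => (hy n).proj_eq m]
  simp

theorem Grading.hasSum [Clct 𝕜 E] (g : Grading 𝕜 E) (x : E) :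
    HasSum (fun n => g.proj n x) x := by
  rw [HasSum, SummationFilter.unconditional_filter, g.inducing.tendsto_nhds_iff, tendsto_pi_nhds]
  intro m
  refine tendsto_const_nhds.congr' ?_
  filter_upwards [eventually_ge_atTop {m}] with s hs
  have hm : m ∈ s := by simpa using hs
  simp only [Function.comp]
  rw [g.proj_sum s _ (fun n => g.homog_proj n x), if_pos hm]

theorem Grading.existsUnique [Clct 𝕜 E] (g : Grading 𝕜 E) (y : ℤ → E)
    (hy : ∀ n, g.Homog n (y n)) : ∃! x, ∀ n, g.proj n x = y n := by
  have hu : IsUniformInducing (fun (x : E) (n : ℤ) => g.proj n x) := by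
    let f : E →ₗ[𝕜] (ℤ → E) := LinearMap.pi fun n => (g.proj n).toLinearMap
    exact AddMonoidHom.isUniformInducing_of_isInducing (f := f) g.inducing
  have hlim : Tendsto (fun (s : Finset ℤ) (m : ℤ) => g.proj m (∑ n ∈ s, y n)) atTop (𝓝 y) := by
    rw [tendsto_pi_nhds]
    intro m
    refine tendsto_const_nhds.congr' ?_
    filter_upwards [eventually_ge_atTop {m}] with s hs
    rw [g.proj_sum s y hy, if_pos (by simpa using hs)]
  have hc : Cauchy (map (fun s : Finset ℤ => ∑ n ∈ s, y n) atTop) := by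
    rw [← hu.cauchy_map_iff, Filter.map_map]
    exact hlim.cauchy_map
  obtain ⟨x, hx⟩ := CompleteSpace.complete hc
  refine ⟨x, fun n => ?_, fun x' hx' => ?_⟩
  · have h1 : Tendsto (fun s : Finset ℤ => g.proj n (∑ n ∈ s, y n)) atTop (𝓝 (g.proj n x)) :=
      ((g.proj n).continuous.tendsto x).comp hx
    exact tendsto_nhds_unique h1 ((tendsto_pi_nhds.1 hlim) n)
  · have h1 := g.hasSum x'
    simp_rw [hx'] at h1
    exact tendsto_nhds_unique h1 (show HasSum y x from hx)

/-- Continuous linear maps that agree on homogeneous elements are equal. -/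
theorem Grading.ext_fun [Clct 𝕜 E] (g : Grading 𝕜 E) {F : Type u} [AddCommGroup F] [Module 𝕜 F]
    [UniformSpace F] [T2Space F] (a b : E →L[𝕜] F)
    (h : ∀ n x, g.Homog n x → a x = b x) (x : E) : a x = b x := by
  have h1 := (g.hasSum x).mapL a
  have h2 := (g.hasSum x).mapL b
  simp_rw [fun n => h n _ (g.homog_proj n x)] at h1
  exact h1.unique h2

/-- A continuous linear map of degree `k` commutes with the projections. -/
theorem Grading.proj_map [Clct 𝕜 E] (g : Grading 𝕜 E) {F : Type u} [AddCommGroup F] [Module 𝕜 F]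
    [UniformSpace F] [Clct 𝕜 F] (g' : Grading 𝕜 F) (f : E →L[𝕜] F) (k : ℤ)
    (hf : ∀ i x, g.Homog i x → g'.Homog (i + k) (f x)) (n : ℤ) (x : E) :
    g'.proj (n + k) (f x) = f (g.proj n x) := by
  refine g.ext_fun ((g'.proj (n + k)).comp f) (f.comp (g.proj n)) (fun m x hx => ?_) x
  change g'.proj (n + k) (f x) = f (g.proj n x)
  rw [(hf m x hx).proj_eq, hx.proj_eq]
  by_cases h : n = m
  · simp [h]
  · rw [if_neg h, if_neg (by omega), map_zero]

end Spaces

/-! ## Algebras and modules -/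

/-- A clct dg-algebra `A` over `𝕜`: the total space `∏ n, A n` is a clct space with a jointly
continuous associative unital multiplication (equivalently, a continuous map `A ⊗̂ A → A` on the
completed projective tensor product) which is compatible with the degrees, and a continuous
differential of degree `1` which satisfies the graded Leibniz rule. -/
structure DGAlg (𝕜 : Type v) [RCLike 𝕜] where
  carrier : Type u
  [ring : Ring carrier]
  [algebra : Algebra 𝕜 carrier]
  [uniformSpace : UniformSpace carrier]
  [clct : Clct 𝕜 carrier]
  [continuousMul : ContinuousMul carrier]
  deg : Grading 𝕜 carrier
  one_homog : deg.Homog 0 1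
  mul_homog : ∀ i j a b, deg.Homog i a → deg.Homog j b → deg.Homog (i + j) (a * b)
  d : carrier →L[𝕜] carrier
  d_homog : ∀ i a, deg.Homog i a → deg.Homog (i + 1) (d a)
  d_d : ∀ a, d (d a) = 0
  leibniz : ∀ i a b, deg.Homog i a → d (a * b) = d a * b + i.negOnePow • (a * d b)

instance {𝕜 : Type v} [RCLike 𝕜] : CoeSort (DGAlg.{v, u} 𝕜) (Type u) := ⟨DGAlg.carrier⟩

attribute [instance] DGAlg.ring DGAlg.algebra DGAlg.uniformSpace DGAlg.clct DGAlg.continuousMul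

/-- A graded clct vector space. -/
structure GrSpace (𝕜 : Type v) [RCLike 𝕜] where
  carrier : Type u
  [addCommGroup : AddCommGroup carrier]
  [module : Module 𝕜 carrier]
  [uniformSpace : UniformSpace carrier]
  [clct : Clct 𝕜 carrier]
  deg : Grading 𝕜 carrier

instance {𝕜 : Type v} [RCLike 𝕜] : CoeSort (GrSpace.{v, u} 𝕜) (Type u) := ⟨GrSpace.carrier⟩

attribute [instance] GrSpace.addCommGroup GrSpace.module GrSpace.uniformSpace GrSpace.clct

section Modules

variable {𝕜 : Type v} [RCLike 𝕜]

/-- The algebra is concentrated in non-negative degrees. -/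
def DGAlg.NonNeg (A : DGAlg.{v, u} 𝕜) : Prop := ∀ n < 0, ∀ a, A.deg.proj n a = 0

/-- A graded right clct module over the graded algebra `A^#` underlying `A`
(the differential of `A` plays no role). The action of `a` on `m` is written `m <• a`;
it is jointly continuous, i.e. given by a continuous map `M ⊗̂ A → M`. -/
structure GrMod (A : DGAlg.{v, u} 𝕜) extends GrSpace.{v, u} 𝕜 where
  [act : Module Aᵐᵒᵖ carrier]
  [tower : IsScalarTower 𝕜 Aᵐᵒᵖ carrier]
  [continuousAct : ContinuousSMul Aᵐᵒᵖ carrier]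
  act_homog : ∀ i j m a, deg.Homog i m → A.deg.Homog j a → deg.Homog (i + j) (m <• a)

instance (A : DGAlg.{v, u} 𝕜) : CoeSort (GrMod A) (Type u) := ⟨fun M => M.carrier⟩

attribute [instance] GrMod.act GrMod.tower GrMod.continuousAct

/-- A right clct dg-module over `A`. -/
structure DGMod (A : DGAlg.{v, u} 𝕜) extends GrMod A where
  d : carrier →L[𝕜] carrier
  d_homog : ∀ i m, deg.Homog i m → deg.Homog (i + 1) (d m)
  d_d : ∀ m, d (d m) = 0
  leibniz : ∀ i m (a : A), deg.Homog i m →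
    d (m <• a) = d m <• a + i.negOnePow • (m <• A.d a)

instance (A : DGAlg.{v, u} 𝕜) : CoeSort (DGMod A) (Type u) := ⟨fun M => M.carrier⟩

variable {A : DGAlg.{v, u} 𝕜}

/-- `A^#`-linear continuous maps of degree `k`. -/
@[ext]
structure GrHom (k : ℤ) (M N : GrMod A) extends M →L[𝕜] N where
  map_act : ∀ m (a : A), toFun (m <• a) = toFun m <• a
  map_homog : ∀ i m, M.deg.Homog i m → N.deg.Homog (i + k) (toFun m)

/-- Closed morphisms of degree `0`, the morphisms of `Z⁰(A-Mod)`. -/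
@[ext]
structure DGHom (M N : DGMod A) extends GrHom 0 M.toGrMod N.toGrMod where
  map_d : ∀ m, toFun (M.d m) = N.d (toFun m)

/-- The category `Z⁰(A-Mod)`. -/
instance : Category.{u} (DGMod A) where
  Hom M N := DGHom M N
  id M := { ContinuousLinearMap.id 𝕜 M with
    map_act := fun _ _ => rfl
    map_homog := fun i m h => by simpa using h
    map_d := fun _ => rfl }
  comp {M N L} f g := { g.toContinuousLinearMap.comp f.toContinuousLinearMap with
    map_act := fun m a => by
      have h1 := f.map_act m a
      have h2 := g.map_act (f.toFun m) a
      exact (congrArg g.toFun h1).trans h2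
    map_homog := fun i m h => by
      have h1 := g.map_homog _ _ (f.map_homog i m h)
      simpa using h1
    map_d := fun m => (congrArg g.toFun (f.map_d m)).trans (g.map_d _) }

/-- Two closed morphisms of degree `0` are homotopic if their difference is the differential
`d ∘ h + h ∘ d` of some `h` of degree `-1` in the complex `Hom_A(M, N)`. -/
def DGHomotopic (A : DGAlg.{v, u} 𝕜) : HomRel (DGMod A) := fun M N f g =>
  ∃ h : GrHom (-1) M.toGrMod N.toGrMod,
    ∀ m, f.toFun m - g.toFun m = N.d (h.toFun m) + h.toFun (M.d m)

/-- The homotopy category `H⁰(A-Mod)`. -/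
abbrev HoCat (A : DGAlg.{v, u} 𝕜) := CategoryTheory.Quotient (DGHomotopic A)

/-- The object of `H⁰(A-Mod)` given by a dg-module. -/
abbrev DGMod.toHo (M : DGMod A) : HoCat A := (Quotient.functor (DGHomotopic A)).obj M

end Modules

/-! ## Shifts, cones, products; the contraderived category -/

section Constructions

variable {𝕜 : Type v} [RCLike 𝕜]

section GradingConstr

variable {E : Type u} [AddCommGroup E] [Module 𝕜 E] [UniformSpace E]
  {F : Type u} [AddCommGroup F] [Module 𝕜 F] [UniformSpace F]

/-- The shift `E[k]`, with `E[k]^n = E^(n + k)`. -/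
def Grading.shift (g : Grading 𝕜 E) (k : ℤ) : Grading 𝕜 E where
  proj n := g.proj (n + k)
  proj_proj i j x := by simp [g.proj_proj]
  inducing := by
    refine IsInducing.of_comp (g := fun (y : ℤ → E) (n : ℤ) => y (n - k))
      (continuous_pi fun n => (g.proj (n + k)).continuous)
      (continuous_pi fun n => continuous_apply (n - k)) ?_
    simpa [Function.comp_def] using g.inducing

/-- The direct sum of two graded spaces. -/
def Grading.prod (g : Grading 𝕜 E) (h : Grading 𝕜 F) : Grading 𝕜 (E × F) where
  proj n := (g.proj n).prodMap (h.proj n)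
  proj_proj i j x := by
    by_cases hij : i = j <;> ext <;> simp [g.proj_proj, h.proj_proj, hij]
  inducing := by
    refine IsInducing.of_comp
      (g := fun (y : ℤ → E × F) => ((fun n => (y n).1, fun n => (y n).2) : (ℤ → E) × (ℤ → F)))
      (continuous_pi fun n => ((g.proj n).prodMap (h.proj n)).continuous) (by fun_prop) ?_
    exact g.inducing.prodMap h.inducing

/-- The product of graded spaces. -/
def Grading.pi {ι : Type u} {E : ι → Type u} [∀ i, AddCommGroup (E i)] [∀ i, Module 𝕜 (E i)]
    [∀ i, UniformSpace (E i)] (g : ∀ i, Grading 𝕜 (E i)) : Grading 𝕜 (∀ i, E i) where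
  proj n := ContinuousLinearMap.pi fun i => ((g i).proj n).comp (ContinuousLinearMap.proj i)
  proj_proj i j x := by
    ext l
    by_cases hij : i = j <;> simp [(g l).proj_proj, hij]
  inducing := by
    refine IsInducing.of_comp
      (g := fun (y : ℤ → ∀ i, E i) => (fun i n => y n i : ∀ i, ℤ → E i))
      (by fun_prop) (by fun_prop) ?_
    exact IsInducing.piMap fun i => (g i).inducing

end GradingConstr

instance {E F : Type u} [AddCommGroup E] [Module 𝕜 E] [UniformSpace E] [Clct 𝕜 E]
    [AddCommGroup F] [Module 𝕜 F] [UniformSpace F] [Clct 𝕜 F] : Clct 𝕜 (E × F) where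

instance {ι : Type u} {E : ι → Type u} [∀ i, AddCommGroup (E i)] [∀ i, Module 𝕜 (E i)]
    [∀ i, UniformSpace (E i)] [∀ i, Clct 𝕜 (E i)] : Clct 𝕜 (∀ i, E i) where

variable {A : DGAlg.{v, u} 𝕜}

/-- The shift `M[k]` with differential `(-1)^k d` and unchanged right action. -/
def DGMod.shift (M : DGMod A) (k : ℤ) : DGMod A where
  carrier := M
  deg := M.deg.shift k
  act_homog i j m a hm ha := by
    have := M.act_homog (i + k) j m a hm ha
    rwa [add_right_comm] at this
  d := (k.negOnePow : ℤ) • M.d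
  d_homog i m hm := by
    have := M.d_homog (i + k) m hm
    rw [add_right_comm] at this
    change M.deg.proj (i + 1 + k) _ = _
    rcases Int.units_eq_one_or k.negOnePow with h | h <;>
      simpa [h, Grading.Homog] using this
  d_d m := by
    rcases Int.units_eq_one_or k.negOnePow with h | h <;> simp [h, M.d_d]
  leibniz i m a hm := by
    have h := M.leibniz (i + k) m a hm
    rcases Int.units_eq_one_or k.negOnePow with hk | hk <;>
      simp [hk, Int.negOnePow_add] at h ⊢ <;> simp [h, add_comm]

/-- The cone of a closed morphism `f : M → N` of degree `0`: the graded module `M[1] ⊕ N` with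
differential `(m, n) ↦ (-d m, f m + d n)`. -/
def DGHom.cone {M N : DGMod A} (f : M ⟶ N) : DGMod A where
  carrier := M × N
  deg := (M.deg.shift 1).prod N.deg
  act_homog i j m a hm ha := by
    refine Prod.ext ?_ (N.act_homog i j m.2 a (congrArg Prod.snd hm) ha)
    have := M.act_homog (i + 1) j m.1 a (congrArg Prod.fst hm) ha
    rwa [add_right_comm] at this
  d := ((-M.d).comp (ContinuousLinearMap.fst 𝕜 M N)).prod
    (f.toContinuousLinearMap.comp (ContinuousLinearMap.fst 𝕜 M N) +
      N.d.comp (ContinuousLinearMap.snd 𝕜 M N))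
  d_homog i m hm := by
    have h1 := M.d_homog (i + 1) m.1 (congrArg Prod.fst hm)
    have h2 := f.map_homog (i + 1) m.1 (congrArg Prod.fst hm)
    have h3 := N.d_homog i m.2 (congrArg Prod.snd hm)
    rw [add_zero] at h2
    refine Prod.ext ?_ ?_
    · change M.deg.proj (i + 1 + 1) (-M.d m.1) = -M.d m.1
      rw [map_neg, h1]
    · change N.deg.proj (i + 1) (f.toFun m.1 + N.d m.2) = f.toFun m.1 + N.d m.2
      rw [map_add, h2, h3]
  d_d m := by
    refine Prod.ext ?_ ?_
    · change -M.d (-M.d m.1) = 0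
      rw [map_neg, M.d_d, neg_zero, neg_zero]
    · change f.toContinuousLinearMap (-M.d m.1) + N.d (f.toFun m.1 + N.d m.2) = 0
      have h := f.map_d m.1
      rw [map_neg, map_add, N.d_d, ← h]
      exact (congrArg (_ + ·) (add_zero _)).trans (neg_add_cancel _)
  leibniz i m a hm := by
    have h1 := M.leibniz (i + 1) m.1 a (congrArg Prod.fst hm)
    have h2 := N.leibniz i m.2 a (congrArg Prod.snd hm)
    have h3 := f.map_act m.1 a
    refine Prod.ext ?_ ?_
    · change -M.d (m.1 <• a) = (-M.d m.1) <• a + i.negOnePow • (m.1 <• A.d a)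
      rw [h1, Int.negOnePow_succ]
      simp [add_comm]
    · change f.toFun (m.1 <• a) + N.d (m.2 <• a) =
        (f.toFun m.1 + N.d m.2) <• a + i.negOnePow • (m.2 <• A.d a)
      rw [h2, h3, smul_add, add_assoc]

/-- The product of a family of dg-modules. -/
def DGMod.pi {ι : Type u} (M : ι → DGMod A) : DGMod A where
  carrier := ∀ i, M i
  deg := Grading.pi fun i => (M i).deg
  act_homog i j m a hm ha := by
    ext l
    exact (M l).act_homog i j (m l) a (congrFun hm l) ha
  d := ContinuousLinearMap.pi fun i => (M i).d.comp (ContinuousLinearMap.proj i)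
  d_homog i m hm := by
    ext l
    exact (M l).d_homog i (m l) (congrFun hm l)
  d_d m := by
    ext l
    exact (M l).d_d (m l)
  leibniz i m a hm := by
    ext l
    exact (M l).leibniz i (m l) a (congrFun hm l)

/-- `0 → K → L → M → 0` (with maps `i`, `q`) is exact in `Z⁰(A-Mod)`: in each degree it is split
exact, i.e. it has a continuous `𝕜`-linear contracting homotopy `(r, s)`. -/
def IsSplitExact {K L M : DGMod A} (i : K ⟶ L) (q : L ⟶ M) : Prop :=
  (∀ x, q.toFun (i.toFun x) = 0) ∧
  ∃ (r : L →L[𝕜] K) (s : M →L[𝕜] L),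
    (∀ n x, L.deg.Homog n x → K.deg.Homog n (r x)) ∧
    (∀ n x, M.deg.Homog n x → L.deg.Homog n (s x)) ∧
    (∀ x, r (i.toFun x) = x) ∧ (∀ x, q.toFun (s x) = x) ∧
    ∀ x, i.toFun (r x) + s (q.toFun x) = x

/-- The map `cone i → M`, `(k, l) ↦ q l` induced by `q : L → M` with `q ∘ i = 0`. -/
def DGHom.coneDesc {K L M : DGMod A} (i : K ⟶ L) (q : L ⟶ M)
    (h : ∀ x, q.toFun (i.toFun x) = 0) : i.cone ⟶ M :=
  ({ q.toContinuousLinearMap.comp (ContinuousLinearMap.snd 𝕜 K L) with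
    map_act := fun m a => q.map_act m.2 a
    map_homog := fun n m hm => q.map_homog n m.2 (congrArg Prod.snd hm)
    map_d := fun m => by
      change q.toContinuousLinearMap (i.toFun m.1 + L.d m.2) = M.d (q.toFun m.2)
      rw [map_add]
      exact (congrArg₂ (· + ·) (h m.1) (q.map_d m.2)).trans (zero_add _) } :
    DGHom i.cone M)

/-- The totalization of `0 → K → L → M → 0`: the iterated cone, whose underlying graded module is
`K[2] ⊕ L[1] ⊕ M`. -/
def DGHom.tot {K L M : DGMod A} (i : K ⟶ L) (q : L ⟶ M)
    (h : ∀ x, q.toFun (i.toFun x) = 0) : DGMod A :=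
  (DGHom.coneDesc i q h).cone

/-- Membership in `Ac^ctr(A)`: the smallest class of objects of `H⁰(A-Mod)` which contains the
totalizations of short exact sequences and is closed under shifts, cones, direct summands
(in particular under isomorphisms) in `H⁰(A-Mod)`, and products. -/
inductive AcCtr (A : DGAlg.{v, u} 𝕜) : DGMod A → Prop
  | tot {K L M : DGMod A} (i : K ⟶ L) (q : L ⟶ M) (h : IsSplitExact i q) :
      AcCtr A (DGHom.tot i q h.1)
  | shift (M : DGMod A) (k : ℤ) : AcCtr A M → AcCtr A (M.shift k)
  | cone {M N : DGMod A} (f : M ⟶ N) : AcCtr A M → AcCtr A N → AcCtr A f.cone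
  | retract (M N : DGMod A) : Nonempty (Retract M.toHo N.toHo) → AcCtr A N → AcCtr A M
  | pi {ι : Type u} (M : ι → DGMod A) : (∀ i, AcCtr A (M i)) → AcCtr A (DGMod.pi M)

/-- The morphisms of `H⁰(A-Mod)` whose cone lies in `Ac^ctr(A)`. -/
def ctrEquiv (A : DGAlg.{v, u} 𝕜) : MorphismProperty (HoCat A) := fun X Y φ =>
  ∃ f : X.as ⟶ Y.as, (Quotient.functor (DGHomotopic A)).map f = φ ∧ AcCtr A f.cone

/-- The contraderived category, the Verdier quotient `H⁰(A-Mod) / Ac^ctr(A)`. -/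
abbrev Dctr (A : DGAlg.{v, u} 𝕜) := (ctrEquiv A).Localization

/-- The quotient functor `H⁰(A-Mod) ⥤ D^ctr(A)`. -/
noncomputable abbrev Dctr.quot (A : DGAlg.{v, u} 𝕜) : HoCat A ⥤ Dctr A := (ctrEquiv A).Q

/-- A dg-module is contraacyclic if it is trivial in `D^ctr(A)`. -/
def DGMod.IsContraacyclic (M : DGMod A) : Prop :=
  Limits.IsZero ((Dctr.quot A).obj M.toHo)

/-- `P` is projective with respect to the exact structure on graded clct `A^#`-modules. -/
def GrMod.IsGradedProjective (P : GrMod A) : Prop :=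
  ∀ (X Y : GrMod A) (p : GrHom 0 X Y) (g : GrHom 0 P Y),
    (∃ s : Y →L[𝕜] X, (∀ n y, Y.deg.Homog n y → X.deg.Homog n (s y)) ∧
      ∀ y, p.toFun (s y) = y) →
    ∃ l : GrHom 0 P X, ∀ x, p.toFun (l.toFun x) = g.toFun x

/-- The graded-projective objects of `H⁰(A-Mod)`. -/
def gradedProjectives (A : DGAlg.{v, u} 𝕜) : ObjectProperty (HoCat A) :=
  fun X => X.as.toGrMod.IsGradedProjective

/-- The functor `H⁰(A-Mod_gproj) ⥤ D^ctr(A)`. -/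
noncomputable abbrev gprojToDctr (A : DGAlg.{v, u} 𝕜) : (gradedProjectives A).FullSubcategory ⥤ Dctr A :=
  (gradedProjectives A).ι ⋙ Dctr.quot A

end Constructions

/-! ## Completed projective tensor products -/

theorem exists_seminorm_of_mem_nhds {𝕜 : Type v} [RCLike 𝕜] {X : Type u} [AddCommGroup X]
    [Module 𝕜 X] [TopologicalSpace X] [PolynormableSpace 𝕜 X] {U : Set X} (hU : U ∈ 𝓝 (0 : X)) :
    ∃ p : Seminorm 𝕜 X, Continuous p ∧ ∀ x, p x < 1 → x ∈ U := by
  have hw := PolynormableSpace.withSeminorms 𝕜 X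
  have := hw.topologicalAddGroup
  obtain ⟨⟨s, r⟩, hr, hs⟩ := hw.hasBasis_zero_ball.mem_iff.1 hU
  let c : NNReal := ⟨r⁻¹, (inv_pos.2 hr).le⟩
  refine ⟨c • s.sup fun p : {p : Seminorm 𝕜 X // Continuous p} => p.1,
    Continuous.const_smul (Seminorm.continuous_finsetSup fun i _ => i.2) _, fun x hx => hs ?_⟩
  rw [Seminorm.mem_ball_zero]
  have h : r⁻¹ * (s.sup fun p : {p : Seminorm 𝕜 X // Continuous p} => p.1) x < 1 := hx
  rwa [inv_mul_lt_iff₀ hr, mul_one] at h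

section Tensor

variable {𝕜 : Type v} [RCLike 𝕜]
variable {E : Type u} [AddCommGroup E] [Module 𝕜 E]
variable {F : Type u} [AddCommGroup F] [Module 𝕜 F]
variable {E' : Type u} [AddCommGroup E'] [Module 𝕜 E']
variable {F' : Type u} [AddCommGroup F'] [Module 𝕜 F']

/-- The quotient of the algebraic tensor product `E ⊗ F` by a subspace `K`. -/
def PTensor (K : Submodule 𝕜 (E ⊗[𝕜] F)) : Type u := (E ⊗[𝕜] F) ⧸ K

instance (K : Submodule 𝕜 (E ⊗[𝕜] F)) : AddCommGroup (PTensor K) :=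
  inferInstanceAs (AddCommGroup ((E ⊗[𝕜] F) ⧸ K))

instance (K : Submodule 𝕜 (E ⊗[𝕜] F)) : Module 𝕜 (PTensor K) :=
  inferInstanceAs (Module 𝕜 ((E ⊗[𝕜] F) ⧸ K))

/-- The quotient map. -/
def PTensor.mk (K : Submodule 𝕜 (E ⊗[𝕜] F)) : E ⊗[𝕜] F →ₗ[𝕜] PTensor K := K.mkQ

theorem PTensor.mk_surjective (K : Submodule 𝕜 (E ⊗[𝕜] F)) : Function.Surjective (PTensor.mk K) :=
  K.mkQ_surjective

/-- The class of `∑ a, e_a ⊗ f_a` for a finite list of pairs `(e_a, f_a)`. -/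
def PTensor.ofList (K : Submodule 𝕜 (E ⊗[𝕜] F)) (l : List (E × F)) : PTensor K :=
  PTensor.mk K (l.map fun x => x.1 ⊗ₜ[𝕜] x.2).sum

/-- `∑ a, p e_a * q f_a` for a finite list of pairs `(e_a, f_a)`. -/
def projCost (p : Seminorm 𝕜 E) (q : Seminorm 𝕜 F) (l : List (E × F)) : ℝ :=
  (l.map fun x => p x.1 * q x.2).sum

theorem projCost_nonneg (p : Seminorm 𝕜 E) (q : Seminorm 𝕜 F) (l : List (E × F)) :
    0 ≤ projCost p q l := by
  refine List.sum_nonneg fun x hx => ?_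
  obtain ⟨y, -, rfl⟩ := List.mem_map.1 hx
  positivity

theorem PTensor.exists_ofList (K : Submodule 𝕜 (E ⊗[𝕜] F)) (v : PTensor K) :
    ∃ l, PTensor.ofList K l = v := by
  obtain ⟨t, rfl⟩ := PTensor.mk_surjective K v
  induction t with
  | zero => exact ⟨[], by simp [PTensor.ofList]⟩
  | tmul x y => exact ⟨[(x, y)], by simp [PTensor.ofList]⟩
  | add a b ha hb =>
    obtain ⟨l, hl⟩ := ha
    obtain ⟨l', hl'⟩ := hb
    refine ⟨l ++ l', ?_⟩
    rw [map_add, ← hl, ← hl']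
    simp [PTensor.ofList]

/-- The costs of the presentations of `v`. -/
def projCosts (p : Seminorm 𝕜 E) (q : Seminorm 𝕜 F) {K : Submodule 𝕜 (E ⊗[𝕜] F)}
    (v : PTensor K) : Set ℝ :=
  {c | ∃ l, PTensor.ofList K l = v ∧ c = projCost p q l}

theorem projCosts_nonempty (p : Seminorm 𝕜 E) (q : Seminorm 𝕜 F) {K : Submodule 𝕜 (E ⊗[𝕜] F)}
    (v : PTensor K) : (projCosts p q v).Nonempty := by
  obtain ⟨l, hl⟩ := PTensor.exists_ofList K v
  exact ⟨_, l, hl, rfl⟩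

theorem projCosts_bddBelow (p : Seminorm 𝕜 E) (q : Seminorm 𝕜 F) {K : Submodule 𝕜 (E ⊗[𝕜] F)}
    (v : PTensor K) : BddBelow (projCosts p q v) := by
  refine ⟨0, ?_⟩
  rintro c ⟨l, -, rfl⟩
  exact projCost_nonneg p q l

/-- The projective tensor product of two seminorms,
`v ↦ inf {∑ a, p e_a * q f_a | v = ∑ a, e_a ⊗ f_a}`. -/
noncomputable def projSeminorm (p : Seminorm 𝕜 E) (q : Seminorm 𝕜 F)
    (K : Submodule 𝕜 (E ⊗[𝕜] F)) : Seminorm 𝕜 (PTensor K) :=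
  Seminorm.ofSMulLE (fun v => sInf (projCosts p q v))
    (by
      refine le_antisymm (csInf_le (projCosts_bddBelow p q 0) ⟨[], ?_, ?_⟩)
        (Real.sInf_nonneg ?_)
      · simp [PTensor.ofList]
      · simp [projCost]
      · rintro c ⟨l, -, rfl⟩
        exact projCost_nonneg p q l)
    (by
      intro v w
      refine le_of_forall_pos_le_add fun ε hε => ?_
      obtain ⟨a, ⟨l, hl, rfl⟩, ha⟩ := exists_lt_of_csInf_lt (projCosts_nonempty p q v)
        (lt_add_of_pos_right (sInf (projCosts p q v)) (half_pos hε))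
      obtain ⟨b, ⟨l', hl', rfl⟩, hb⟩ := exists_lt_of_csInf_lt (projCosts_nonempty p q w)
        (lt_add_of_pos_right (sInf (projCosts p q w)) (half_pos hε))
      have h : sInf (projCosts p q (v + w)) ≤ projCost p q (l ++ l') :=
        csInf_le (projCosts_bddBelow p q _) ⟨_, by rw [← hl, ← hl']; simp [PTensor.ofList], rfl⟩
      have h' : projCost p q (l ++ l') = projCost p q l + projCost p q l' := by simp [projCost]
      linarith)
    (by
      intro c v
      refine le_of_forall_pos_le_add fun ε hε => ?_
      have hc : 0 < ‖c‖ + 1 := by positivity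
      obtain ⟨a, ⟨l, hl, rfl⟩, ha⟩ := exists_lt_of_csInf_lt (projCosts_nonempty p q v)
        (lt_add_of_pos_right (sInf (projCosts p q v)) (div_pos hε hc))
      have h : sInf (projCosts p q (c • v)) ≤ projCost p q (l.map fun x => (c • x.1, x.2)) := by
        refine csInf_le (projCosts_bddBelow p q _) ⟨_, ?_, rfl⟩
        rw [← hl]
        simp only [PTensor.ofList, List.map_map, ← map_smul, List.smul_sum]
        rfl
      have h' : projCost p q (l.map fun x => (c • x.1, x.2)) = ‖c‖ * projCost p q l := by
        simp only [projCost, List.map_map, ← List.sum_map_mul_left]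
        congr 1
        refine List.map_congr_left fun x _ => ?_
        simp [map_smul_eq_mul, mul_assoc]
      have h2 : ‖c‖ * projCost p q l ≤ ‖c‖ * (sInf (projCosts p q v) + ε / (‖c‖ + 1)) := by
        gcongr
      have h3 : ‖c‖ * (ε / (‖c‖ + 1)) ≤ ε := by
        rw [mul_div_assoc', div_le_iff₀ hc]
        nlinarith [norm_nonneg c]
      rw [h'] at h
      linarith)

theorem projSeminorm_le (p : Seminorm 𝕜 E) (q : Seminorm 𝕜 F) {K : Submodule 𝕜 (E ⊗[𝕜] F)}
    (l : List (E × F)) : projSeminorm p q K (PTensor.ofList K l) ≤ projCost p q l :=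
  csInf_le (projCosts_bddBelow p q _) ⟨l, rfl, rfl⟩

theorem projSeminorm_pure (p : Seminorm 𝕜 E) (q : Seminorm 𝕜 F) (K : Submodule 𝕜 (E ⊗[𝕜] F))
    (x : E) (y : F) : projSeminorm p q K (PTensor.mk K (x ⊗ₜ y)) ≤ p x * q y := by
  have := projSeminorm_le p q (K := K) [(x, y)]
  simpa [PTensor.ofList, projCost] using this

theorem le_projSeminorm (p : Seminorm 𝕜 E) (q : Seminorm 𝕜 F) {K : Submodule 𝕜 (E ⊗[𝕜] F)}
    (v : PTensor K) (c : ℝ) (h : ∀ l, PTensor.ofList K l = v → c ≤ projCost p q l) :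
    c ≤ projSeminorm p q K v := by
  refine le_csInf (projCosts_nonempty p q v) ?_
  rintro _ ⟨l, hl, rfl⟩
  exact h l hl

/-- Bounding a seminorm composed with a linear map by its values on pure tensors. -/
theorem seminorm_le_projSeminorm (p : Seminorm 𝕜 E) (q : Seminorm 𝕜 F)
    {K : Submodule 𝕜 (E ⊗[𝕜] F)} (r : Seminorm 𝕜 (PTensor K)) (C : ℝ) (hC : 0 ≤ C)
    (h : ∀ x y, r (PTensor.mk K (x ⊗ₜ y)) ≤ C * (p x * q y)) (v : PTensor K) :
    r v ≤ C * projSeminorm p q K v := by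
  have key : ∀ l, r (PTensor.ofList K l) ≤ C * projCost p q l := by
    intro l
    induction l with
    | nil => simp [PTensor.ofList, projCost]
    | cons x l ih =>
      have h1 : PTensor.ofList K (x :: l) =
          PTensor.mk K (x.1 ⊗ₜ x.2) + PTensor.ofList K l := by simp [PTensor.ofList]
      have h2 : projCost p q (x :: l) = p x.1 * q x.2 + projCost p q l := by simp [projCost]
      rw [h1, h2, mul_add]
      exact (map_add_le_add r _ _).trans (add_le_add (h _ _) ih)
  rcases hC.eq_or_lt with rfl | hC'
  · obtain ⟨l, rfl⟩ := PTensor.exists_ofList K v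
    simpa using key l
  · rw [← div_le_iff₀' hC']
    refine le_projSeminorm p q v _ ?_
    rintro l rfl
    rw [div_le_iff₀' hC']
    exact key l

section Topology

variable [UniformSpace E] [UniformSpace F] [UniformSpace E'] [UniformSpace F']

/-- The seminorms which define the projective tensor product topology. -/
noncomputable def projFamily (K : Submodule 𝕜 (E ⊗[𝕜] F)) :
    SeminormFamily 𝕜 (PTensor K)
      ({p : Seminorm 𝕜 E // Continuous p} × {q : Seminorm 𝕜 F // Continuous q}) :=
  fun i => projSeminorm i.1.1 i.2.1 K

/-- The projective tensor product topology on (a quotient of) `E ⊗ F`. -/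
noncomputable instance (K : Submodule 𝕜 (E ⊗[𝕜] F)) : UniformSpace (PTensor K) :=
  ⨅ i, (projFamily K i).toSeminormedAddCommGroup.toUniformSpace

instance (K : Submodule 𝕜 (E ⊗[𝕜] F)) : IsUniformAddGroup (PTensor K) :=
  isUniformAddGroup_iInf fun _ => inferInstance

theorem withSeminorms_projFamily (K : Submodule 𝕜 (E ⊗[𝕜] F)) : WithSeminorms (projFamily K) :=
  (SeminormFamily.withSeminorms_iff_uniformSpace_eq_iInf (projFamily K)).2 rfl

instance (K : Submodule 𝕜 (E ⊗[𝕜] F)) : PolynormableSpace 𝕜 (PTensor K) :=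
  (withSeminorms_projFamily K).toPolynormableSpace

instance (K : Submodule 𝕜 (E ⊗[𝕜] F)) : ContinuousSMul 𝕜 (PTensor K) :=
  (withSeminorms_projFamily K).continuousSMul

instance (K : Submodule 𝕜 (E ⊗[𝕜] F)) : UniformContinuousConstSMul 𝕜 (PTensor K) :=
  uniformContinuousConstSMul_of_continuousConstSMul 𝕜 (PTensor K)

theorem exists_seminorm_le [IsUniformAddGroup E] [IsUniformAddGroup F] (K : Submodule 𝕜 (E ⊗[𝕜] F)) (r : Seminorm 𝕜 (PTensor K))
    (hr : Continuous r) : ∃ (p : Seminorm 𝕜 E) (q : Seminorm 𝕜 F) (C : ℝ), Continuous p ∧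
      Continuous q ∧ 0 ≤ C ∧ ∀ v, r v ≤ C * projSeminorm p q K v := by
  obtain ⟨s, C, -, hC⟩ := Seminorm.bound_of_continuous (withSeminorms_projFamily K) r hr
  refine ⟨s.sup fun i => i.1.1, s.sup fun i => i.2.1, C,
    Seminorm.continuous_finsetSup fun i _ => i.1.2,
    Seminorm.continuous_finsetSup fun i _ => i.2.2, C.2, ?_⟩
  refine seminorm_le_projSeminorm _ _ r C C.2 fun x y => (hC _).trans ?_
  refine mul_le_mul_of_nonneg_left (Seminorm.finset_sup_apply_le (by positivity) ?_) C.2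
  intro i hi
  have h1 : projFamily K i (PTensor.mk K (x ⊗ₜ y)) ≤ i.1.1 x * i.2.1 y := by
    have := projSeminorm_le i.1.1 i.2.1 (K := K) [(x, y)]
    simpa [PTensor.ofList, projCost, projFamily] using this
  refine h1.trans (mul_le_mul ?_ ?_ (apply_nonneg _ _) (apply_nonneg _ _))
  · exact Seminorm.le_finset_sup_apply (p := fun i :
      {p : Seminorm 𝕜 E // Continuous p} × {q : Seminorm 𝕜 F // Continuous q} => i.1.1) hi
  · exact Seminorm.le_finset_sup_apply (p := fun i :
      {p : Seminorm 𝕜 E // Continuous p} × {q : Seminorm 𝕜 F // Continuous q} => i.2.1) hi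

end Topology

end Tensor

section Completion

variable {𝕜 : Type v} [RCLike 𝕜] {X : Type u} [AddCommGroup X] [Module 𝕜 X] [UniformSpace X]
  [IsUniformAddGroup X] [UniformContinuousConstSMul 𝕜 X]

/-- The extension of a continuous seminorm to the completion. -/
noncomputable def Seminorm.completion (p : Seminorm 𝕜 X) (hp : UniformContinuous p) :
    Seminorm 𝕜 (Completion X) :=
  Seminorm.of (Completion.extension p)
    (by
      intro x y
      induction x, y using Completion.induction_on₂ with
      | hp =>
        exact isClosed_le (Completion.continuous_extension.comp continuous_add)
          ((Completion.continuous_extension.comp continuous_fst).add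
            (Completion.continuous_extension.comp continuous_snd))
      | ih x y =>
        rw [← Completion.coe_add]
        simp only [Completion.extension_coe hp]
        exact map_add_le_add p x y)
    (by
      intro c x
      induction x using Completion.induction_on with
      | hp =>
        exact isClosed_eq (Completion.continuous_extension.comp (continuous_const_smul c))
          (continuous_const.mul Completion.continuous_extension)
      | ih x =>
        rw [← Completion.coe_smul]
        simp only [Completion.extension_coe hp]
        exact map_smul_eq_mul p c x)

theorem Seminorm.completion_coe (p : Seminorm 𝕜 X) (hp : UniformContinuous p) (x : X) :
    p.completion hp x = p x := Completion.extension_coe hp x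

instance [PolynormableSpace 𝕜 X] : PolynormableSpace 𝕜 (Completion X) where
  withSeminorms' := by
    rw [SeminormFamily.withSeminorms_iff_nhds_eq_iInf]
    refine le_antisymm ?_ ?_
    · simp_rw [le_iInf_iff, ← tendsto_iff_comap]
      intro ⟨p, hp⟩
      exact hp.tendsto' 0 0 (map_zero _)
    · intro U hU
      obtain ⟨V, hV, hVc, hVU⟩ := exists_mem_nhds_isClosed_subset hU
      have h0 : ((↑) : X → Completion X) ⁻¹' V ∈ 𝓝 (0 : X) :=
        (Completion.continuous_coe X).continuousAt.preimage_mem_nhds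
          (by rwa [Completion.coe_zero])
      obtain ⟨p, hp, hpV⟩ := exists_seminorm_of_mem_nhds (𝕜 := 𝕜) h0
      have hpu := Seminorm.uniformContinuous_of_continuousAt_zero hp.continuousAt
      refine mem_iInf_of_mem ⟨p.completion hpu, Completion.continuous_extension⟩ ?_
      refine ⟨Set.Iio 1, Iio_mem_nhds one_pos, fun x hx => hVU ?_⟩
      have hop : IsOpen {y : Completion X | p.completion hpu y < 1} :=
        isOpen_lt Completion.continuous_extension continuous_const
      have hcl := Completion.denseRange_coe.open_subset_closure_inter hop hx
      refine hVc.closure_subset_iff.2 ?_ hcl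
      rintro _ ⟨hy, y, rfl⟩
      refine hpV y ?_
      rwa [Set.mem_ofPred_eq, Seminorm.completion_coe] at hy

instance [PolynormableSpace 𝕜 X] : Clct 𝕜 (Completion X) where

end Completion

section CTensor

variable {𝕜 : Type v} [RCLike 𝕜]
variable {E : Type u} [AddCommGroup E] [Module 𝕜 E] [UniformSpace E]
variable {F : Type u} [AddCommGroup F] [Module 𝕜 F] [UniformSpace F]
variable {E' : Type u} [AddCommGroup E'] [Module 𝕜 E'] [UniformSpace E']
variable {F' : Type u} [AddCommGroup F'] [Module 𝕜 F'] [UniformSpace F']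

/-- The Hausdorff completion of `(E ⊗ F) / K` for the projective tensor product topology.
For `K = ⊥` this is the completed projective tensor product `E ⊗̂ F`; in general it is the
cokernel of `K → E ⊗̂ F` in the category of clct spaces. -/
abbrev CTensor (K : Submodule 𝕜 (E ⊗[𝕜] F)) : Type u := Completion (PTensor K)

/-- The completed projective tensor product. -/
abbrev CTensor₀ (𝕜 : Type v) [RCLike 𝕜] (E : Type u) [AddCommGroup E] [Module 𝕜 E]
    [UniformSpace E] (F : Type u) [AddCommGroup F] [Module 𝕜 F] [UniformSpace F] : Type u :=
  CTensor (⊥ : Submodule 𝕜 (E ⊗[𝕜] F))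

/-- The class of `x ⊗ y`. -/
noncomputable def CTensor.tmul (K : Submodule 𝕜 (E ⊗[𝕜] F)) (x : E) (y : F) : CTensor K :=
  ((PTensor.mk K (x ⊗ₜ y) : PTensor K) : CTensor K)

/-- The canonical map to the completion. -/
noncomputable def CTensor.coeL (K : Submodule 𝕜 (E ⊗[𝕜] F)) : PTensor K →L[𝕜] CTensor K where
  toFun v := v
  map_add' _ _ := Completion.coe_add _ _
  map_smul' _ _ := Completion.coe_smul _ _
  cont := Completion.continuous_coe _

/-- The map of algebraic tensor products induced by `φ` and `ψ`. -/
noncomputable def PTensor.mapₗ (K : Submodule 𝕜 (E ⊗[𝕜] F)) (K' : Submodule 𝕜 (E' ⊗[𝕜] F'))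
    (φ : E →L[𝕜] E') (ψ : F →L[𝕜] F')
    (h : K ≤ K'.comap (TensorProduct.map φ.toLinearMap ψ.toLinearMap)) :
    PTensor K →ₗ[𝕜] PTensor K' :=
  K.mapQ K' (TensorProduct.map φ.toLinearMap ψ.toLinearMap) h

theorem PTensor.mapₗ_mk {K : Submodule 𝕜 (E ⊗[𝕜] F)} {K' : Submodule 𝕜 (E' ⊗[𝕜] F')}
    (φ : E →L[𝕜] E') (ψ : F →L[𝕜] F')
    (h : K ≤ K'.comap (TensorProduct.map φ.toLinearMap ψ.toLinearMap)) (x : E) (y : F) :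
    PTensor.mapₗ K K' φ ψ h (PTensor.mk K (x ⊗ₜ y)) = PTensor.mk K' (φ x ⊗ₜ ψ y) := rfl

/-- The continuous map of projective tensor products induced by `φ` and `ψ`. -/
noncomputable def PTensor.map (K : Submodule 𝕜 (E ⊗[𝕜] F)) (K' : Submodule 𝕜 (E' ⊗[𝕜] F'))
    (φ : E →L[𝕜] E') (ψ : F →L[𝕜] F')
    (h : K ≤ K'.comap (TensorProduct.map φ.toLinearMap ψ.toLinearMap)) :
    PTensor K →L[𝕜] PTensor K' where
  toLinearMap := PTensor.mapₗ K K' φ ψ h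
  cont := by
    refine (withSeminorms_projFamily K').continuous_of_continuous_comp _ fun i => ?_
    let p : Seminorm 𝕜 E := i.1.1.comp φ.toLinearMap
    let q : Seminorm 𝕜 F := i.2.1.comp ψ.toLinearMap
    have hc : Continuous (projSeminorm p q K) :=
      (withSeminorms_projFamily K).continuous_seminorm
        (⟨⟨p, i.1.2.comp φ.continuous⟩, ⟨q, i.2.2.comp ψ.continuous⟩⟩)
    refine Seminorm.continuous_of_le hc fun v => ?_
    have := seminorm_le_projSeminorm p q ((projFamily K' i).comp (PTensor.mapₗ K K' φ ψ h)) 1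
      zero_le_one (fun x y => by
        rw [one_mul]
        exact projSeminorm_pure i.1.1 i.2.1 K' (φ x) (ψ y)) v
    rwa [one_mul] at this

/-- The map `φ ⊗ ψ` on completed tensor products. -/
noncomputable def CTensor.map (K : Submodule 𝕜 (E ⊗[𝕜] F)) (K' : Submodule 𝕜 (E' ⊗[𝕜] F'))
    (φ : E →L[𝕜] E') (ψ : F →L[𝕜] F')
    (h : K ≤ K'.comap (TensorProduct.map φ.toLinearMap ψ.toLinearMap)) :
    CTensor K →L[𝕜] CTensor K' :=
  (PTensor.map K K' φ ψ h).completion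

@[simp]
theorem CTensor.map_tmul {K : Submodule 𝕜 (E ⊗[𝕜] F)} {K' : Submodule 𝕜 (E' ⊗[𝕜] F')}
    (φ : E →L[𝕜] E') (ψ : F →L[𝕜] F')
    (h : K ≤ K'.comap (TensorProduct.map φ.toLinearMap ψ.toLinearMap)) (x : E) (y : F) :
    CTensor.map K K' φ ψ h (CTensor.tmul K x y) = CTensor.tmul K' (φ x) (ψ y) :=
  ContinuousLinearMap.completion_apply_coe _ _

/-- Continuous linear maps which agree on pure tensors are equal. -/
theorem CTensor.ext {K : Submodule 𝕜 (E ⊗[𝕜] F)} {G : Type u} [AddCommGroup G] [Module 𝕜 G]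
    [TopologicalSpace G] [T2Space G] (a b : CTensor K →L[𝕜] G)
    (h : ∀ x y, a (CTensor.tmul K x y) = b (CTensor.tmul K x y)) (z : CTensor K) : a z = b z := by
  induction z using Completion.induction_on with
  | hp => exact isClosed_eq a.continuous b.continuous
  | ih v =>
    obtain ⟨t, rfl⟩ := PTensor.mk_surjective K v
    induction t with
    | zero => rw [map_zero, Completion.coe_zero, map_zero, map_zero]
    | tmul x y => exact h x y
    | add s t hs ht => rw [map_add, Completion.coe_add, map_add, map_add, hs, ht]

/-- For fixed `y`, the map `x ↦ x ⊗ y`. -/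
noncomputable def CTensor.inl [IsUniformAddGroup E] (K : Submodule 𝕜 (E ⊗[𝕜] F)) (y : F) : E →L[𝕜] CTensor K where
  toFun x := CTensor.tmul K x y
  map_add' a b := by simp [CTensor.tmul, TensorProduct.add_tmul, Completion.coe_add]
  map_smul' c a := by simp [CTensor.tmul, ← TensorProduct.smul_tmul']
  cont := by
    refine (Completion.continuous_coe _).comp ?_
    let f : E →ₗ[𝕜] PTensor K := (PTensor.mk K).comp ((TensorProduct.mk 𝕜 E F).flip y)
    refine (withSeminorms_projFamily K).continuous_of_continuous_comp f fun i => ?_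
    refine Seminorm.continuous_of_le
      (Continuous.const_smul i.1.2 (‖i.2.1 y‖₊)) (q := ‖i.2.1 y‖₊ • i.1.1) fun x => ?_
    refine (projSeminorm_pure i.1.1 i.2.1 K x y).trans ?_
    rw [mul_comm]
    exact mul_le_mul_of_nonneg_right (le_abs_self _) (apply_nonneg _ _)

/-- For fixed `x`, the map `y ↦ x ⊗ y`. -/
noncomputable def CTensor.inr [IsUniformAddGroup F] (K : Submodule 𝕜 (E ⊗[𝕜] F)) (x : E) : F →L[𝕜] CTensor K where
  toFun y := CTensor.tmul K x y
  map_add' a b := by simp [CTensor.tmul, TensorProduct.tmul_add, Completion.coe_add]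
  map_smul' c a := by simp [CTensor.tmul]
  cont := by
    refine (Completion.continuous_coe _).comp ?_
    let f : F →ₗ[𝕜] PTensor K := (PTensor.mk K).comp (TensorProduct.mk 𝕜 E F x)
    refine (withSeminorms_projFamily K).continuous_of_continuous_comp f fun i => ?_
    refine Seminorm.continuous_of_le
      (Continuous.const_smul i.2.2 (‖i.1.1 x‖₊)) (q := ‖i.1.1 x‖₊ • i.2.1) fun y => ?_
    refine (projSeminorm_pure i.1.1 i.2.1 K x y).trans ?_
    exact mul_le_mul_of_nonneg_right (le_abs_self _) (apply_nonneg _ _)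

end CTensor

section Estimates

variable {𝕜 : Type v} [RCLike 𝕜]

theorem exists_seminorm_mul {S : Type u} [Ring S] [Algebra 𝕜 S] [UniformSpace S] [Clct 𝕜 S]
    [ContinuousMul S] (q : Seminorm 𝕜 S) (hq : Continuous q) :
    ∃ q₁ : Seminorm 𝕜 S, Continuous q₁ ∧ ∀ s t, q (s * t) ≤ q₁ s * q₁ t := by
  have h0 : {x : S × S | q (x.1 * x.2) < 1} ∈ 𝓝 ((0 : S), (0 : S)) := by
    refine (isOpen_lt (hq.comp continuous_mul) continuous_const).mem_nhds ?_
    simp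
  rw [nhds_prod_eq] at h0
  obtain ⟨U, hU, V, hV, hUV⟩ := mem_prod_iff.1 h0
  obtain ⟨p, hp, hpU⟩ := exists_seminorm_of_mem_nhds (𝕜 := 𝕜) hU
  obtain ⟨p', hp', hpV⟩ := exists_seminorm_of_mem_nhds (𝕜 := 𝕜) hV
  refine ⟨p + p', hp.add hp', fun s t => ?_⟩
  have key : ∀ ε : ℝ, 0 < ε → q (s * t) ≤ ((p + p') s + ε) * ((p + p') t + ε) := by
    intro ε hε
    set a := (p + p') s + ε with ha
    set b := (p + p') t + ε with hb
    have ha0 : 0 < a := by positivity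
    have hb0 : 0 < b := by positivity
    have hs : ((a⁻¹ : ℝ) : 𝕜) • s ∈ U := by
      refine hpU _ ?_
      rw [map_smul_eq_mul, RCLike.norm_ofReal, abs_of_pos (inv_pos.2 ha0),
        inv_mul_lt_iff₀ ha0, mul_one, ha, add_apply]
      linarith [apply_nonneg p' s]
    have ht : ((b⁻¹ : ℝ) : 𝕜) • t ∈ V := by
      refine hpV _ ?_
      rw [map_smul_eq_mul, RCLike.norm_ofReal, abs_of_pos (inv_pos.2 hb0),
        inv_mul_lt_iff₀ hb0, mul_one, hb, add_apply]
      linarith [apply_nonneg p t]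
    have h : q ((((a⁻¹ : ℝ) : 𝕜) • s) * (((b⁻¹ : ℝ) : 𝕜) • t)) < 1 :=
      hUV (Set.mk_mem_prod hs ht)
    rw [smul_mul_smul_comm, map_smul_eq_mul, norm_mul, RCLike.norm_ofReal, RCLike.norm_ofReal,
      abs_of_pos (inv_pos.2 ha0), abs_of_pos (inv_pos.2 hb0), ← mul_inv,
      inv_mul_lt_iff₀ (by positivity), mul_one] at h
    exact h.le
  have hlim : Tendsto (fun ε : ℝ => ((p + p') s + ε) * ((p + p') t + ε)) (𝓝[>] 0)
      (𝓝 (((p + p') s + 0) * ((p + p') t + 0))) :=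
    (Continuous.tendsto (by fun_prop) 0).mono_left nhdsWithin_le_nhds
  rw [add_zero, add_zero] at hlim
  refine ge_of_tendsto hlim ?_
  filter_upwards [self_mem_nhdsWithin] with ε hε
  exact key ε hε

theorem continuous_bilin {X Y Z : Type u} [AddCommGroup X] [Module 𝕜 X] [UniformSpace X]
    [IsUniformAddGroup X]
    [AddCommGroup Y] [Module 𝕜 Y] [UniformSpace Y] [IsUniformAddGroup Y]
    [AddCommGroup Z] [Module 𝕜 Z] [UniformSpace Z] [IsUniformAddGroup Z] [PolynormableSpace 𝕜 Z]
    (b : X →ₗ[𝕜] Y →ₗ[𝕜] Z)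
    (h : ∀ r : Seminorm 𝕜 Z, Continuous r → ∃ (p : Seminorm 𝕜 X) (q : Seminorm 𝕜 Y),
      Continuous p ∧ Continuous q ∧ ∀ x y, r (b x y) ≤ p x * q y) :
    Continuous fun z : X × Y => b z.1 z.2 := by
  rw [continuous_iff_continuousAt]
  rintro ⟨x₀, y₀⟩
  refine ((PolynormableSpace.withSeminorms 𝕜 Z).tendsto_nhds' _ _).2 ?_
  intro s ε hε
  let r : Seminorm 𝕜 Z := s.sup fun p : {p : Seminorm 𝕜 Z // Continuous p} => p.1
  have hr : Continuous r := Seminorm.continuous_finsetSup fun i _ => i.2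
  obtain ⟨p, q, hp, hq, hb⟩ := h r hr
  have hlim : Tendsto (fun z : X × Y => p (z.1 - x₀) * q z.2 + p x₀ * q (z.2 - y₀)) (𝓝 (x₀, y₀))
      (𝓝 (p (x₀ - x₀) * q y₀ + p x₀ * q (y₀ - y₀))) := by
    refine Continuous.tendsto ?_ (x₀, y₀)
    have h1 : Continuous fun z : X × Y => p (z.1 - x₀) := hp.comp (by fun_prop)
    have h2 : Continuous fun z : X × Y => q z.2 := hq.comp (by fun_prop)
    have h3 : Continuous fun z : X × Y => q (z.2 - y₀) := hq.comp (by fun_prop)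
    fun_prop
  simp only [sub_self, map_zero, zero_mul, mul_zero, add_zero] at hlim
  filter_upwards [hlim.eventually (gt_mem_nhds hε)] with z hz
  have he : b z.1 z.2 - b x₀ y₀ = b (z.1 - x₀) z.2 + b x₀ (z.2 - y₀) := by
    simp only [map_sub, LinearMap.sub_apply]
    abel
  change r (b z.1 z.2 - b x₀ y₀) < ε
  rw [he]
  exact ((map_add_le_add _ _ _).trans (add_le_add (hb _ _) (hb _ _))).trans_lt hz

theorem Grading.exists_finset {E : Type u} [AddCommGroup E] [Module 𝕜 E] [UniformSpace E]
    [Clct 𝕜 E] (g : Grading 𝕜 E) (r : Seminorm 𝕜 E) (hr : Continuous r) :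
    ∃ S : Finset ℤ, ∀ x, r (x - ∑ n ∈ S, g.proj n x) = 0 := by
  have h0 : {x : E | r x < 1} ∈ 𝓝 (0 : E) :=
    (isOpen_lt hr continuous_const).mem_nhds (by simp)
  rw [g.inducing.nhds_eq_comap, mem_comap] at h0
  obtain ⟨T, hT, hTr⟩ := h0
  rw [nhds_pi, mem_pi] at hT
  obtain ⟨I, hI, V, hV, hVT⟩ := hT
  refine ⟨hI.toFinset, fun x => ?_⟩
  set y := x - ∑ n ∈ hI.toFinset, g.proj n x with hy
  have hy0 : ∀ m ∈ I, g.proj m y = 0 := by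
    intro m hm
    rw [hy, map_sub, g.proj_sum _ _ (fun n => g.homog_proj n x), if_pos (by simpa using hm),
      sub_self]
  have hlt : ∀ c : 𝕜, r (c • y) < 1 := by
    intro c
    refine hTr (hVT ?_)
    intro m hm
    simp only [map_smul, hy0 m hm, smul_zero]
    simpa using mem_of_mem_nhds (hV m)
  by_contra hne
  have hpos : 0 < r y := lt_of_le_of_ne (apply_nonneg r y) (Ne.symm hne)
  have := hlt (((r y)⁻¹ : ℝ) : 𝕜)
  rw [map_smul_eq_mul, RCLike.norm_ofReal, abs_of_pos (inv_pos.2 hpos),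
    inv_mul_cancel₀ hpos.ne'] at this
  exact lt_irrefl _ this

theorem inducing_of_seminorm {E : Type u} [AddCommGroup E] [Module 𝕜 E] [UniformSpace E]
    [Clct 𝕜 E] (P : ℤ → E →L[𝕜] E)
    (h : ∀ r : Seminorm 𝕜 E, Continuous r →
      ∃ S : Finset ℤ, ∀ x, r (x - ∑ n ∈ S, P n x) = 0) :
    IsInducing fun (x : E) (n : ℤ) => P n x := by
  let f : E →ₗ[𝕜] (ℤ → E) := LinearMap.pi fun n => (P n).toLinearMap
  change IsInducing f
  have hf : Continuous f := continuous_pi fun n => (P n).continuous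
  rw [IsTopologicalAddGroup.isInducing_iff_nhds_zero]
  refine le_antisymm (by
    have := hf.tendsto 0
    rw [map_zero] at this
    exact tendsto_iff_comap.1 this) ?_
  have hw := PolynormableSpace.withSeminorms 𝕜 E
  rw [(SeminormFamily.withSeminorms_iff_nhds_eq_iInf _).1 hw, le_iInf_iff]
  rintro ⟨r, hr⟩
  rw [← tendsto_iff_comap]
  obtain ⟨S, hS⟩ := h r hr
  have h1 : Tendsto (fun x => r (∑ n ∈ S, P n x)) (comap f (𝓝 0)) (𝓝 0) := by
    have h2 : Tendsto (fun y : ℤ → E => r (∑ n ∈ S, y n)) (𝓝 0) (𝓝 0) := by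
      refine (hr.comp (continuous_finsetSum S fun n _ => continuous_apply n)).tendsto' 0 0 ?_
      simp
    exact h2.comp tendsto_comap
  refine tendsto_of_tendsto_of_tendsto_of_le_of_le tendsto_const_nhds h1
    (fun x => apply_nonneg r x) fun x => ?_
  have h3 := map_add_le_add r (x - ∑ n ∈ S, P n x) (∑ n ∈ S, P n x)
  rwa [sub_add_cancel, hS x, zero_add] at h3

end Estimates

section TensorStructure

set_option linter.unusedSectionVars false

variable {𝕜 : Type v} [RCLike 𝕜]
variable {E : Type u} [AddCommGroup E] [Module 𝕜 E] [UniformSpace E] [Clct 𝕜 E]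
variable {S : Type u} [Ring S] [Algebra 𝕜 S] [UniformSpace S] [Clct 𝕜 S] [ContinuousMul S]

/-- Right multiplication by `s`. -/
def mulRightL (s : S) : S →L[𝕜] S where
  toFun x := x * s
  map_add' x y := add_mul x y s
  map_smul' c x := smul_mul_assoc c x s
  cont := continuous_mul_const s

/-- The subspace `K` of `E ⊗ S` is stable under `1 ⊗ (· * s)`. -/
def RightStable (K : Submodule 𝕜 (E ⊗[𝕜] S)) : Prop :=
  ∀ s : S, K ≤ K.comap (TensorProduct.map (ContinuousLinearMap.id 𝕜 E).toLinearMap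
    (mulRightL (𝕜 := 𝕜) s).toLinearMap)

/-- The action of `s` on `E ⊗̂ S` by multiplication on the second factor. -/
noncomputable def CTensor.right (K : Submodule 𝕜 (E ⊗[𝕜] S)) (hK : RightStable K) (s : S) :
    CTensor K →L[𝕜] CTensor K :=
  CTensor.map K K (ContinuousLinearMap.id 𝕜 E) (mulRightL s) (hK s)

@[simp]
theorem CTensor.right_tmul {K : Submodule 𝕜 (E ⊗[𝕜] S)} (hK : RightStable K) (s : S) (x : E)
    (t : S) : CTensor.right K hK s (CTensor.tmul K x t) = CTensor.tmul K x (t * s) :=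
  CTensor.map_tmul _ _ _ _ _

theorem CTensor.tmul_add (K : Submodule 𝕜 (E ⊗[𝕜] S)) (x : E) (s t : S) :
    CTensor.tmul K x (s + t) = CTensor.tmul K x s + CTensor.tmul K x t :=
  map_add (CTensor.inr K x) s t

/-- The action as a bilinear map. -/
noncomputable def CTensor.rightₗ (K : Submodule 𝕜 (E ⊗[𝕜] S)) (hK : RightStable K) :
    S →ₗ[𝕜] CTensor K →ₗ[𝕜] CTensor K :=
  LinearMap.mk₂ 𝕜 (fun s z => CTensor.right K hK s z)
    (fun s t z => CTensor.ext (CTensor.right K hK (s + t))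
      (CTensor.right K hK s + CTensor.right K hK t)
      (fun x y => by simp [mul_add, CTensor.tmul_add]) z)
    (fun c s z => CTensor.ext (CTensor.right K hK (c • s)) (c • CTensor.right K hK s)
      (fun x y => by
        have h := map_smul (CTensor.inr K x) c (y * s)
        simp only [CTensor.right_tmul, mul_smul_comm, smul_apply]
        exact h) z)
    (fun s z w => map_add _ z w)
    (fun c s z => map_smul _ c z)

theorem CTensor.continuous_right (K : Submodule 𝕜 (E ⊗[𝕜] S)) (hK : RightStable K) :
    Continuous fun p : S × CTensor K => CTensor.right K hK p.1 p.2 := by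
  refine continuous_bilin (CTensor.rightₗ K hK) fun r hr => ?_
  let r₀ : Seminorm 𝕜 (PTensor K) := r.comp (CTensor.coeL K).toLinearMap
  have hr₀ : Continuous r₀ := hr.comp (CTensor.coeL K).continuous
  obtain ⟨p, q, C, hp, hq, hC, hb⟩ := exists_seminorm_le K r₀ hr₀
  obtain ⟨q₁, hq₁, hmul⟩ := exists_seminorm_mul (𝕜 := 𝕜) q hq
  have hpc : Continuous (projSeminorm p q₁ K) :=
    (withSeminorms_projFamily K).continuous_seminorm ⟨⟨p, hp⟩, ⟨q₁, hq₁⟩⟩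
  have hpu : UniformContinuous (projSeminorm p q₁ K) :=
    Seminorm.uniformContinuous_of_continuousAt_zero hpc.continuousAt
  let C' : NNReal := ⟨C, hC⟩
  refine ⟨q₁, C' • (projSeminorm p q₁ K).completion hpu, hq₁,
    Continuous.const_smul Completion.continuous_extension _, fun s z => ?_⟩
  change r (CTensor.right K hK s z) ≤ q₁ s * (C * (projSeminorm p q₁ K).completion hpu z)
  induction z using Completion.induction_on with
  | hp =>
    exact isClosed_le (hr.comp (CTensor.right K hK s).continuous)
      (continuous_const.mul (continuous_const.mul Completion.continuous_extension))
  | ih v =>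
    rw [Seminorm.completion_coe]
    have h1 : CTensor.right K hK s (v : CTensor K) =
        ((PTensor.map K K (ContinuousLinearMap.id 𝕜 E) (mulRightL s) (hK s) v : PTensor K) :
          CTensor K) := ContinuousLinearMap.completion_apply_coe _ _
    rw [h1]
    refine (hb _).trans ?_
    rw [mul_left_comm]
    refine mul_le_mul_of_nonneg_left ?_ hC
    refine seminorm_le_projSeminorm p q₁ ((projSeminorm p q K).comp
      (PTensor.mapₗ K K (ContinuousLinearMap.id 𝕜 E) (mulRightL s) (hK s))) (q₁ s)
      (apply_nonneg _ _) (fun x y => ?_) v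
    refine (projSeminorm_pure p q K x (y * s)).trans ?_
    have h2 := mul_le_mul_of_nonneg_left (hmul y s) (apply_nonneg p x)
    linarith

/-- The right `S`-module structure of the completed tensor product. -/
@[reducible]
noncomputable def CTensor.moduleOp (K : Submodule 𝕜 (E ⊗[𝕜] S)) (hK : RightStable K) :
    Module Sᵐᵒᵖ (CTensor K) where
  smul s z := CTensor.right K hK s.unop z
  one_smul z := CTensor.ext (CTensor.right K hK 1) (ContinuousLinearMap.id 𝕜 _)
    (fun x y => by simp) z
  mul_smul s t z := CTensor.ext (CTensor.right K hK (t.unop * s.unop))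
    ((CTensor.right K hK s.unop).comp (CTensor.right K hK t.unop))
    (fun x y => by simp [mul_assoc]) z
  smul_zero s := map_zero (CTensor.right K hK s.unop)
  smul_add s z w := map_add (CTensor.right K hK s.unop) z w
  add_smul s t z := LinearMap.congr_fun (map_add (CTensor.rightₗ K hK) s.unop t.unop) z
  zero_smul z := LinearMap.congr_fun (map_zero (CTensor.rightₗ K hK)) z

theorem CTensor.tower_op (K : Submodule 𝕜 (E ⊗[𝕜] S)) (hK : RightStable K) :
    letI := CTensor.moduleOp K hK
    IsScalarTower 𝕜 Sᵐᵒᵖ (CTensor K) :=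
  letI := CTensor.moduleOp K hK
  ⟨fun c s z => LinearMap.congr_fun (map_smul (CTensor.rightₗ K hK) c s.unop) z⟩

theorem continuous_comp_unop {X Y Z : Type u} [TopologicalSpace X] [TopologicalSpace Y]
    [TopologicalSpace Z] {f : X × Y → Z} (hf : Continuous f) :
    Continuous fun p : Xᵐᵒᵖ × Y => f (p.1.unop, p.2) :=
  hf.comp ((MulOpposite.continuous_unop.comp continuous_fst).prodMk continuous_snd)

theorem CTensor.continuous_unop_right (K : Submodule 𝕜 (E ⊗[𝕜] S)) (hK : RightStable K) :
    Continuous fun p : Sᵐᵒᵖ × CTensor K => CTensor.right K hK p.1.unop p.2 :=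
  continuous_comp_unop (CTensor.continuous_right K hK)

theorem CTensor.continuousSMul_op (K : Submodule 𝕜 (E ⊗[𝕜] S)) (hK : RightStable K) :
    letI := CTensor.moduleOp K hK
    ContinuousSMul Sᵐᵒᵖ (CTensor K) := by
  let := CTensor.moduleOp K hK
  refine @ContinuousSMul.mk _ _ _ _ _ ?_
  exact CTensor.continuous_unop_right K hK

/-- The grading of `E ⊗̂ S` induced by a grading of `E`, where `S` is placed in degree `0`. -/
noncomputable def CTensor.grading (g : Grading 𝕜 E) (K : Submodule 𝕜 (E ⊗[𝕜] S))
    (hK : ∀ n, K ≤ K.comap (TensorProduct.map (g.proj n).toLinearMap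
      (ContinuousLinearMap.id 𝕜 S).toLinearMap)) : Grading 𝕜 (CTensor K) where
  proj n := CTensor.map K K (g.proj n) (ContinuousLinearMap.id 𝕜 S) (hK n)
  proj_proj i j z := by
    have h := CTensor.ext
      ((CTensor.map K K (g.proj i) (ContinuousLinearMap.id 𝕜 S) (hK i)).comp
        (CTensor.map K K (g.proj j) (ContinuousLinearMap.id 𝕜 S) (hK j)))
      (if i = j then CTensor.map K K (g.proj j) (ContinuousLinearMap.id 𝕜 S) (hK j) else 0)
      (fun x y => by
        by_cases hij : i = j
        · simp [hij, g.proj_proj]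
        · have h0 : CTensor.tmul K (0 : E) y = 0 := map_zero (CTensor.inl K y)
          simp [hij, g.proj_proj, h0]) z
    by_cases hij : i = j
    · simpa [hij] using h
    · simpa [hij] using h
  inducing := by
    refine inducing_of_seminorm _ fun r hr => ?_
    let r₀ : Seminorm 𝕜 (PTensor K) := r.comp (CTensor.coeL K).toLinearMap
    have hr₀ : Continuous r₀ := hr.comp (CTensor.coeL K).continuous
    obtain ⟨p, q, C, hp, hq, hC, hb⟩ := exists_seminorm_le K r₀ hr₀
    obtain ⟨T, hT⟩ := g.exists_finset p hp
    refine ⟨T, fun z => ?_⟩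
    let D : CTensor K →L[𝕜] CTensor K := ContinuousLinearMap.id 𝕜 _ -
      ∑ n ∈ T, CTensor.map K K (g.proj n) (ContinuousLinearMap.id 𝕜 S) (hK n)
    have hD : ∀ z, D z = z -
        ∑ n ∈ T, CTensor.map K K (g.proj n) (ContinuousLinearMap.id 𝕜 S) (hK n) z := by
      intro z
      simp [D]
    rw [← hD]
    induction z using Completion.induction_on with
    | hp => exact isClosed_eq (hr.comp D.continuous) continuous_const
    | ih v =>
      let r₁ : Seminorm 𝕜 (PTensor K) := (r.comp D.toLinearMap).comp (CTensor.coeL K).toLinearMap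
      have h1 := seminorm_le_projSeminorm p q r₁ 0 le_rfl (fun x y => by
        rw [zero_mul]
        have h2 : D (CTensor.tmul K x y) = CTensor.tmul K (x - ∑ n ∈ T, g.proj n x) y := by
          rw [hD]
          have h3 : CTensor.inl K y (x - ∑ n ∈ T, g.proj n x) =
              CTensor.inl K y x - ∑ n ∈ T, CTensor.inl K y (g.proj n x) := by
            rw [map_sub, map_sum]
          simp only [CTensor.map_tmul]
          exact h3.symm
        change r (D (CTensor.tmul K x y)) ≤ 0
        rw [h2]
        refine (hb _).trans ?_
        have h4 := projSeminorm_pure p q K (x - ∑ n ∈ T, g.proj n x) y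
        rw [hT, zero_mul] at h4
        exact mul_nonpos_of_nonneg_of_nonpos hC h4) v
      rw [zero_mul] at h1
      exact le_antisymm h1 (apply_nonneg _ _)

end TensorStructure

/-! ## The degree zero part and extension of scalars -/

section ZeroPart

variable {𝕜 : Type v} [RCLike 𝕜] (A : DGAlg.{v, u} 𝕜)

/-- The subalgebra of elements of degree `0`. -/
def DGAlg.zeroSub : Subalgebra 𝕜 A where
  carrier := {a | A.deg.Homog 0 a}
  mul_mem' {a b} ha hb := by
    have := A.mul_homog 0 0 a b ha hb
    rwa [add_zero] at this
  add_mem' {a b} ha hb := by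
    change A.deg.proj 0 (a + b) = a + b
    rw [map_add, show A.deg.proj 0 a = a from ha, show A.deg.proj 0 b = b from hb]
  algebraMap_mem' c := by
    change A.deg.proj 0 (algebraMap 𝕜 A c) = algebraMap 𝕜 A c
    rw [Algebra.algebraMap_eq_smul_one, map_smul, show A.deg.proj 0 1 = 1 from A.one_homog]

instance : IsUniformAddGroup A.zeroSub :=
  inferInstanceAs (IsUniformAddGroup (Subalgebra.toSubmodule A.zeroSub).toAddSubgroup)

instance : PolynormableSpace 𝕜 A.zeroSub :=
  inferInstanceAs (PolynormableSpace 𝕜 (Subalgebra.toSubmodule A.zeroSub))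

instance : CompleteSpace A.zeroSub :=
  (isClosed_eq (A.deg.proj 0).continuous continuous_id).completeSpace_coe

instance : Clct 𝕜 A.zeroSub where

instance : ContinuousMul A.zeroSub :=
  ⟨((continuous_subtype_val.comp continuous_fst).mul
    (continuous_subtype_val.comp continuous_snd)).subtype_mk _⟩

/-- The clct dg-algebra `A⁰`, concentrated in degree `0`, with zero differential. -/
def DGAlg.zeroPart : DGAlg.{v, u} 𝕜 where
  carrier := A.zeroSub
  deg :=
    { proj := fun n => if n = 0 then ContinuousLinearMap.id 𝕜 _ else 0
      proj_proj := fun i j x => by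
        by_cases hj : j = 0
        · by_cases hi : i = 0
          · simp [hi, hj]
          · simp [hi, hj]
        · simp [hj]
      inducing := by
        refine inducing_of_seminorm _ fun r _ => ⟨{0}, fun x => by simp⟩ }
  one_homog := by simp [Grading.Homog]
  mul_homog i j a b ha hb := by
    by_cases hi : i = 0
    · by_cases hj : j = 0
      · simp [Grading.Homog, hi, hj]
      · have hb0 : b = 0 := by simpa [Grading.Homog, hj] using hb.symm
        simp [hb0, Grading.Homog]
    · have ha0 : a = 0 := by simpa [Grading.Homog, hi] using ha.symm
      simp [ha0, Grading.Homog]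
  d := 0
  d_homog i a _ := by simp [Grading.Homog]
  d_d a := rfl
  leibniz i a b _ := by simp

/-- The inclusion `A⁰ → A`. -/
def DGAlg.incl : A.zeroPart →L[𝕜] A where
  toFun a := a.1
  map_add' _ _ := rfl
  map_smul' _ _ := rfl
  cont := continuous_subtype_val

/-- The projection `π₀ : A → A⁰`. -/
def DGAlg.pi₀ : A →L[𝕜] A.zeroPart where
  toFun a := ⟨A.deg.proj 0 a, A.deg.homog_proj 0 a⟩
  map_add' a b := Subtype.ext (map_add (A.deg.proj 0) a b)
  map_smul' c a := Subtype.ext (map_smul (A.deg.proj 0) c a)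
  cont := (A.deg.proj 0).continuous.subtype_mk _

variable {A}

theorem DGAlg.incl_homog (s : A.zeroPart) : A.deg.Homog 0 (A.incl s) := s.2

theorem DGAlg.incl_mul (s t : A.zeroPart) : A.incl (s * t) = A.incl s * A.incl t := rfl

theorem DGAlg.incl_one : A.incl 1 = 1 := rfl

theorem DGAlg.pi₀_incl (s : A.zeroPart) : A.pi₀ (A.incl s) = s := Subtype.ext s.2

theorem DGAlg.incl_pi₀ (a : A) : A.incl (A.pi₀ a) = A.deg.proj 0 a := rfl

theorem DGAlg.pi₀_one : A.pi₀ 1 = 1 := DGAlg.pi₀_incl 1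

theorem DGAlg.pi₀_eq_zero {j : ℤ} {a : A} (ha : A.deg.Homog j a) (hj : j ≠ 0) : A.pi₀ a = 0 :=
  Subtype.ext ((ha.proj_eq 0).trans (if_neg hj.symm))

theorem DGAlg.zeroPart_homog_zero (s : A.zeroPart) : A.zeroPart.deg.Homog 0 s := by
  change (if (0 : ℤ) = 0 then ContinuousLinearMap.id 𝕜 A.zeroSub else 0) s = s
  rw [if_pos rfl]
  rfl

theorem DGAlg.zeroPart_homog {j : ℤ} {s : A.zeroPart} (hs : A.zeroPart.deg.Homog j s)
    (hj : j ≠ 0) : s = 0 := by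
  have h : (if j = 0 then ContinuousLinearMap.id 𝕜 A.zeroSub else 0) s = s := hs
  rw [if_neg hj] at h
  exact h.symm

theorem DGAlg.NonNeg.eq_zero (hA : A.NonNeg) {j : ℤ} {a : A} (ha : A.deg.Homog j a)
    (hj : j < 0) : a = 0 := (show A.deg.proj j a = a from ha).symm.trans (hA j hj a)

/-- Left multiplication by `s`. -/
def mulLeftL {S : Type u} [Ring S] [Algebra 𝕜 S] [UniformSpace S] [ContinuousMul S] (s : S) :
    S →L[𝕜] S where
  toFun x := s * x
  map_add' x y := mul_add s x y
  map_smul' c x := mul_smul_comm c s x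
  cont := continuous_const_mul s

/-- If `A` is concentrated in non-negative degrees, then `π₀` is multiplicative. -/
theorem DGAlg.NonNeg.pi₀_mul (hA : A.NonNeg) (a b : A) : A.pi₀ (a * b) = A.pi₀ a * A.pi₀ b := by
  refine A.deg.ext_fun (A.pi₀.comp (mulRightL b)) ((mulRightL (A.pi₀ b)).comp A.pi₀)
    (fun i a ha => ?_) a
  refine A.deg.ext_fun (A.pi₀.comp (mulLeftL a)) ((mulLeftL (A.pi₀ a)).comp A.pi₀)
    (fun j b hb => ?_) b
  change A.pi₀ (a * b) = A.pi₀ a * A.pi₀ b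
  rcases lt_trichotomy i 0 with hi | hi | hi
  · rw [hA.eq_zero ha hi, zero_mul, map_zero, zero_mul]
  · subst hi
    by_cases hj : j = 0
    · subst hj
      refine Subtype.ext ?_
      change A.deg.proj 0 (a * b) = A.deg.proj 0 a * A.deg.proj 0 b
      have h := A.mul_homog 0 0 a b ha hb
      rw [add_zero] at h
      rw [show A.deg.proj 0 (a * b) = a * b from h, show A.deg.proj 0 a = a from ha,
        show A.deg.proj 0 b = b from hb]
    · rw [DGAlg.pi₀_eq_zero hb hj, mul_zero]
      refine DGAlg.pi₀_eq_zero (A.mul_homog 0 j a b ha hb) ?_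
      rwa [zero_add]
  · rw [DGAlg.pi₀_eq_zero ha hi.ne', zero_mul]
    rcases lt_or_ge j 0 with hj | hj
    · rw [hA.eq_zero hb hj, mul_zero, map_zero]
    · exact DGAlg.pi₀_eq_zero (A.mul_homog i j a b ha hb) (by omega)

theorem DGAlg.NonNeg.pi₀_d (hA : A.NonNeg) (a : A) : A.pi₀ (A.d a) = 0 := by
  refine A.deg.ext_fun (A.pi₀.comp A.d) 0 (fun i a ha => ?_) a
  change A.pi₀ (A.d a) = 0
  by_cases hi : i = -1
  · rw [hA.eq_zero ha (by omega), map_zero, map_zero]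
  · exact DGAlg.pi₀_eq_zero (A.d_homog i a ha) (by omega)

/-- The graded `A⁰`-module given by `W ⊗̂ A⁰`, or by a quotient of it. -/
noncomputable def tensorZeroPart {E : Type u} [AddCommGroup E] [Module 𝕜 E] [UniformSpace E]
    [Clct 𝕜 E] (g : Grading 𝕜 E) (K : Submodule 𝕜 (E ⊗[𝕜] A.zeroPart)) (hK : RightStable K)
    (hg : ∀ n, K ≤ K.comap (TensorProduct.map (g.proj n).toLinearMap
      (ContinuousLinearMap.id 𝕜 A.zeroPart).toLinearMap)) : GrMod A.zeroPart :=
  letI := CTensor.moduleOp K hK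
  { carrier := CTensor K
    deg := CTensor.grading g K hg
    tower := CTensor.tower_op K hK
    continuousAct := CTensor.continuousSMul_op K hK
    act_homog := fun i j z s hz hs => by
      change (CTensor.grading g K hg).Homog (i + j) (CTensor.right K hK s z)
      by_cases hj : j = 0
      · subst hj
        rw [add_zero, Grading.Homog]
        have h : (CTensor.grading g K hg).proj i (CTensor.right K hK s z) =
            CTensor.right K hK s ((CTensor.grading g K hg).proj i z) :=
          CTensor.ext (((CTensor.grading g K hg).proj i).comp (CTensor.right K hK s))
            ((CTensor.right K hK s).comp ((CTensor.grading g K hg).proj i))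
            (fun x y => by simp [CTensor.grading]) z
        rw [h, hz]
      · have h0 : CTensor.right K hK 0 z = 0 :=
          LinearMap.congr_fun (map_zero (CTensor.rightₗ K hK)) z
        rw [DGAlg.zeroPart_homog hs hj, h0, Grading.Homog, map_zero] }

end ZeroPart

section ExtendScalars

variable {𝕜 : Type v} [RCLike 𝕜] {A : DGAlg.{v, u} 𝕜}

/-- The relations `m a ⊗ s = m ⊗ π₀(a) s` which define `M ⊗_A A⁰` (for homogeneous `m`, `a`). -/
def GrMod.relations (M : GrMod A) : Submodule 𝕜 (M ⊗[𝕜] A.zeroPart) :=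
  Submodule.span 𝕜 {t | ∃ (i j : ℤ) (m : M) (a : A) (s : A.zeroPart), M.deg.Homog i m ∧
    A.deg.Homog j a ∧ t = (m <• a) ⊗ₜ s - m ⊗ₜ (A.pi₀ a * s)}

theorem GrMod.relations_right (M : GrMod A) : RightStable M.relations := by
  intro r
  rw [GrMod.relations, Submodule.span_le]
  rintro _ ⟨i, j, m, a, s, hm, ha, rfl⟩
  refine Submodule.subset_span ⟨i, j, m, a, s * r, hm, ha, ?_⟩
  simp [mulRightL, mul_assoc]

theorem GrMod.relations_map {M N : GrMod A} {k : ℤ} (f : GrHom k M N) :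
    M.relations ≤ N.relations.comap (TensorProduct.map f.toContinuousLinearMap.toLinearMap
      (ContinuousLinearMap.id 𝕜 A.zeroPart).toLinearMap) := by
  rw [GrMod.relations, Submodule.span_le]
  rintro _ ⟨i, j, m, a, s, hm, ha, rfl⟩
  refine Submodule.subset_span ⟨i + k, j, f.toFun m, a, s, f.map_homog i m hm, ha, ?_⟩
  rw [← f.map_act]
  simp

theorem GrMod.relations_proj (M : GrMod A) (n : ℤ) :
    M.relations ≤ M.relations.comap (TensorProduct.map (M.deg.proj n).toLinearMap
      (ContinuousLinearMap.id 𝕜 A.zeroPart).toLinearMap) := by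
  refine Submodule.span_le.2 ?_
  rintro _ ⟨i, j, m, a, s, hm, ha, rfl⟩
  have hma := M.act_homog i j m a hm ha
  have hgen : (m <• a) ⊗ₜ[𝕜] s - m ⊗ₜ[𝕜] (A.pi₀ a * s) ∈ M.relations :=
    Submodule.subset_span ⟨i, j, m, a, s, hm, ha, rfl⟩
  simp only [SetLike.mem_coe, Submodule.mem_comap, map_sub, TensorProduct.map_tmul,
    ContinuousLinearMap.coe_coe, hm.proj_eq, hma.proj_eq,
    ContinuousLinearMap.coe_id, LinearMap.id_coe, id_eq]
  by_cases hj : j = 0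
  · subst hj
    rw [add_zero]
    by_cases hn : n = i
    · simpa [hn] using hgen
    · simp [hn]
  · rw [DGAlg.pi₀_eq_zero ha hj, zero_mul, TensorProduct.tmul_zero, sub_zero] at hgen ⊢
    by_cases hn : n = i + j
    · simpa [hn] using hgen
    · simp [hn]

theorem DGMod.relations_d (hA : A.NonNeg) (M : DGMod A) :
    M.relations ≤ M.relations.comap (TensorProduct.map M.d.toLinearMap
      (ContinuousLinearMap.id 𝕜 A.zeroPart).toLinearMap) := by
  refine Submodule.span_le.2 ?_
  rintro _ ⟨i, j, m, a, s, hm, ha, rfl⟩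
  have h1 : (M.d m <• a) ⊗ₜ[𝕜] s - M.d m ⊗ₜ[𝕜] (A.pi₀ a * s) ∈ M.relations :=
    Submodule.subset_span ⟨i + 1, j, M.d m, a, s, M.d_homog i m hm, ha, rfl⟩
  have h2 : (m <• A.d a) ⊗ₜ[𝕜] s ∈ M.relations := by
    have : (m <• A.d a) ⊗ₜ[𝕜] s - m ⊗ₜ[𝕜] (A.pi₀ (A.d a) * s) ∈ M.relations :=
      Submodule.subset_span ⟨i, j + 1, m, A.d a, s, hm, A.d_homog j a ha, rfl⟩
    rwa [hA.pi₀_d, zero_mul, TensorProduct.tmul_zero, sub_zero] at this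
  simp only [SetLike.mem_coe, Submodule.mem_comap, map_sub, TensorProduct.map_tmul,
    ContinuousLinearMap.coe_coe, M.leibniz i m a hm,
    ContinuousLinearMap.coe_id, LinearMap.id_coe, id_eq]
  rw [TensorProduct.add_tmul, add_sub_right_comm]
  refine add_mem h1 ?_
  rcases Int.units_eq_one_or i.negOnePow with h | h
  · simpa [h] using h2
  · simpa [h, TensorProduct.neg_tmul] using h2

/-- Extension of scalars `M ⊗̂_A A⁰` along `π₀ : A → A⁰`: the completed cokernel of
`M ⊗̂ A ⊗̂ A⁰ → M ⊗̂ A⁰`, with the differential `d_M ⊗ 1`. -/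
noncomputable def DGMod.extend (hA : A.NonNeg) (M : DGMod A) : DGMod A.zeroPart where
  toGrMod := tensorZeroPart M.deg M.relations M.relations_right M.relations_proj
  d := CTensor.map M.relations M.relations M.d (ContinuousLinearMap.id 𝕜 _) (M.relations_d hA)
  d_homog i z hz := by
    let D := CTensor.map M.relations M.relations M.d (ContinuousLinearMap.id 𝕜 _)
      (M.relations_d hA)
    let P := (CTensor.grading M.deg M.relations M.relations_proj).proj
    have h := CTensor.ext ((P (i + 1)).comp D) (D.comp (P i)) (fun x y => by
      simp [P, D, CTensor.grading, M.deg.proj_map M.deg M.d 1 M.d_homog]) z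
    have hz' : P i z = z := hz
    exact h.trans (congrArg D hz')
  d_d z := by
    let D := CTensor.map M.relations M.relations M.d (ContinuousLinearMap.id 𝕜 _)
      (M.relations_d hA)
    exact CTensor.ext (D.comp D) 0 (fun x y => by
      have h0 : CTensor.tmul M.relations (0 : M) y = 0 := map_zero (CTensor.inl M.relations y)
      simp [D, M.d_d, h0]) z
  leibniz i z s _ := by
    let D := CTensor.map M.relations M.relations M.d (ContinuousLinearMap.id 𝕜 _)
      (M.relations_d hA)
    let R := CTensor.right M.relations M.relations_right s
    have h := CTensor.ext (D.comp R) (R.comp D) (fun x y => by simp [D, R]) z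
    have h0 : CTensor.right M.relations M.relations_right 0 z = 0 :=
      LinearMap.congr_fun (map_zero (CTensor.rightₗ M.relations M.relations_right)) z
    change D (R z) = R (D z) +
      i.negOnePow • (CTensor.right M.relations M.relations_right 0 z)
    rw [h0, smul_zero, add_zero]
    exact h

/-- The map `f ⊗ 1 : M ⊗̂_A A⁰ → N ⊗̂_A A⁰` induced by an `A`-linear map of degree `k`. -/
noncomputable def GrHom.extend (hA : A.NonNeg) {M N : DGMod A} {k : ℤ}
    (f : GrHom k M.toGrMod N.toGrMod) :
    GrHom k (M.extend hA).toGrMod (N.extend hA).toGrMod where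
  toContinuousLinearMap := CTensor.map M.relations N.relations f.toContinuousLinearMap
    (ContinuousLinearMap.id 𝕜 _) (GrMod.relations_map f)
  map_act z s := by
    let F := CTensor.map M.relations N.relations f.toContinuousLinearMap
      (ContinuousLinearMap.id 𝕜 _) (GrMod.relations_map f)
    let R := CTensor.right M.relations M.relations_right s
    let R' := CTensor.right N.relations N.relations_right s
    exact CTensor.ext (F.comp R) (R'.comp F) (fun x y => by simp [F, R, R']) z
  map_homog i z hz := by
    let F := CTensor.map M.relations N.relations f.toContinuousLinearMap
      (ContinuousLinearMap.id 𝕜 _) (GrMod.relations_map f)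
    let P := (CTensor.grading M.deg M.relations M.relations_proj).proj
    let P' := (CTensor.grading N.deg N.relations N.relations_proj).proj
    have h := CTensor.ext ((P' (i + k)).comp F) (F.comp (P i)) (fun x y => by
      simp [P, P', F, CTensor.grading,
        M.deg.proj_map N.deg f.toContinuousLinearMap k f.map_homog]) z
    have hz' : P i z = z := hz
    exact h.trans (congrArg F hz')

/-- Extension of scalars as a functor `Z⁰(A-Mod) ⥤ Z⁰(A⁰-Mod)`. -/
noncomputable def extendZ (hA : A.NonNeg) : DGMod A ⥤ DGMod A.zeroPart where
  obj M := M.extend hA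
  map {M N} f := ({ f.toGrHom.extend hA with
    map_d := fun z => by
      let F := CTensor.map M.relations N.relations f.toContinuousLinearMap
        (ContinuousLinearMap.id 𝕜 _) (GrMod.relations_map f.toGrHom)
      let D := CTensor.map M.relations M.relations M.d (ContinuousLinearMap.id 𝕜 _)
        (M.relations_d hA)
      let D' := CTensor.map N.relations N.relations N.d (ContinuousLinearMap.id 𝕜 _)
        (N.relations_d hA)
      exact CTensor.ext (F.comp D) (D'.comp F) (fun x y => by
        have h := f.map_d x
        simp only [F, D, D', ContinuousLinearMap.comp_apply, CTensor.map_tmul]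
        exact congrArg (fun w => CTensor.tmul N.relations w y) h) z } :
    DGHom (M.extend hA) (N.extend hA))
  map_id M := by
    refine DGHom.ext (funext fun z => ?_)
    exact CTensor.ext (CTensor.map M.relations M.relations (𝟙 M : DGHom M M).toContinuousLinearMap
      (ContinuousLinearMap.id 𝕜 _) (GrMod.relations_map (𝟙 M : DGHom M M).toGrHom))
      (ContinuousLinearMap.id 𝕜 _) (fun x y => by
        rw [CTensor.map_tmul]
        rfl) z
  map_comp {M N L} f g := by
    refine DGHom.ext (funext fun z => ?_)
    exact CTensor.ext (CTensor.map M.relations L.relations (f ≫ g).toContinuousLinearMap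
      (ContinuousLinearMap.id 𝕜 _) (GrMod.relations_map (f ≫ g).toGrHom))
      ((CTensor.map N.relations L.relations g.toContinuousLinearMap
        (ContinuousLinearMap.id 𝕜 _) (GrMod.relations_map g.toGrHom)).comp
      (CTensor.map M.relations N.relations f.toContinuousLinearMap
        (ContinuousLinearMap.id 𝕜 _) (GrMod.relations_map f.toGrHom))) (fun x y => by
        simp only [ContinuousLinearMap.comp_apply, CTensor.map_tmul]
        rfl) z

/-- Extension of scalars as a functor `H⁰(A-Mod) ⥤ H⁰(A⁰-Mod)`. -/
noncomputable def extendHo (hA : A.NonNeg) : HoCat A ⥤ HoCat A.zeroPart :=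
  CategoryTheory.Quotient.lift _ (extendZ hA ⋙ CategoryTheory.Quotient.functor _) (by
    rintro M N f g ⟨h, hh⟩
    refine CategoryTheory.Quotient.sound _ ⟨h.extend hA, fun z => ?_⟩
    let T {k : ℤ} (a : GrHom k M.toGrMod N.toGrMod) := CTensor.map M.relations N.relations
      a.toContinuousLinearMap (ContinuousLinearMap.id 𝕜 _) (GrMod.relations_map a)
    let D := CTensor.map M.relations M.relations M.d (ContinuousLinearMap.id 𝕜 _)
      (M.relations_d hA)
    let D' := CTensor.map N.relations N.relations N.d (ContinuousLinearMap.id 𝕜 _)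
      (N.relations_d hA)
    exact CTensor.ext (T f.toGrHom - T g.toGrHom) (D'.comp (T h) + (T h).comp D) (fun x y => by
      simp only [T, D, D', ContinuousLinearMap.comp_apply, CTensor.map_tmul, sub_apply, add_apply]
      have h1 := congrArg (CTensor.inl N.relations y) (hh x)
      rw [map_sub, map_add] at h1
      exact h1) z)

/-- `L : D^ctr(A) ⥤ D^ctr(A⁰)` is the derived functor `(-) ⊗̂^L_A A⁰`: it is computed by applying
`(-) ⊗̂_A A⁰` to graded-projective modules. -/
def IsDerivedExtension (hA : A.NonNeg) (L : Dctr A ⥤ Dctr A.zeroPart) : Prop :=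
  Nonempty (gprojToDctr A ⋙ L ≅
    (gradedProjectives A).ι ⋙ extendHo hA ⋙ Dctr.quot A.zeroPart)

end ExtendScalars

/-! ## Graded-free modules and their reduction -/

section Free

variable {𝕜 : Type v} [RCLike 𝕜] {A : DGAlg.{v, u} 𝕜}

/-- An isomorphism `W ⊗̂ A^# ≃ N^#` of graded `A^#`-modules, which exhibits the dg-module `N` as
graded-free on the graded clct space `W`. Since completed projective tensor products commute with
products, the total space of `W ⊗̂ A^#` is the completed projective tensor product of the total
spaces. -/
structure GradedFree (W : GrSpace.{v, u} 𝕜) (N : DGMod A) where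
  iso : CTensor₀ 𝕜 W A ≃L[𝕜] N
  iso_act : ∀ (w : W) (a : A),
    iso (CTensor.tmul ⊥ w a) = iso (CTensor.tmul ⊥ w 1) <• a
  iso_homog : ∀ i j (w : W) (a : A), W.deg.Homog i w → A.deg.Homog j a →
    N.deg.Homog (i + j) (iso (CTensor.tmul ⊥ w a))

theorem rightStable_bot {E : Type u} [AddCommGroup E] [Module 𝕜 E]
    {S : Type u} [Ring S] [Algebra 𝕜 S] [UniformSpace S] [Clct 𝕜 S] [ContinuousMul S]
    [UniformSpace E] : RightStable (⊥ : Submodule 𝕜 (E ⊗[𝕜] S)) :=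
  fun _ => bot_le

/-- The map `1 ⊗ π₀ : W ⊗̂ A → W ⊗̂ A⁰`. -/
noncomputable def GrSpace.toZero (W : GrSpace.{v, u} 𝕜) (A : DGAlg.{v, u} 𝕜) :
    CTensor₀ 𝕜 W A →L[𝕜] CTensor₀ 𝕜 W A.zeroPart :=
  CTensor.map ⊥ ⊥ (ContinuousLinearMap.id 𝕜 W) A.pi₀ bot_le

/-- The inclusion `W ⊗̂ A⁰ → W ⊗̂ A`. -/
noncomputable def GrSpace.ofZero (W : GrSpace.{v, u} 𝕜) (A : DGAlg.{v, u} 𝕜) :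
    CTensor₀ 𝕜 W A.zeroPart →L[𝕜] CTensor₀ 𝕜 W A :=
  CTensor.map ⊥ ⊥ (ContinuousLinearMap.id 𝕜 W) A.incl bot_le

namespace GradedFree

variable {W : GrSpace.{v, u} 𝕜} {N : DGMod A} (φ : GradedFree W N)

/-- The component `d₀ : W ⊗̂ A⁰ → W ⊗̂ A⁰` of the differential `d = d₀ + d₁ + …` of
`N = W ⊗̂ A`. -/
noncomputable def d₀ : CTensor₀ 𝕜 W A.zeroPart →L[𝕜] CTensor₀ 𝕜 W A.zeroPart :=
  (W.toZero A).comp ((φ.iso.symm.toContinuousLinearMap.comp (N.d.comp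
    φ.iso.toContinuousLinearMap)).comp (W.ofZero A))

/-- The action of `a` on `N` as a continuous linear map. -/
noncomputable def actL (N : DGMod A) (a : A) : N →L[𝕜] N where
  toFun n := n <• a
  map_add' x y := smul_add _ x y
  map_smul' c x := by
    change MulOpposite.op a • (c • x) = c • MulOpposite.op a • x
    rw [← smul_one_smul Aᵐᵒᵖ c x, smul_smul, mul_smul_comm, mul_one, smul_assoc]
  cont := continuous_const_smul (MulOpposite.op a)

theorem iso_right (a : A) (x : CTensor₀ 𝕜 W A) :
    φ.iso (CTensor.right ⊥ rightStable_bot a x) = φ.iso x <• a := by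
  refine CTensor.ext (φ.iso.toContinuousLinearMap.comp (CTensor.right ⊥ rightStable_bot a))
    ((actL N a).comp φ.iso.toContinuousLinearMap) (fun w b => ?_) x
  change φ.iso (CTensor.right ⊥ rightStable_bot a (CTensor.tmul ⊥ w b)) =
    φ.iso (CTensor.tmul ⊥ w b) <• a
  rw [CTensor.right_tmul, φ.iso_act w (b * a), φ.iso_act w b, MulOpposite.op_mul, mul_smul]

theorem toZero_right (hA : A.NonNeg) (a : A) (x : CTensor₀ 𝕜 W A) :
    W.toZero A (CTensor.right ⊥ rightStable_bot a x) =
      CTensor.right ⊥ rightStable_bot (A.pi₀ a) (W.toZero A x) :=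
  CTensor.ext ((W.toZero A).comp (CTensor.right ⊥ rightStable_bot a))
    ((CTensor.right ⊥ rightStable_bot (A.pi₀ a)).comp (W.toZero A))
    (fun w b => by simp [GrSpace.toZero, hA.pi₀_mul]) x

theorem ofZero_right (s : A.zeroPart) (x : CTensor₀ 𝕜 W A.zeroPart) :
    W.ofZero A (CTensor.right ⊥ rightStable_bot s x) =
      CTensor.right ⊥ rightStable_bot (A.incl s) (W.ofZero A x) :=
  CTensor.ext ((W.ofZero A).comp (CTensor.right ⊥ rightStable_bot s))
    ((CTensor.right ⊥ rightStable_bot (A.incl s)).comp (W.ofZero A))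
    (fun w b => by simp [GrSpace.ofZero, DGAlg.incl_mul]) x

theorem toZero_ofZero (x : CTensor₀ 𝕜 W A.zeroPart) : W.toZero A (W.ofZero A x) = x :=
  CTensor.ext ((W.toZero A).comp (W.ofZero A)) (ContinuousLinearMap.id 𝕜 _)
    (fun w s => by simp [GrSpace.ofZero, GrSpace.toZero, DGAlg.pi₀_incl]) x

theorem symm_act (n : N) (a : A) :
    φ.iso.symm (n <• a) = CTensor.right ⊥ rightStable_bot a (φ.iso.symm n) := by
  rw [ContinuousLinearEquiv.symm_apply_eq, φ.iso_right, ContinuousLinearEquiv.apply_symm_apply]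

/-- Modulo positive degrees of `A`, the differential of `N` is `A`-linear. -/
theorem toZero_d_act (hA : A.NonNeg) (n : N) (a : A) :
    W.toZero A (φ.iso.symm (N.d (n <• a))) =
      CTensor.right ⊥ rightStable_bot (A.pi₀ a) (W.toZero A (φ.iso.symm (N.d n))) := by
  let T : N →L[𝕜] CTensor₀ 𝕜 W A.zeroPart :=
    (W.toZero A).comp φ.iso.symm.toContinuousLinearMap
  refine N.deg.ext_fun (T.comp (N.d.comp (actL N a)))
    ((CTensor.right ⊥ rightStable_bot (A.pi₀ a)).comp (T.comp N.d)) (fun i n hn => ?_) n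
  change T (N.d (n <• a)) = CTensor.right ⊥ rightStable_bot (A.pi₀ a) (T (N.d n))
  have hT : ∀ (m : N) (b : A), T (m <• b) =
      CTensor.right ⊥ rightStable_bot (A.pi₀ b) (T m) := by
    intro m b
    change W.toZero A (φ.iso.symm (m <• b)) = _
    rw [φ.symm_act, toZero_right hA]
    rfl
  have h0 : CTensor.right (⊥ : Submodule 𝕜 (W ⊗[𝕜] A.zeroPart)) rightStable_bot 0 (T n) = 0 :=
    LinearMap.congr_fun (map_zero (CTensor.rightₗ ⊥ rightStable_bot)) _
  have h1 : T (n <• A.d a) = 0 := by rw [hT, hA.pi₀_d, h0]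
  rw [N.leibniz i n a hn, map_add, hT]
  rcases Int.units_eq_one_or i.negOnePow with h | h <;> simp [h, h1]

theorem d₀_toZero (hA : A.NonNeg) (x : CTensor₀ 𝕜 W A) :
    φ.d₀ (W.toZero A x) = W.toZero A (φ.iso.symm (N.d (φ.iso x))) := by
  refine CTensor.ext (φ.d₀.comp (W.toZero A)) ((W.toZero A).comp
    (φ.iso.symm.toContinuousLinearMap.comp (N.d.comp φ.iso.toContinuousLinearMap)))
    (fun w a => ?_) x
  change W.toZero A (φ.iso.symm (N.d (φ.iso (W.ofZero A (W.toZero A (CTensor.tmul ⊥ w a)))))) =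
    W.toZero A (φ.iso.symm (N.d (φ.iso (CTensor.tmul ⊥ w a))))
  have h : W.ofZero A (W.toZero A (CTensor.tmul ⊥ w a)) =
      CTensor.tmul ⊥ w (A.incl (A.pi₀ a)) := by simp [GrSpace.ofZero, GrSpace.toZero]
  rw [h, φ.iso_act w a, φ.iso_act w (A.incl (A.pi₀ a)), φ.toZero_d_act hA, φ.toZero_d_act hA,
    DGAlg.pi₀_incl]

theorem toZero_proj (n : ℤ) (x : CTensor₀ 𝕜 W A) :
    (CTensor.grading W.deg (⊥ : Submodule 𝕜 (W ⊗[𝕜] A.zeroPart)) fun _ => bot_le).proj n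
      (W.toZero A x) = W.toZero A (φ.iso.symm (N.deg.proj n (φ.iso x))) := by
  let P := (CTensor.grading W.deg (⊥ : Submodule 𝕜 (W ⊗[𝕜] A.zeroPart)) fun _ => bot_le).proj n
  let L := P.comp (W.toZero A)
  let R := (W.toZero A).comp (φ.iso.symm.toContinuousLinearMap.comp
    ((N.deg.proj n).comp φ.iso.toContinuousLinearMap))
  refine CTensor.ext L R (fun w a => ?_) x
  refine W.deg.ext_fun (L.comp (CTensor.inl ⊥ a)) (R.comp (CTensor.inl ⊥ a)) (fun i w hw => ?_) w
  refine A.deg.ext_fun (L.comp (CTensor.inr ⊥ w)) (R.comp (CTensor.inr ⊥ w)) (fun j a ha => ?_) a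
  change P (W.toZero A (CTensor.tmul ⊥ w a)) =
    W.toZero A (φ.iso.symm (N.deg.proj n (φ.iso (CTensor.tmul ⊥ w a))))
  have h1 : W.toZero A (CTensor.tmul ⊥ w a) = CTensor.tmul ⊥ w (A.pi₀ a) := by
    simp [GrSpace.toZero]
  have h2 : P (CTensor.tmul ⊥ w (A.pi₀ a)) = CTensor.tmul ⊥ (W.deg.proj n w) (A.pi₀ a) := by
    simp [P, CTensor.grading]
  rw [(φ.iso_homog i j w a hw ha).proj_eq, h1, h2, hw.proj_eq]
  have h3 : CTensor.tmul (⊥ : Submodule 𝕜 (W ⊗[𝕜] A.zeroPart)) (0 : W) (A.pi₀ a) = 0 :=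
    map_zero (CTensor.inl _ (A.pi₀ a))
  by_cases hj : j = 0
  · subst hj
    rw [add_zero]
    by_cases hn : n = i
    · rw [if_pos hn, if_pos hn, ContinuousLinearEquiv.symm_apply_apply, h1]
    · rw [if_neg hn, if_neg hn, h3, map_zero, map_zero]
  · have h4 : ∀ w : W, CTensor.tmul (⊥ : Submodule 𝕜 (W ⊗[𝕜] A.zeroPart)) w (A.pi₀ a) = 0 := by
      intro w
      rw [DGAlg.pi₀_eq_zero ha hj]
      exact map_zero (CTensor.inr _ w)
    rw [h4]
    by_cases hn : n = i + j
    · rw [if_pos hn, ContinuousLinearEquiv.symm_apply_apply, h1, h4]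
    · rw [if_neg hn, map_zero, map_zero]

theorem ofZero_proj (n : ℤ) (x : CTensor₀ 𝕜 W A.zeroPart) :
    φ.iso (W.ofZero A ((CTensor.grading W.deg (⊥ : Submodule 𝕜 (W ⊗[𝕜] A.zeroPart))
      fun _ => bot_le).proj n x)) = N.deg.proj n (φ.iso (W.ofZero A x)) := by
  let P := (CTensor.grading W.deg (⊥ : Submodule 𝕜 (W ⊗[𝕜] A.zeroPart)) fun _ => bot_le).proj n
  let J := φ.iso.toContinuousLinearMap.comp (W.ofZero A)
  refine CTensor.ext (J.comp P) ((N.deg.proj n).comp J) (fun w s => ?_) x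
  refine W.deg.ext_fun ((J.comp P).comp (CTensor.inl ⊥ s))
    (((N.deg.proj n).comp J).comp (CTensor.inl ⊥ s)) (fun i w hw => ?_) w
  change φ.iso (W.ofZero A (P (CTensor.tmul ⊥ w s))) =
    N.deg.proj n (φ.iso (W.ofZero A (CTensor.tmul ⊥ w s)))
  have h1 : ∀ w, W.ofZero A (CTensor.tmul ⊥ w s) = CTensor.tmul ⊥ w (A.incl s) := fun w => by
    simp [GrSpace.ofZero]
  have h2 : P (CTensor.tmul ⊥ w s) = CTensor.tmul ⊥ (W.deg.proj n w) s := by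
    simp [P, CTensor.grading]
  have h3 := φ.iso_homog i 0 w (A.incl s) hw (DGAlg.incl_homog s)
  rw [add_zero] at h3
  rw [h2, h1, h1, h3.proj_eq, hw.proj_eq]
  by_cases hn : n = i
  · rw [if_pos hn, if_pos hn]
  · rw [if_neg hn, if_neg hn]
    have h4 : CTensor.tmul (⊥ : Submodule 𝕜 (W ⊗[𝕜] A)) (0 : W) (A.incl s) = 0 :=
      map_zero (CTensor.inl _ (A.incl s))
    rw [h4, map_zero]

theorem d₀_proj (i : ℤ) (z : CTensor₀ 𝕜 W A.zeroPart) :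
    (CTensor.grading W.deg (⊥ : Submodule 𝕜 (W ⊗[𝕜] A.zeroPart)) fun _ => bot_le).proj (i + 1)
      (φ.d₀ z) = φ.d₀ ((CTensor.grading W.deg (⊥ : Submodule 𝕜 (W ⊗[𝕜] A.zeroPart))
        fun _ => bot_le).proj i z) := by
  simp only [d₀, ContinuousLinearMap.comp_apply, ContinuousLinearEquiv.coe_coe]
  rw [φ.ofZero_proj, φ.toZero_proj, ContinuousLinearEquiv.apply_symm_apply,
    N.deg.proj_map N.deg N.d 1 N.d_homog]

theorem d₀_d₀ (hA : A.NonNeg) (z : CTensor₀ 𝕜 W A.zeroPart) : φ.d₀ (φ.d₀ z) = 0 := by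
  have h : φ.d₀ z = W.toZero A (φ.iso.symm (N.d (φ.iso (W.ofZero A z)))) := rfl
  rw [h, φ.d₀_toZero hA, ContinuousLinearEquiv.apply_symm_apply, N.d_d, map_zero, map_zero]

theorem d₀_right (hA : A.NonNeg) (s : A.zeroPart) (z : CTensor₀ 𝕜 W A.zeroPart) :
    φ.d₀ (CTensor.right ⊥ rightStable_bot s z) =
      CTensor.right ⊥ rightStable_bot s (φ.d₀ z) := by
  simp only [d₀, ContinuousLinearMap.comp_apply, ContinuousLinearEquiv.coe_coe]
  rw [ofZero_right, φ.iso_right, φ.toZero_d_act hA, DGAlg.pi₀_incl]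

/-- The reduction `(W ⊗̂ A⁰, d₀)` of the graded-free module `N = (W ⊗̂ A^#, d₀ + d₁ + …)`. -/
noncomputable def reduction (hA : A.NonNeg) : DGMod A.zeroPart where
  toGrMod := tensorZeroPart W.deg ⊥ rightStable_bot fun _ => bot_le
  d := φ.d₀
  d_homog i z hz := (φ.d₀_proj i z).trans (congrArg φ.d₀ hz)
  d_d z := φ.d₀_d₀ hA z
  leibniz i z s _ := by
    have h0 : CTensor.right (⊥ : Submodule 𝕜 (W ⊗[𝕜] A.zeroPart)) rightStable_bot 0 z = 0 :=
      LinearMap.congr_fun (map_zero (CTensor.rightₗ ⊥ rightStable_bot)) _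
    change φ.d₀ (CTensor.right ⊥ rightStable_bot s z) =
      CTensor.right ⊥ rightStable_bot s (φ.d₀ z) +
        i.negOnePow • (CTensor.right ⊥ rightStable_bot 0 z)
    rw [h0, smul_zero, add_zero]
    exact φ.d₀_right hA s z

end GradedFree

end Free

/-! ## Locally finite sums of continuous linear maps -/

section LocallyFinite

theorem Seminorm.sum_eq_zero {𝕜 : Type*} [RCLike 𝕜] {ι F : Type*} [AddCommGroup F] [Module 𝕜 F]
    (p : Seminorm 𝕜 F) (S : Finset ι) (x : ι → F)
    (h : ∀ i ∈ S, p (x i) = 0) : p (∑ i ∈ S, x i) = 0 := by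
  classical
  induction S using Finset.induction_on with
  | empty => simp
  | insert a s ha ih =>
    rw [Finset.sum_insert ha]
    have h1 := map_add_le_add p (x a) (∑ i ∈ s, x i)
    rw [h a (by simp), ih fun i hi => h i (by simp [hi]), add_zero] at h1
    exact le_antisymm h1 (apply_nonneg _ _)

variable {𝕜 : Type v} [RCLike 𝕜] {ι : Type*} {E : Type*} [AddCommGroup E] [Module 𝕜 E]
  [TopologicalSpace E] {F : Type u} [AddCommGroup F] [Module 𝕜 F] [UniformSpace F]

/-- Every continuous seminorm of the target kills almost all members of the family. -/
def LocFinite (f : ι → E →L[𝕜] F) : Prop :=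
  ∀ p : Seminorm 𝕜 F, Continuous p → ∃ S : Finset ι, ∀ i ∉ S, ∀ x, p (f i x) = 0

variable [Clct 𝕜 F]

theorem LocFinite.summable {f : ι → E →L[𝕜] F} (hf : LocFinite f) (x : E) :
    Summable fun i => f i x := by
  rw [summable_iff_vanishing]
  intro e he
  obtain ⟨p, hp, hpe⟩ := exists_seminorm_of_mem_nhds (𝕜 := 𝕜) he
  obtain ⟨S, hS⟩ := hf p hp
  refine ⟨S, fun t ht => hpe _ ?_⟩
  rw [Seminorm.sum_eq_zero p t _ fun i hi => hS i (Finset.disjoint_left.1 ht hi) x]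
  exact one_pos

theorem LocFinite.seminorm_sub {f : ι → E →L[𝕜] F} (p : Seminorm 𝕜 F) (hp : Continuous p)
    (S : Finset ι) (hS : ∀ i ∉ S, ∀ x, p (f i x) = 0) (x : E) (y : F)
    (hy : HasSum (fun i => f i x) y) :
    p (y - ∑ i ∈ S, f i x) = 0 := by
  classical
  have h1 : Tendsto (fun T : Finset ι => p (∑ i ∈ T, f i x - ∑ i ∈ S, f i x)) atTop
      (𝓝 (p (y - ∑ i ∈ S, f i x))) := by
    have h2 : Tendsto (fun T : Finset ι => ∑ i ∈ T, f i x) atTop (𝓝 y) := hy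
    exact (hp.tendsto _).comp (h2.sub_const _)
  refine tendsto_nhds_unique h1 (tendsto_const_nhds.congr' ?_)
  filter_upwards [eventually_ge_atTop S] with T hT
  rw [← Finset.sum_sdiff hT, add_sub_cancel_right]
  exact (Seminorm.sum_eq_zero p _ _ fun i hi => hS i (Finset.mem_sdiff.1 hi).2 x).symm

/-- The sum of a locally finite family of continuous linear maps. -/
noncomputable def LocFinite.sum [IsTopologicalAddGroup E] {f : ι → E →L[𝕜] F}
    (hf : LocFinite f) : E →L[𝕜] F where
  toFun x := ∑' i, f i x
  map_add' x y := by
    simp only [map_add]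
    exact (hf.summable x).tsum_add (hf.summable y)
  map_smul' c x := by
    simp only [map_smul]
    exact (hf.summable x).tsum_const_smul c
  cont := by
    let G : E →ₗ[𝕜] F :=
      { toFun := fun x => ∑' i, f i x
        map_add' := fun x y => by
          simp only [map_add]
          exact (hf.summable x).tsum_add (hf.summable y)
        map_smul' := fun c x => by
          simp only [map_smul]
          exact (hf.summable x).tsum_const_smul c }
    refine (PolynormableSpace.withSeminorms 𝕜 F).continuous_of_continuous_comp G fun p => ?_
    obtain ⟨S, hS⟩ := hf p.1 p.2
    have hc : Continuous (p.1.comp (∑ i ∈ S, f i).toLinearMap) :=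
      p.2.comp (∑ i ∈ S, f i).continuous
    refine Seminorm.continuous_of_le hc fun x => ?_
    have h1 := LocFinite.seminorm_sub p.1 p.2 S hS x (G x) (hf.summable x).hasSum
    have h2 := map_add_le_add p.1 (G x - ∑ i ∈ S, f i x) (∑ i ∈ S, f i x)
    rw [sub_add_cancel, h1, zero_add] at h2
    refine h2.trans (le_of_eq ?_)
    simp

theorem LocFinite.hasSum [IsTopologicalAddGroup E] {f : ι → E →L[𝕜] F} (hf : LocFinite f)
    (x : E) : HasSum (fun i => f i x) (hf.sum x) :=
  (hf.summable x).hasSum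

theorem LocFinite.sum_eq_of [IsTopologicalAddGroup E] {f : ι → E →L[𝕜] F} (hf : LocFinite f)
    (x : E) (i : ι) (h : ∀ j, j ≠ i → f j x = 0) : hf.sum x = f i x :=
  (hf.hasSum x).unique (hasSum_single i h)

end LocallyFinite

section Products

variable {𝕜 : Type v} [RCLike 𝕜] {E : ℕ → Type u} [∀ i, AddCommGroup (E i)]
  [∀ i, Module 𝕜 (E i)] [∀ i, UniformSpace (E i)]

instance clctNatPi [∀ i, Clct 𝕜 (E i)] : Clct 𝕜 (∀ i, E i) where

theorem pi_exists_finset (p : Seminorm 𝕜 (∀ i, E i)) (hp : Continuous p) :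
    ∃ S : Finset ℕ, ∀ x, (∀ i ∈ S, x i = 0) → p x = 0 := by
  have h0 : {x | p x < 1} ∈ 𝓝 (0 : ∀ i, E i) :=
    (isOpen_lt hp continuous_const).mem_nhds (by simp)
  rw [nhds_pi, mem_pi] at h0
  obtain ⟨I, hI, V, hV, hVT⟩ := h0
  refine ⟨hI.toFinset, fun x hx => ?_⟩
  have hlt : ∀ c : 𝕜, p (c • x) < 1 := by
    intro c
    refine hVT ?_
    intro m hm
    have : x m = 0 := hx m (by simpa using hm)
    rw [Pi.smul_apply, this, smul_zero]
    exact mem_of_mem_nhds (hV m)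
  by_contra hne
  have hpos : 0 < p x := lt_of_le_of_ne (apply_nonneg p x) (Ne.symm hne)
  have := hlt (((p x)⁻¹ : ℝ) : 𝕜)
  rw [map_smul_eq_mul, RCLike.norm_ofReal, abs_of_pos (inv_pos.2 hpos),
    inv_mul_cancel₀ hpos.ne'] at this
  exact lt_irrefl _ this

end Products

/-! ## Bilinear maps -/

section Bilinear

variable {𝕜 : Type v} [RCLike 𝕜] {X Y Z : Type u} [AddCommGroup X] [Module 𝕜 X]
  [UniformSpace X] [Clct 𝕜 X] [AddCommGroup Y] [Module 𝕜 Y] [UniformSpace Y] [Clct 𝕜 Y]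
  [AddCommGroup Z] [Module 𝕜 Z] [UniformSpace Z]

theorem exists_seminorm_bilin (b : X →ₗ[𝕜] Y →ₗ[𝕜] Z)
    (hb : Continuous fun z : X × Y => b z.1 z.2) (r : Seminorm 𝕜 Z) (hr : Continuous r) :
    ∃ (p : Seminorm 𝕜 X) (q : Seminorm 𝕜 Y), Continuous p ∧ Continuous q ∧
      ∀ x y, r (b x y) ≤ p x * q y := by
  have h0 : {z : X × Y | r (b z.1 z.2) < 1} ∈ 𝓝 ((0 : X), (0 : Y)) := by
    refine (isOpen_lt (hr.comp hb) continuous_const).mem_nhds ?_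
    simp
  rw [nhds_prod_eq] at h0
  obtain ⟨U, hU, V, hV, hUV⟩ := mem_prod_iff.1 h0
  obtain ⟨p, hp, hpU⟩ := exists_seminorm_of_mem_nhds (𝕜 := 𝕜) hU
  obtain ⟨q, hq, hqV⟩ := exists_seminorm_of_mem_nhds (𝕜 := 𝕜) hV
  refine ⟨p, q, hp, hq, fun s t => ?_⟩
  have key : ∀ ε : ℝ, 0 < ε → r (b s t) ≤ (p s + ε) * (q t + ε) := by
    intro ε hε
    set α := p s + ε with ha
    set β := q t + ε with hb
    have ha0 : 0 < α := by positivity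
    have hb0 : 0 < β := by positivity
    have hs : ((α⁻¹ : ℝ) : 𝕜) • s ∈ U := by
      refine hpU _ ?_
      rw [map_smul_eq_mul, RCLike.norm_ofReal, abs_of_pos (inv_pos.2 ha0),
        inv_mul_lt_iff₀ ha0, mul_one, ha]
      linarith
    have ht : ((β⁻¹ : ℝ) : 𝕜) • t ∈ V := by
      refine hqV _ ?_
      rw [map_smul_eq_mul, RCLike.norm_ofReal, abs_of_pos (inv_pos.2 hb0),
        inv_mul_lt_iff₀ hb0, mul_one, hb]
      linarith
    have h : r (b (((α⁻¹ : ℝ) : 𝕜) • s) (((β⁻¹ : ℝ) : 𝕜) • t)) < 1 :=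
      hUV (Set.mk_mem_prod hs ht)
    rw [(b _).map_smul, b.map_smul, LinearMap.smul_apply, map_smul_eq_mul, map_smul_eq_mul,
      RCLike.norm_ofReal, RCLike.norm_ofReal, abs_of_pos (inv_pos.2 ha0),
      abs_of_pos (inv_pos.2 hb0), ← mul_assoc, ← mul_inv,
      inv_mul_lt_iff₀ (by positivity), mul_one] at h
    rw [mul_comm α β]
    exact h.le
  have hlim : Tendsto (fun ε : ℝ => (p s + ε) * (q t + ε)) (𝓝[>] 0)
      (𝓝 ((p s + 0) * (q t + 0))) :=
    (Continuous.tendsto (by fun_prop) 0).mono_left nhdsWithin_le_nhds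
  rw [add_zero, add_zero] at hlim
  refine ge_of_tendsto hlim ?_
  filter_upwards [self_mem_nhdsWithin] with ε hε
  exact key ε hε

variable [Clct 𝕜 Z]

/-- The linear map on `(X ⊗ Y) / K` induced by a bilinear map which kills `K`. -/
noncomputable def PTensor.lift (K : Submodule 𝕜 (X ⊗[𝕜] Y)) (b : X →ₗ[𝕜] Y →ₗ[𝕜] Z)
    (hb : Continuous fun z : X × Y => b z.1 z.2)
    (hK : K ≤ LinearMap.ker (TensorProduct.lift b)) : PTensor K →L[𝕜] Z where
  toLinearMap := K.liftQ (TensorProduct.lift b) hK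
  cont := by
    refine (PolynormableSpace.withSeminorms 𝕜 Z).continuous_of_continuous_comp _ fun r => ?_
    obtain ⟨p, q, hp, hq, h⟩ := exists_seminorm_bilin b hb r.1 r.2
    have hc : Continuous (projSeminorm p q K) :=
      (withSeminorms_projFamily K).continuous_seminorm (⟨⟨p, hp⟩, ⟨q, hq⟩⟩)
    refine Seminorm.continuous_of_le hc fun v => ?_
    have := seminorm_le_projSeminorm p q
      (r.1.comp (K.liftQ (TensorProduct.lift b) hK : PTensor K →ₗ[𝕜] Z)) 1
      zero_le_one (fun x y => by
        rw [one_mul]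
        refine le_trans (le_of_eq ?_) (h x y)
        change r.1 ((K.liftQ (TensorProduct.lift b) hK) (K.mkQ (x ⊗ₜ y))) = _
        rw [Submodule.mkQ_apply, Submodule.liftQ_apply, TensorProduct.lift.tmul]) v
    rwa [one_mul] at this

/-- The continuous linear map on the completed tensor product induced by a continuous bilinear
map which kills `K`. -/
noncomputable def CTensor.lift (K : Submodule 𝕜 (X ⊗[𝕜] Y)) (b : X →ₗ[𝕜] Y →ₗ[𝕜] Z)
    (hb : Continuous fun z : X × Y => b z.1 z.2)
    (hK : K ≤ LinearMap.ker (TensorProduct.lift b)) : CTensor K →L[𝕜] Z :=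
  (PTensor.lift K b hb hK).extend (CTensor.coeL K)

theorem CTensor.lift_tmul (K : Submodule 𝕜 (X ⊗[𝕜] Y)) (b : X →ₗ[𝕜] Y →ₗ[𝕜] Z)
    (hb : Continuous fun z : X × Y => b z.1 z.2)
    (hK : K ≤ LinearMap.ker (TensorProduct.lift b)) (x : X) (y : Y) :
    CTensor.lift K b hb hK (CTensor.tmul K x y) = b x y := by
  have h := ContinuousLinearMap.extend_eq (PTensor.lift K b hb hK) (e := CTensor.coeL K)
    Completion.denseRange_coe (Completion.isUniformInducing_coe _) (PTensor.mk K (x ⊗ₜ y))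
  refine Eq.trans h ?_
  change (K.liftQ (TensorProduct.lift b) hK) (K.mkQ (x ⊗ₜ y)) = _
  rw [Submodule.mkQ_apply, Submodule.liftQ_apply, TensorProduct.lift.tmul]

end Bilinear

/-! ## The total grading of a completed tensor product -/

section TensorGrading

variable {𝕜 : Type v} [RCLike 𝕜] {E : Type u} [AddCommGroup E] [Module 𝕜 E] [UniformSpace E]
  {F : Type u} [AddCommGroup F] [Module 𝕜 F] [UniformSpace F]

theorem Grading.exists_finset_proj [Clct 𝕜 E] (g : Grading 𝕜 E) (r : Seminorm 𝕜 E)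
    (hr : Continuous r) : ∃ S : Finset ℤ, (∀ n ∉ S, ∀ x, r (g.proj n x) = 0) ∧
      ∀ x, (∀ n ∈ S, g.proj n x = 0) → r x = 0 := by
  obtain ⟨S, hS⟩ := g.exists_finset r hr
  refine ⟨S, fun n hn x => ?_, fun x hx => ?_⟩
  · have h := hS (g.proj n x)
    rwa [Finset.sum_eq_zero, sub_zero] at h
    intro m hm
    rw [g.proj_proj, if_neg]
    rintro rfl
    exact hn hm
  · have h := hS x
    rwa [Finset.sum_eq_zero hx, sub_zero] at h

/-- A continuous seminorm which vanishes on homogeneous elements is zero. -/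
theorem Grading.seminorm_eq_zero [Clct 𝕜 E] (g : Grading 𝕜 E) (r : Seminorm 𝕜 E)
    (hr : Continuous r) (h : ∀ n x, g.Homog n x → r x = 0) (x : E) : r x = 0 := by
  obtain ⟨S, hS⟩ := g.exists_finset r hr
  have h1 := map_add_le_add r (x - ∑ n ∈ S, g.proj n x) (∑ n ∈ S, g.proj n x)
  rw [sub_add_cancel, hS x, Seminorm.sum_eq_zero r S _ fun n _ => h n _ (g.homog_proj n x),
    add_zero] at h1
  exact le_antisymm h1 (apply_nonneg _ _)

/-- A continuous seminorm which vanishes on pure tensors is zero. -/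
theorem CTensor.seminorm_eq_zero {K : Submodule 𝕜 (E ⊗[𝕜] F)} (r : Seminorm 𝕜 (CTensor K))
    (hr : Continuous r) (h : ∀ x y, r (CTensor.tmul K x y) = 0) (z : CTensor K) : r z = 0 := by
  induction z using Completion.induction_on with
  | hp => exact isClosed_eq hr continuous_const
  | ih v =>
    obtain ⟨t, rfl⟩ := PTensor.mk_surjective K v
    induction t with
    | zero => rw [map_zero, Completion.coe_zero, map_zero]
    | tmul x y => exact h x y
    | add s t hs ht =>
      rw [map_add, Completion.coe_add]
      have h1 := map_add_le_add r ((PTensor.mk K s : PTensor K) : CTensor K)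
        ((PTensor.mk K t : PTensor K) : CTensor K)
      rw [hs, ht, add_zero] at h1
      exact le_antisymm h1 (apply_nonneg _ _)

/-- Bound of a continuous seminorm on pure tensors. -/
theorem CTensor.exists_seminorm_tmul [IsUniformAddGroup E] [IsUniformAddGroup F]
    (K : Submodule 𝕜 (E ⊗[𝕜] F)) (r : Seminorm 𝕜 (CTensor K)) (hr : Continuous r) :
    ∃ (p : Seminorm 𝕜 E) (q : Seminorm 𝕜 F), Continuous p ∧ Continuous q ∧
      ∀ x y, (p x = 0 ∨ q y = 0) → r (CTensor.tmul K x y) = 0 := by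
  obtain ⟨p, q, C, hp, hq, hC, hb⟩ := exists_seminorm_le K (r.comp (CTensor.coeL K).toLinearMap)
    (hr.comp (CTensor.coeL K).continuous)
  refine ⟨p, q, hp, hq, fun x y hxy => le_antisymm ?_ (apply_nonneg _ _)⟩
  refine (hb (PTensor.mk K (x ⊗ₜ y))).trans ?_
  have h := projSeminorm_pure p q K x y
  rw [mul_eq_zero.2 hxy] at h
  exact mul_nonpos_of_nonneg_of_nonpos hC h

/-- Maps out of a tensor product of graded spaces are determined on homogeneous tensors. -/
theorem CTensor.ext_homog [Clct 𝕜 E] [Clct 𝕜 F] (g : Grading 𝕜 E) (g' : Grading 𝕜 F)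
    {K : Submodule 𝕜 (E ⊗[𝕜] F)} {G : Type u}
    [AddCommGroup G] [Module 𝕜 G] [UniformSpace G] [T2Space G] (a b : CTensor K →L[𝕜] G)
    (h : ∀ i j x y, g.Homog i x → g'.Homog j y →
      a (CTensor.tmul K x y) = b (CTensor.tmul K x y)) (z : CTensor K) : a z = b z := by
  refine CTensor.ext a b (fun x y => ?_) z
  refine g.ext_fun (a.comp (CTensor.inl K y)) (b.comp (CTensor.inl K y)) (fun i x hx => ?_) x
  exact g'.ext_fun (a.comp (CTensor.inr K x)) (b.comp (CTensor.inr K x))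
    (fun j y hy => h i j x y hx hy) y

@[simp]
theorem CTensor.zero_tmul [IsUniformAddGroup E] (K : Submodule 𝕜 (E ⊗[𝕜] F)) (y : F) :
    CTensor.tmul K 0 y = 0 := map_zero (CTensor.inl K y)

@[simp]
theorem CTensor.tmul_zero [IsUniformAddGroup F] (K : Submodule 𝕜 (E ⊗[𝕜] F)) (x : E) :
    CTensor.tmul K x 0 = 0 := map_zero (CTensor.inr K x)

variable [Clct 𝕜 E] [Clct 𝕜 F]

/-- The map `f ⊗ g` on completed tensor products. -/
noncomputable abbrev tmap {E' F' : Type u} [AddCommGroup E'] [Module 𝕜 E'] [UniformSpace E']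
    [AddCommGroup F'] [Module 𝕜 F'] [UniformSpace F'] (f : E →L[𝕜] E') (g : F →L[𝕜] F') :
    CTensor₀ 𝕜 E F →L[𝕜] CTensor₀ 𝕜 E' F' :=
  CTensor.map ⊥ ⊥ f g bot_le

theorem Grading.locFinite_tensor (g : Grading 𝕜 E) (g' : Grading 𝕜 F) (n : ℤ) :
    LocFinite fun i : ℤ => tmap (g.proj i) (g'.proj (n - i)) := by
  intro r hr
  obtain ⟨p, q, hp, -, hpq⟩ := CTensor.exists_seminorm_tmul _ r hr
  obtain ⟨S, hS, -⟩ := g.exists_finset_proj p hp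
  refine ⟨S, fun i hi => CTensor.seminorm_eq_zero (r.comp (tmap (g.proj i)
    (g'.proj (n - i))).toLinearMap) (hr.comp (tmap _ _).continuous) fun x y => ?_⟩
  change r (tmap (g.proj i) (g'.proj (n - i)) _) = 0
  rw [CTensor.map_tmul]
  exact hpq _ _ (Or.inl (hS i hi x))

theorem Grading.locFinite_tensor_tmul (g : Grading 𝕜 E) (g' : Grading 𝕜 F) (n : ℤ) {i j : ℤ}
    {x : E} {y : F} (hx : g.Homog i x) (hy : g'.Homog j y) :
    (g.locFinite_tensor g' n).sum (CTensor.tmul ⊥ x y) =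
      if n = i + j then CTensor.tmul ⊥ x y else 0 := by
  rw [LocFinite.sum_eq_of _ _ i]
  · rw [CTensor.map_tmul, hx.proj_eq, hy.proj_eq, if_pos rfl]
    by_cases h : n = i + j
    · rw [if_pos h, if_pos (by omega)]
    · rw [if_neg h, if_neg (by omega), CTensor.tmul_zero]
  · intro k hk
    rw [CTensor.map_tmul, hx.proj_eq, if_neg hk, CTensor.zero_tmul]

/-- The total grading of `E ⊗̂ F`. -/
noncomputable def Grading.tensor (g : Grading 𝕜 E) (g' : Grading 𝕜 F) :
    Grading 𝕜 (CTensor₀ 𝕜 E F) where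
  proj n := (g.locFinite_tensor g' n).sum
  proj_proj i j z := by
    have h := CTensor.ext_homog g g'
      ((g.locFinite_tensor g' i).sum.comp (g.locFinite_tensor g' j).sum)
      (if i = j then (g.locFinite_tensor g' j).sum else 0) (fun a b x y hx hy => by
        rw [ContinuousLinearMap.comp_apply, g.locFinite_tensor_tmul g' j hx hy]
        by_cases hj : j = a + b
        · rw [if_pos hj, g.locFinite_tensor_tmul g' i hx hy]
          by_cases hi : i = j
          · rw [if_pos (hi.trans hj), if_pos hi, g.locFinite_tensor_tmul g' j hx hy, if_pos hj]
          · rw [if_neg (by omega), if_neg hi, zero_apply]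
        · rw [if_neg hj, map_zero]
          by_cases hi : i = j
          · rw [if_pos hi, g.locFinite_tensor_tmul g' j hx hy, if_neg hj]
          · rw [if_neg hi, zero_apply]) z
    rw [ContinuousLinearMap.comp_apply] at h
    rw [h]
    by_cases hi : i = j
    · rw [if_pos hi, if_pos hi]
    · rw [if_neg hi, if_neg hi, zero_apply]
  inducing := by
    classical
    refine inducing_of_seminorm _ fun r hr => ?_
    obtain ⟨p, q, hp, hq, hpq⟩ := CTensor.exists_seminorm_tmul _ r hr
    obtain ⟨S, hS, -⟩ := g.exists_finset_proj p hp
    obtain ⟨T, hT, -⟩ := g'.exists_finset_proj q hq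
    let U : Finset ℤ := (S ×ˢ T).image fun z => z.1 + z.2
    let D : CTensor₀ 𝕜 E F →L[𝕜] CTensor₀ 𝕜 E F :=
      ContinuousLinearMap.id 𝕜 _ - ∑ n ∈ U, (g.locFinite_tensor g' n).sum
    have hD : ∀ z, D z = z - ∑ n ∈ U, (g.locFinite_tensor g' n).sum z := by
      intro z
      simp [D]
    refine ⟨U, fun z => ?_⟩
    rw [← hD]
    refine CTensor.seminorm_eq_zero (r.comp D.toLinearMap) (hr.comp D.continuous)
      (fun x y => ?_) z
    refine g.seminorm_eq_zero (r.comp (D.comp (CTensor.inl _ y)).toLinearMap)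
      (hr.comp (D.comp (CTensor.inl _ y)).continuous) (fun i x hx => ?_) x
    refine g'.seminorm_eq_zero (r.comp (D.comp (CTensor.inr _ x)).toLinearMap)
      (hr.comp (D.comp (CTensor.inr _ x)).continuous) (fun j y hy => ?_) y
    change r (D (CTensor.tmul ⊥ x y)) = 0
    rw [hD, Finset.sum_congr rfl fun n _ => g.locFinite_tensor_tmul g' n hx hy,
      Finset.sum_ite_eq']
    by_cases hU : i + j ∈ U
    · rw [if_pos hU, sub_self, map_zero]
    · rw [if_neg hU, sub_zero]
      by_cases hi : i ∈ S
      · have hj : j ∉ T := fun hj => hU (Finset.mem_image.2 ⟨(i, j), by simp [hi, hj], rfl⟩)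
        refine hpq _ _ (Or.inr ?_)
        rw [← show g'.proj j y = y from hy]
        exact hT j hj y
      · refine hpq _ _ (Or.inl ?_)
        rw [← show g.proj i x = x from hx]
        exact hS i hi x

theorem Grading.tensor_homog (g : Grading 𝕜 E) (g' : Grading 𝕜 F) {i j : ℤ}
    {x : E} {y : F} (hx : g.Homog i x) (hy : g'.Homog j y) :
    (g.tensor g').Homog (i + j) (CTensor.tmul ⊥ x y) :=
  (g.locFinite_tensor_tmul g' (i + j) hx hy).trans (if_pos rfl)

/-- A map out of `E ⊗̂ F` has degree `k` if it does so on homogeneous tensors. -/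
theorem Grading.tensor_map_homog (g : Grading 𝕜 E) (g' : Grading 𝕜 F) {G : Type u}
    [AddCommGroup G] [Module 𝕜 G] [UniformSpace G] [Clct 𝕜 G] (h : Grading 𝕜 G) (k : ℤ)
    (f : CTensor₀ 𝕜 E F →L[𝕜] G)
    (hf : ∀ i j x y, g.Homog i x → g'.Homog j y → h.Homog (i + j + k) (f (CTensor.tmul ⊥ x y)))
    (n : ℤ) (z : CTensor₀ 𝕜 E F) (hz : (g.tensor g').Homog n z) : h.Homog (n + k) (f z) := by
  have := CTensor.ext_homog g g' ((h.proj (n + k)).comp f) (f.comp ((g.tensor g').proj n))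
    (fun i j x y hx hy => by
      rw [ContinuousLinearMap.comp_apply, ContinuousLinearMap.comp_apply,
        (hf i j x y hx hy).proj_eq, (g.tensor_homog g' hx hy).proj_eq]
      by_cases hn : n = i + j
      · rw [if_pos hn, if_pos (by omega)]
      · rw [if_neg hn, if_neg (by omega), map_zero]) z
  rw [ContinuousLinearMap.comp_apply, ContinuousLinearMap.comp_apply] at this
  rw [Grading.Homog, this, show (g.tensor g').proj n z = z from hz]

end TensorGrading

/-! ## Homogeneous maps of graded modules -/

section GrHomAlgebra

variable {𝕜 : Type v} [RCLike 𝕜]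

theorem Grading.Homog.add {E : Type u} [AddCommGroup E] [Module 𝕜 E] [UniformSpace E]
    {g : Grading 𝕜 E} {n : ℤ} {x y : E} (hx : g.Homog n x) (hy : g.Homog n y) :
    g.Homog n (x + y) := by
  rw [Grading.Homog, map_add, hx, hy]

theorem Grading.Homog.neg {E : Type u} [AddCommGroup E] [Module 𝕜 E] [UniformSpace E]
    {g : Grading 𝕜 E} {n : ℤ} {x : E} (hx : g.Homog n x) : g.Homog n (-x) := by
  rw [Grading.Homog, map_neg, hx]

theorem Grading.Homog.zsmul {E : Type u} [AddCommGroup E] [Module 𝕜 E] [UniformSpace E]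
    {g : Grading 𝕜 E} {n : ℤ} {x : E} (hx : g.Homog n x) (c : ℤ) : g.Homog n (c • x) := by
  rw [Grading.Homog, map_zsmul, hx]

theorem Grading.homog_zero {E : Type u} [AddCommGroup E] [Module 𝕜 E] [UniformSpace E]
    (g : Grading 𝕜 E) (n : ℤ) : g.Homog n 0 := map_zero _

variable {A : DGAlg.{v, u} 𝕜} {M N L : GrMod A} {k l n : ℤ}

instance : FunLike (GrHom k M N) M N where
  coe f := f.toContinuousLinearMap
  coe_injective _ _ h := GrHom.ext h

instance : ContinuousSemilinearMapClass (GrHom k M N) (RingHom.id 𝕜) M N where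
  map_add f := map_add f.toContinuousLinearMap
  map_smulₛₗ f := map_smul f.toContinuousLinearMap
  map_continuous f := f.toContinuousLinearMap.continuous

theorem GrHom.act (f : GrHom k M N) (m : M) (a : A) : f (m <• a) = f m <• a := f.map_act m a

theorem GrHom.homog (f : GrHom k M N) {i : ℤ} {m : M} (hm : M.deg.Homog i m) :
    N.deg.Homog (i + k) (f m) := f.map_homog i m hm

@[simp] theorem GrHom.coe_clm (f : GrHom k M N) (m : M) : f.toContinuousLinearMap m = f m := rfl

/-- A homogeneous `A^#`-linear map from a continuous linear map. -/
def GrHom.of (f : M →L[𝕜] N) (h : ∀ m (a : A), f (m <• a) = f m <• a)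
    (h' : ∀ i m, M.deg.Homog i m → N.deg.Homog (i + k) (f m)) : GrHom k M N :=
  { f with map_act := h, map_homog := h' }

/-- Composition of homogeneous maps. -/
def GrHom.comp (g : GrHom l N L) (f : GrHom k M N) (h : k + l = n := by omega) : GrHom n M L :=
  GrHom.of (g.toContinuousLinearMap.comp f.toContinuousLinearMap)
    (fun m a => by simp [f.act, g.act])
    (fun i m hm => by
      have := g.homog (f.homog hm)
      rwa [add_assoc, h] at this)

@[simp] theorem GrHom.comp_apply (g : GrHom l N L) (f : GrHom k M N) (h : k + l = n) (m : M) :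
    GrHom.comp g f h m = g (f m) := rfl

/-- The identity, as a map of degree `0`. -/
def GrHom.id (M : GrMod A) : GrHom 0 M M :=
  GrHom.of (ContinuousLinearMap.id 𝕜 M) (fun _ _ => rfl) (fun i m hm => by simpa using hm)

@[simp] theorem GrHom.id_apply (m : M) : GrHom.id M m = m := rfl

instance : Zero (GrHom k M N) :=
  ⟨GrHom.of 0 (fun m a => by simp) (fun i m _ => Grading.homog_zero _ _)⟩

instance : Add (GrHom k M N) :=
  ⟨fun f g => GrHom.of (f.toContinuousLinearMap + g.toContinuousLinearMap)
    (fun m a => by simp [f.act, g.act]) (fun _ _ hm => (f.homog hm).add (g.homog hm))⟩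

instance : SMul ℤ (GrHom k M N) :=
  ⟨fun c f => GrHom.of (c • f.toContinuousLinearMap)
    (fun m a => by
      change c • f (m <• a) = (c • f m) <• a
      rw [f.act]
      exact smul_comm c (MulOpposite.op a) (f m)) (fun _ _ hm => (f.homog hm).zsmul c)⟩

instance : Neg (GrHom k M N) :=
  ⟨fun f => GrHom.of (-f.toContinuousLinearMap)
    (fun m a => by simp [f.act]) (fun _ _ hm => (f.homog hm).neg)⟩

instance : Sub (GrHom k M N) :=
  ⟨fun f g => f + -g⟩

@[simp] theorem GrHom.zero_apply (m : M) : (0 : GrHom k M N) m = 0 := rfl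

@[simp] theorem GrHom.add_apply (f g : GrHom k M N) (m : M) : (f + g) m = f m + g m := rfl

@[simp] theorem GrHom.zsmul_apply (c : ℤ) (f : GrHom k M N) (m : M) : (c • f) m = c • f m := rfl

@[simp] theorem GrHom.neg_apply (f : GrHom k M N) (m : M) : (-f) m = -f m := rfl

@[simp] theorem GrHom.sub_apply (f g : GrHom k M N) (m : M) : (f - g) m = f m - g m :=
  (sub_eq_add_neg _ _).symm

end GrHomAlgebra

/-! ## Closed morphisms and homotopies -/

section Homotopies

variable {𝕜 : Type v} [RCLike 𝕜] {A : DGAlg.{v, u} 𝕜} {M N L : DGMod A}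

/-- The map of graded modules underlying a closed morphism. -/
def DGHom.gr (f : M ⟶ N) : GrHom 0 M.toGrMod N.toGrMod := DGHom.toGrHom f

/-- A closed morphism from a map of graded modules. -/
def DGHom.ofGr (f : GrHom 0 M.toGrMod N.toGrMod) (h : ∀ m, f (M.d m) = N.d (f m)) : M ⟶ N :=
  ({ f with map_d := h } : DGHom M N)

@[simp] theorem DGHom.gr_ofGr (f : GrHom 0 M.toGrMod N.toGrMod)
    (h : ∀ m, f (M.d m) = N.d (f m)) (m : M) : (DGHom.ofGr f h).gr m = f m := rfl

theorem DGHom.gr_d (f : M ⟶ N) (m : M) : f.gr (M.d m) = N.d (f.gr m) := f.map_d m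

@[simp] theorem DGHom.gr_id (m : M) : DGHom.gr (𝟙 M) m = m := rfl

@[simp] theorem DGHom.gr_comp (f : M ⟶ N) (g : N ⟶ L) (m : M) :
    DGHom.gr (f ≫ g) m = g.gr (f.gr m) := rfl

theorem DGHom.ext_gr {f g : M ⟶ N} (h : ∀ m, f.gr m = g.gr m) : f = g :=
  DGHom.ext (funext h)

@[simp] theorem DGMod.d_d' (m : M) : M.d (M.d m) = 0 := M.d_d m

theorem dgHomotopic_iff (f g : M ⟶ N) : DGHomotopic A f g ↔
    ∃ h : GrHom (-1) M.toGrMod N.toGrMod, ∀ m, f.gr m - g.gr m = N.d (h m) + h (M.d m) :=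
  Iff.rfl

instance : Congruence (DGHomotopic A) where
  equivalence {M N} :=
    { refl := fun f => ⟨0, fun m => by
        change f.gr m - f.gr m = N.d ((0 : GrHom (-1) M.toGrMod N.toGrMod) m) +
          (0 : GrHom (-1) M.toGrMod N.toGrMod) (M.d m)
        simp⟩
      symm := fun {f g} ⟨h, hh⟩ => ⟨-h, fun m => by
        change g.gr m - f.gr m = N.d ((-h) m) + (-h) (M.d m)
        have h1 : f.gr m - g.gr m = N.d (h m) + h (M.d m) := hh m
        rw [← neg_sub, h1]
        simp [add_comm]⟩
      trans := fun {f g e} ⟨h, hh⟩ ⟨h', hh'⟩ => ⟨h + h', fun m => by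
        change f.gr m - e.gr m = N.d ((h + h') m) + (h + h') (M.d m)
        have h1 : f.gr m - g.gr m = N.d (h m) + h (M.d m) := hh m
        have h2 : g.gr m - e.gr m = N.d (h' m) + h' (M.d m) := hh' m
        rw [← sub_add_sub_cancel, h1, h2]
        simp only [GrHom.add_apply, map_add]
        abel⟩ }
  comp_left {M N L} f g g' := by
    rintro ⟨h, hh⟩
    refine ⟨h.comp f.gr, fun m => ?_⟩
    change g.gr (f.gr m) - g'.gr (f.gr m) = L.d (h (f.gr m)) + h (f.gr (M.d m))
    rw [f.gr_d]
    exact hh _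
  comp_right {M N L} f f' g := by
    rintro ⟨h, hh⟩
    refine ⟨g.gr.comp h, fun m => ?_⟩
    change g.gr (f.gr m) - g.gr (f'.gr m) = L.d (g.gr (h m)) + g.gr (h (M.d m))
    rw [← map_sub, ← g.gr_d, ← map_add]
    exact congrArg g.gr (hh m)

theorem ho_map_eq_iff (f g : M ⟶ N) : (Quotient.functor (DGHomotopic A)).map f =
    (Quotient.functor (DGHomotopic A)).map g ↔ DGHomotopic A f g :=
  Quotient.functor_map_eq_iff _ f g

/-- The identity of `M` is homotopic to zero. -/
def DGMod.Contractible (M : DGMod A) : Prop :=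
  ∃ h : GrHom (-1) M.toGrMod M.toGrMod, ∀ m, M.d (h m) + h (M.d m) = m

/-- If `d h + h d` has a closed left inverse, then the module is contractible. -/
theorem DGMod.contractible_of_left_inverse (h : GrHom (-1) M.toGrMod M.toGrMod)
    (w : GrHom 0 M.toGrMod M.toGrMod) (hw : ∀ m, w (M.d m) = M.d (w m))
    (hh : ∀ m, w (M.d (h m) + h (M.d m)) = m) : M.Contractible :=
  ⟨w.comp h, fun m => by
    rw [GrHom.comp_apply, GrHom.comp_apply, ← hw, ← map_add, hh]⟩

/-- Contractibility passes to retracts. -/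
theorem DGMod.Contractible.retract (hN : N.Contractible) (i : M ⟶ N) (r : N ⟶ M)
    (h : ∀ m, r.gr (i.gr m) = m) : M.Contractible := by
  obtain ⟨c, hc⟩ := hN
  refine ⟨(r.gr.comp c (n := -1)).comp i.gr, fun m => ?_⟩
  simp only [GrHom.comp_apply]
  rw [← r.gr_d, i.gr_d, ← map_add, hc, h]

theorem AcCtr.of_retract (hN : AcCtr A N) (i : M ⟶ N) (r : N ⟶ M)
    (h : ∀ m, r.gr (i.gr m) = m) : AcCtr A M := by
  refine AcCtr.retract M N ⟨⟨(Quotient.functor (DGHomotopic A)).map i,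
    (Quotient.functor (DGHomotopic A)).map r, ?_⟩⟩ hN
  rw [← Functor.map_comp, show i ≫ r = 𝟙 M from DGHom.ext_gr h]
  exact CategoryTheory.Functor.map_id _ _

end Homotopies

/-! ## Shifts, cones, products and twisted differentials -/

section ConeApi

variable {𝕜 : Type v} [RCLike 𝕜] {A : DGAlg.{v, u} 𝕜}

/-- The identity `M → M[k]`, of degree `-k`. -/
def DGMod.toShift (M : DGMod A) (k : ℤ) : GrHom (-k) M.toGrMod (M.shift k).toGrMod :=
  GrHom.of (ContinuousLinearMap.id 𝕜 M) (fun _ _ => rfl) (fun i m hm => by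
    change M.deg.Homog (i + -k + k) m
    simpa using hm)

/-- The identity `M[k] → M`, of degree `k`. -/
def DGMod.ofShift (M : DGMod A) (k : ℤ) : GrHom k (M.shift k).toGrMod M.toGrMod :=
  GrHom.of (ContinuousLinearMap.id 𝕜 M) (fun _ _ => rfl) (fun _ _ hm => hm)

@[simp] theorem DGMod.ofShift_toShift (M : DGMod A) (k : ℤ) (m : M) :
    M.ofShift k (M.toShift k m) = m := rfl

theorem DGMod.ofShift_injective (M : DGMod A) (k : ℤ) : Function.Injective (M.ofShift k) :=
  fun _ _ h => h

theorem DGMod.ofShift_d (M : DGMod A) (k : ℤ) (m : M.shift k) :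
    M.ofShift k ((M.shift k).d m) = (k.negOnePow : ℤ) • M.d (M.ofShift k m) := rfl

theorem DGMod.shift_d (M : DGMod A) (k : ℤ) (m : M) :
    (M.shift k).d (M.toShift k m) = (k.negOnePow : ℤ) • M.toShift k (M.d m) := rfl

variable {M N : DGMod A} (f : M ⟶ N)

/-- The component `M → cone f` of degree `-1`. -/
def coneInl : GrHom (-1) M.toGrMod f.cone.toGrMod :=
  GrHom.of (ContinuousLinearMap.inl 𝕜 M N) (fun m a => Prod.ext rfl (smul_zero _).symm)
    (fun i m hm => Prod.ext (by
      change M.deg.Homog (i + -1 + 1) m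
      simpa using hm) (N.deg.homog_zero _))

/-- The inclusion `N → cone f`. -/
def coneInr : GrHom 0 N.toGrMod f.cone.toGrMod :=
  GrHom.of (ContinuousLinearMap.inr 𝕜 M N) (fun m a => Prod.ext (smul_zero _).symm rfl)
    (fun i m hm => Prod.ext (M.deg.homog_zero _) (by
      change N.deg.Homog (i + 0) m
      simpa using hm))

/-- The component `cone f → M` of degree `1`. -/
def coneFst : GrHom 1 f.cone.toGrMod M.toGrMod :=
  GrHom.of (ContinuousLinearMap.fst 𝕜 M N) (fun _ _ => rfl) (fun _ _ hm => congrArg Prod.fst hm)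

/-- The component `cone f → N`. -/
def coneSnd : GrHom 0 f.cone.toGrMod N.toGrMod :=
  GrHom.of (ContinuousLinearMap.snd 𝕜 M N) (fun _ _ => rfl) (fun i m hm => by
    rw [add_zero]
    exact congrArg Prod.snd hm)

variable {f}

@[simp] theorem coneFst_inl (m : M) : coneFst f (coneInl f m) = m := rfl
@[simp] theorem coneFst_inr (m : N) : coneFst f (coneInr f m) = 0 := rfl
@[simp] theorem coneSnd_inl (m : M) : coneSnd f (coneInl f m) = 0 := rfl
@[simp] theorem coneSnd_inr (m : N) : coneSnd f (coneInr f m) = m := rfl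
@[simp] theorem coneFst_d (x : f.cone) : coneFst f (f.cone.d x) = -M.d (coneFst f x) := rfl
@[simp] theorem coneSnd_d (x : f.cone) :
    coneSnd f (f.cone.d x) = f.gr (coneFst f x) + N.d (coneSnd f x) := rfl

theorem cone_ext {x y : f.cone} (h : coneFst f x = coneFst f y)
    (h' : coneSnd f x = coneSnd f y) : x = y := Prod.ext h h'

theorem cone_eta (x : f.cone) : coneInl f (coneFst f x) + coneInr f (coneSnd f x) = x :=
  cone_ext (by simp) (by simp)

@[simp] theorem cone_d_inl (m : M) :
    f.cone.d (coneInl f m) = -coneInl f (M.d m) + coneInr f (f.gr m) :=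
  cone_ext (by simp) (by simp)

@[simp] theorem cone_d_inr (m : N) : f.cone.d (coneInr f m) = coneInr f (N.d m) :=
  cone_ext (by simp) (by simp)

/-- The cone of a homotopy equivalence is contractible. -/
theorem cone_contractible (g : N ⟶ M) (s : GrHom (-1) M.toGrMod M.toGrMod)
    (t : GrHom (-1) N.toGrMod N.toGrMod)
    (hs : ∀ m, g.gr (f.gr m) - m = M.d (s m) + s (M.d m))
    (ht : ∀ m, f.gr (g.gr m) - m = N.d (t m) + t (N.d m)) : f.cone.Contractible := by
  let θ : GrHom (-1) M.toGrMod N.toGrMod := f.gr.comp s - t.comp f.gr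
  have hθ : ∀ m, θ (M.d m) = -N.d (θ m) := by
    intro m
    have h1 := congrArg f.gr (hs m)
    have h2 := ht (f.gr m)
    simp only [map_sub, map_add, f.gr_d] at h1 h2
    simp only [θ, GrHom.sub_apply, GrHom.comp_apply, map_sub, f.gr_d]
    rw [← sub_eq_zero]
    have h3 := h1.symm.trans h2
    rw [← sub_eq_zero] at h3
    rw [← h3]
    abel
  let h : GrHom (-1) f.cone.toGrMod f.cone.toGrMod :=
    (coneInl f).comp (g.gr.comp (coneSnd f) + s.comp (coneFst f) : GrHom 0 _ _)
      - (coneInr f).comp (t.comp (coneSnd f) : GrHom (-1) _ _)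
  let w : GrHom 0 f.cone.toGrMod f.cone.toGrMod :=
    GrHom.id _ - (coneInr f).comp (θ.comp (coneFst f) : GrHom 0 _ _)
  have hy : ∀ x, coneFst f (f.cone.d (h x) + h (f.cone.d x)) = coneFst f x := by
    intro x
    have hs' := hs (coneFst f x)
    rw [sub_eq_iff_eq_add] at hs'
    simp only [h, GrHom.sub_apply, GrHom.add_apply, GrHom.comp_apply, map_sub,
      map_add, coneSnd_d, coneFst_d, coneFst_inl, map_neg, coneFst_inr, map_zero, g.gr_d, hs']
    abel
  have hy' : ∀ x, coneSnd f (f.cone.d (h x) + h (f.cone.d x)) =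
      coneSnd f x + θ (coneFst f x) := by
    intro x
    have ht' := ht (coneSnd f x)
    rw [sub_eq_iff_eq_add] at ht'
    simp only [h, θ, GrHom.sub_apply, GrHom.add_apply, GrHom.comp_apply, map_sub,
      map_add, coneSnd_d, coneFst_d, coneFst_inl, map_neg, coneFst_inr, map_zero, g.gr_d, ht',
      coneSnd_inl, coneSnd_inr]
    abel
  refine DGMod.contractible_of_left_inverse h w (fun x => ?_) fun x => ?_
  · refine cone_ext (by simp [w]) ?_
    simp only [w, GrHom.sub_apply, GrHom.id_apply, GrHom.comp_apply, map_sub, coneSnd_d, coneSnd_inr,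
      coneFst_d, map_neg, hθ, coneFst_inr, map_zero]
    abel
  · refine cone_ext ?_ ?_
    · simp only [w, GrHom.sub_apply, GrHom.id_apply, GrHom.comp_apply, map_sub, hy, coneFst_inr,
        sub_zero]
    · simp only [w, GrHom.sub_apply, GrHom.id_apply, GrHom.comp_apply, map_sub, hy, hy',
        coneSnd_inr, add_sub_cancel_right]

end ConeApi

/-! ## Countable products and twisted differentials -/

section NatPi

variable {𝕜 : Type v} [RCLike 𝕜]

/-- The product of a sequence of graded spaces. -/
def Grading.natPi {E : ℕ → Type u} [∀ i, AddCommGroup (E i)] [∀ i, Module 𝕜 (E i)]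
    [∀ i, UniformSpace (E i)] (g : ∀ i, Grading 𝕜 (E i)) : Grading 𝕜 (∀ i, E i) where
  proj n := ContinuousLinearMap.pi fun i => ((g i).proj n).comp (ContinuousLinearMap.proj i)
  proj_proj i j x := by
    ext l
    by_cases hij : i = j <;> simp [(g l).proj_proj, hij]
  inducing := by
    refine IsInducing.of_comp
      (g := fun (y : ℤ → ∀ i, E i) => (fun i n => y n i : ∀ i, ℤ → E i))
      (by fun_prop) (by fun_prop) ?_
    exact IsInducing.piMap fun i => (g i).inducing

variable {A : DGAlg.{v, u} 𝕜}

/-- The product of a sequence of dg-modules. -/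
def DGMod.natPi (T : ℕ → DGMod A) : DGMod A where
  carrier := ∀ i, T i
  deg := Grading.natPi fun i => (T i).deg
  act_homog i j m a hm ha := by
    ext l
    exact (T l).act_homog i j (m l) a (congrFun hm l) ha
  d := ContinuousLinearMap.pi fun i => (T i).d.comp (ContinuousLinearMap.proj i)
  d_homog i m hm := by
    ext l
    exact (T l).d_homog i (m l) (congrFun hm l)
  d_d m := by
    ext l
    exact (T l).d_d (m l)
  leibniz i m a hm := by
    ext l
    exact (T l).leibniz i (m l) a (congrFun hm l)

variable (T : ℕ → DGMod A)

/-- The projections of a product. -/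
def natProj (n : ℕ) : GrHom 0 (DGMod.natPi T).toGrMod (T n).toGrMod :=
  GrHom.of (ContinuousLinearMap.proj (R := 𝕜) (φ := fun i => T i) n) (fun _ _ => rfl)
    (fun i m hm => by
      rw [add_zero]
      exact congrFun hm n)

variable {T}

/-- The map to a product with given components. -/
def natLift {M : GrMod A} {k : ℤ} (f : ∀ n, GrHom k M (T n).toGrMod) :
    GrHom k M (DGMod.natPi T).toGrMod :=
  GrHom.of (ContinuousLinearMap.pi (φ := fun i => T i) fun n => (f n).toContinuousLinearMap)
    (fun m a => funext fun n => (f n).act m a)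
    (fun _ _ hm => funext fun n => (f n).homog hm)

@[simp] theorem natProj_lift {M : GrMod A} {k : ℤ} (f : ∀ n, GrHom k M (T n).toGrMod) (m : M)
    (n : ℕ) : natProj T n (natLift f m) = f n m := rfl

@[simp] theorem natProj_d (x : DGMod.natPi T) (n : ℕ) :
    natProj T n ((DGMod.natPi T).d x) = (T n).d (natProj T n x) := rfl

theorem natPi_ext {x y : DGMod.natPi T} (h : ∀ n, natProj T n x = natProj T n y) : x = y :=
  funext h

theorem AcCtr.natPi (h : ∀ n, AcCtr A (T n)) : AcCtr A (DGMod.natPi T) := by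
  let U : ULift.{u} ℕ → DGMod A := fun j => T j.down
  have hU : AcCtr A (DGMod.pi U) := AcCtr.pi U fun j => h j.down
  let i : GrHom 0 (DGMod.natPi T).toGrMod (DGMod.pi U).toGrMod :=
    GrHom.of (ContinuousLinearMap.pi (φ := fun j => U j) fun j =>
        (natProj T j.down).toContinuousLinearMap)
      (fun m a => rfl) (fun i m hm => by
        rw [add_zero]
        exact funext fun j => congrFun hm j.down)
  let r : GrHom 0 (DGMod.pi U).toGrMod (DGMod.natPi T).toGrMod :=
    GrHom.of (ContinuousLinearMap.pi (φ := fun i => T i) fun n =>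
        ContinuousLinearMap.proj (R := 𝕜) (φ := fun j => U j) (ULift.up n))
      (fun m a => rfl) (fun i m hm => by
        rw [add_zero]
        exact funext fun n => congrFun hm (ULift.up n))
  exact AcCtr.of_retract hU (DGHom.ofGr i fun m => rfl) (DGHom.ofGr r fun m => rfl) fun m => rfl

/-- The dg-module `M` with the differential `d + N`. -/
def DGMod.twist (M : DGMod A) (N : GrHom 1 M.toGrMod M.toGrMod)
    (h : ∀ m, M.d (N m) + N (M.d m) + N (N m) = 0) : DGMod A where
  toGrMod := M.toGrMod
  d := M.d + N.toContinuousLinearMap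
  d_homog i m hm := (M.d_homog i m hm).add (N.homog hm)
  d_d m := by
    simp only [add_apply, GrHom.coe_clm, map_add, M.d_d]
    rw [zero_add, ← add_assoc, add_comm (N (M.d m))]
    exact h m
  leibniz i m a hm := by
    simp only [add_apply, GrHom.coe_clm, M.leibniz i m a hm, N.act, smul_add]
    abel

theorem AcCtr.of_shift {M : DGMod A} {k : ℤ} (h : AcCtr A (M.shift k)) : AcCtr A M := by
  have hs : ∀ x : M, ((-k).negOnePow : ℤ) • (k.negOnePow : ℤ) • x = x := by
    intro x
    rw [smul_smul, ← Units.val_mul, ← Int.negOnePow_add, neg_add_cancel]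
    simp
  refine AcCtr.of_retract (h.shift _ (-k))
    (DGHom.ofGr (((M.shift k).toShift (-k)).comp (M.toShift k)) fun m => ?_)
    (DGHom.ofGr ((M.ofShift k).comp ((M.shift k).ofShift (-k))) fun m => ?_) fun m => rfl
  · exact (hs (M.d m)).symm
  · exact hs (M.d m)

end NatPi

section Twisted

variable {𝕜 : Type v} [RCLike 𝕜] {A : DGAlg.{v, u} 𝕜}

/-- Maps `δ n : T n → T (n + 1)` of degree `1` which square to zero and anticommute with the
differentials. -/
structure TwData (T : ℕ → DGMod A) where
  δ : ∀ n, GrHom 1 (T n).toGrMod (T (n + 1)).toGrMod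
  d_δ : ∀ n x, (T (n + 1)).d (δ n x) = -δ n ((T n).d x)
  δ_δ : ∀ n x, δ (n + 1) (δ n x) = 0

namespace TwData

variable {T : ℕ → DGMod A} (X : TwData T)

/-- The shifted components of the twisting map. -/
def prev : ∀ n, GrHom 1 (DGMod.natPi T).toGrMod (T n).toGrMod
  | 0 => 0
  | n + 1 => (X.δ n).comp (natProj T n)

/-- The twisted product `(∏ T n, d + δ)`. -/
def tw : DGMod A :=
  (DGMod.natPi T).twist (natLift X.prev) (fun m => natPi_ext fun n => by
    rcases n with _ | _ | n
    · simp [prev]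
    · simp [prev, X.d_δ]
    · simp [prev, X.d_δ, X.δ_δ])

/-- The projections of the twisted product. -/
def pr (n : ℕ) : GrHom 0 X.tw.toGrMod (T n).toGrMod := natProj T n

/-- The map to the twisted product with given components. -/
def lift {M : GrMod A} {k : ℤ} (f : ∀ n, GrHom k M (T n).toGrMod) : GrHom k M X.tw.toGrMod :=
  natLift f

@[simp] theorem pr_lift {M : GrMod A} {k : ℤ} (f : ∀ n, GrHom k M (T n).toGrMod) (m : M) (n : ℕ) :
    X.pr n (X.lift f m) = f n m := rfl

@[simp] theorem pr_zero_d (x : X.tw) : X.pr 0 (X.tw.d x) = (T 0).d (X.pr 0 x) := add_zero _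

@[simp] theorem pr_succ_d (x : X.tw) (n : ℕ) :
    X.pr (n + 1) (X.tw.d x) = (T (n + 1)).d (X.pr (n + 1) x) + X.δ n (X.pr n x) := rfl

theorem ext_pr {x y : X.tw} (h : ∀ n, X.pr n x = X.pr n y) : x = y := funext h

/-- The twisting maps up to index `k`. -/
def trunc (k : ℕ) : TwData T where
  δ n := if n < k then X.δ n else 0
  d_δ n x := by
    split_ifs
    · exact X.d_δ n x
    · simp
  δ_δ n x := by
    split_ifs
    · exact X.δ_δ n x
    all_goals simp

theorem trunc_δ_of_lt {n k : ℕ} (h : n < k) (x : T n) : (X.trunc k).δ n x = X.δ n x := by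
  simp [trunc, h]

theorem trunc_δ_of_le {n k : ℕ} (h : k ≤ n) (x : T n) : (X.trunc k).δ n x = 0 := by
  simp [trunc, Nat.not_lt.2 h]

theorem δ_pr_d (k n : ℕ) (x : (X.trunc k).tw) : X.δ n ((X.trunc k).pr n ((X.trunc k).tw.d x)) =
    X.δ n ((T n).d ((X.trunc k).pr n x)) := by
  rcases n with _ | n
  · simp
  · rw [pr_succ_d, map_add]
    by_cases h : n < k
    · rw [X.trunc_δ_of_lt h, X.δ_δ, add_zero]
    · rw [X.trunc_δ_of_le (not_lt.1 h), map_zero, add_zero]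

/-- Keep the component `n` if `p` holds. -/
def keep {M : GrMod A} {k : ℤ} {N : GrMod A} (p : Prop) [Decidable p] (f : GrHom k M N) :
    GrHom k M N := if p then f else 0

theorem keep_pos {M : GrMod A} {k : ℤ} {N : GrMod A} {p : Prop} [Decidable p] (f : GrHom k M N)
    (h : p) (x : M) : keep p f x = f x := by simp [keep, h]

theorem keep_neg {M : GrMod A} {k : ℤ} {N : GrMod A} {p : Prop} [Decidable p] (f : GrHom k M N)
    (h : ¬p) (x : M) : keep p f x = 0 := by simp [keep, h]

theorem acCtr_trunc_zero (hT : ∀ n, AcCtr A (T n)) : AcCtr A (X.trunc 0).tw := by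
  refine AcCtr.of_retract (AcCtr.natPi hT)
    (DGHom.ofGr (natLift (X.trunc 0).pr) fun m => natPi_ext fun n => ?_)
    (DGHom.ofGr ((X.trunc 0).lift (natProj T)) fun m => (X.trunc 0).ext_pr fun n => ?_)
    fun m => rfl
  · rcases n with _ | n
    · simp
    · simp [X.trunc_δ_of_le]
  · rcases n with _ | n
    · simp
    · simp [X.trunc_δ_of_le]

/-- The components of `stepMap`. -/
def stepComp (k : ℕ) : ∀ n, GrHom 0 ((X.trunc k).tw.shift (-1)).toGrMod (T n).toGrMod
  | 0 => 0
  | n + 1 => keep (n = k)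
      ((X.δ n).comp (((X.trunc k).pr n).comp ((X.trunc k).tw.ofShift (-1)) : GrHom (-1) _ _))

/-- The map whose cone is the next truncated twisted product, up to retracts. -/
def stepMap (k : ℕ) : (X.trunc k).tw.shift (-1) ⟶ DGMod.natPi T :=
  DGHom.ofGr (natLift (X.stepComp k)) fun m => natPi_ext fun n => by
    rcases n with _ | n
    · simp [stepComp]
    · simp only [natProj_lift, natProj_d, stepComp]
      by_cases h : n = k
      · rw [keep_pos _ h, keep_pos _ h]
        simp only [GrHom.comp_apply, DGMod.ofShift_d, map_zsmul, X.δ_pr_d, X.d_δ]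
        simp
      · rw [keep_neg _ h, keep_neg _ h, map_zero]

theorem stepMap_same (k : ℕ) (x : (X.trunc k).tw.shift (-1)) :
    natProj T (k + 1) ((X.stepMap k).gr x) =
      X.δ k ((X.trunc k).pr k ((X.trunc k).tw.ofShift (-1) x)) :=
  keep_pos _ rfl x

theorem stepMap_ne {k n : ℕ} (h : n ≠ k) (x : (X.trunc k).tw.shift (-1)) :
    natProj T (n + 1) ((X.stepMap k).gr x) = 0 :=
  keep_neg _ h x

theorem acCtr_trunc_succ (hT : ∀ n, AcCtr A (T n)) (k : ℕ) (hk : AcCtr A (X.trunc k).tw) :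
    AcCtr A (X.trunc (k + 1)).tw := by
  have hc : AcCtr A (X.stepMap k).cone := (hk.shift _ (-1)).cone _ (AcCtr.natPi hT)
  let lo : GrHom 0 (X.trunc (k + 1)).tw.toGrMod (X.trunc k).tw.toGrMod :=
    (X.trunc k).lift fun n => keep (n ≤ k) ((X.trunc (k + 1)).pr n)
  let hi : GrHom 0 (X.trunc (k + 1)).tw.toGrMod (DGMod.natPi T).toGrMod :=
    natLift fun n => keep (¬ n ≤ k) ((X.trunc (k + 1)).pr n)
  let i : GrHom 0 (X.trunc (k + 1)).tw.toGrMod (X.stepMap k).cone.toGrMod :=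
    (coneInl _).comp (((X.trunc k).tw.toShift (-1)).comp lo : GrHom 1 _ _) + (coneInr _).comp hi
  let r : GrHom 0 (X.stepMap k).cone.toGrMod (X.trunc (k + 1)).tw.toGrMod :=
    (X.trunc (k + 1)).lift fun n =>
      keep (n ≤ k) (((X.trunc k).pr n).comp (((X.trunc k).tw.ofShift (-1)).comp (coneFst _) :
        GrHom 0 _ _)) + keep (¬ n ≤ k) ((natProj T n).comp (coneSnd _))
  have hlo : ∀ m, (X.trunc k).tw.d (lo m) = lo ((X.trunc (k + 1)).tw.d m) := by
    intro m
    refine (X.trunc k).ext_pr fun n => ?_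
    rcases n with _ | n
    · simp [lo, keep_pos]
    · rw [pr_succ_d]
      simp only [lo, pr_lift]
      by_cases h : n + 1 ≤ k
      · rw [keep_pos _ h, keep_pos _ h, keep_pos _ (by omega), pr_succ_d,
          X.trunc_δ_of_lt (by omega), X.trunc_δ_of_lt (by omega)]
      · rw [keep_neg _ h, keep_neg _ h, map_zero, zero_add, X.trunc_δ_of_le (by omega)]
  refine AcCtr.of_retract hc (DGHom.ofGr i fun m => cone_ext ?_ ?_)
    (DGHom.ofGr r fun x => (X.trunc (k + 1)).ext_pr fun n => ?_) fun m => ?_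
  · simp only [i, GrHom.add_apply, GrHom.comp_apply, map_add, coneFst_inl, coneFst_inr, add_zero,
      coneFst_d]
    rw [← hlo, DGMod.shift_d]
    simp
  · simp only [i, GrHom.add_apply, GrHom.comp_apply, map_add, coneSnd_inl, coneSnd_inr, zero_add,
      coneSnd_d, coneFst_inl, coneFst_inr, map_zero, add_zero]
    refine natPi_ext fun n => ?_
    rcases n with _ | n
    · simp [hi, keep, stepMap, stepComp]
    · simp only [hi, natProj_lift, map_add, natProj_d]
      by_cases h : n = k
      · subst h
        rw [keep_pos _ (by omega), X.stepMap_same, keep_pos _ (by omega), pr_succ_d,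
          X.trunc_δ_of_lt (by omega)]
        simp only [DGMod.ofShift_toShift, lo, pr_lift]
        rw [keep_pos _ le_rfl]
        exact add_comm _ _
      · rw [X.stepMap_ne h]
        by_cases h' : n + 1 ≤ k
        · rw [keep_neg _ (by omega), keep_neg _ (by omega), map_zero, add_zero]
        · rw [keep_pos _ (by omega), keep_pos _ (by omega), pr_succ_d,
            X.trunc_δ_of_le (by omega), add_zero, zero_add]
  · rcases n with _ | n
    · simp [r, keep, DGMod.ofShift_d]
    · rw [pr_succ_d]
      simp only [r, pr_lift, GrHom.add_apply]
      by_cases h : n + 1 ≤ k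
      · rw [keep_pos _ h, keep_neg _ (by omega), keep_pos _ h, keep_neg _ (by omega),
          keep_pos _ (by omega), keep_neg _ (by omega), X.trunc_δ_of_lt (by omega)]
        simp [DGMod.ofShift_d, X.trunc_δ_of_lt (show n < k by omega)]
      · rw [keep_neg _ h, keep_pos _ h, keep_neg _ h, keep_pos _ h]
        by_cases h' : n = k
        · subst h'
          rw [keep_pos _ le_rfl, keep_neg _ (by omega), X.trunc_δ_of_lt (by omega)]
          simp only [GrHom.comp_apply, coneSnd_d, map_add, natProj_d, zero_add, add_zero,
            X.stepMap_same]
          exact add_comm (X.δ n _) ((T (n + 1)).d _)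
        · rw [keep_neg _ (by omega), keep_pos _ (by omega), X.trunc_δ_of_le (by omega)]
          simp only [GrHom.comp_apply, coneSnd_d, map_add, natProj_d, zero_add, add_zero,
            X.stepMap_ne h']
  · refine (X.trunc (k + 1)).ext_pr fun n => ?_
    simp only [DGHom.gr_ofGr, r, i, pr_lift, GrHom.add_apply]
    by_cases h : n ≤ k
    · rw [keep_pos _ h, keep_neg _ (by omega)]
      simp only [GrHom.comp_apply, map_add, coneFst_inl, coneFst_inr, add_zero,
        DGMod.ofShift_toShift, lo, pr_lift, keep_pos _ h, map_zero]
    · rw [keep_neg _ h, keep_pos _ h]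
      simp only [GrHom.comp_apply, map_add, coneSnd_inl, coneSnd_inr, zero_add, hi, natProj_lift,
        keep_pos _ h, map_zero]

theorem acCtr_trunc (hT : ∀ n, AcCtr A (T n)) (k : ℕ) : AcCtr A (X.trunc k).tw := by
  induction k with
  | zero => exact X.acCtr_trunc_zero hT
  | succ k ih => exact X.acCtr_trunc_succ hT k ih

/-- The restriction between truncated twisted products. -/
def restr (k : ℕ) : (X.trunc (k + 1)).tw ⟶ (X.trunc k).tw :=
  DGHom.ofGr ((X.trunc k).lift fun n => keep (n ≤ k) ((X.trunc (k + 1)).pr n)) fun m => by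
    refine (X.trunc k).ext_pr fun n => ?_
    rcases n with _ | n
    · simp [keep_pos]
    · rw [pr_succ_d]
      simp only [pr_lift]
      by_cases h : n + 1 ≤ k
      · rw [keep_pos _ h, keep_pos _ h, keep_pos _ (by omega), pr_succ_d,
          X.trunc_δ_of_lt (by omega), X.trunc_δ_of_lt (by omega)]
      · rw [keep_neg _ h, keep_neg _ h, map_zero, zero_add, X.trunc_δ_of_le (by omega)]

/-- The difference of the identity and the restrictions. -/
def milnorMap : DGMod.natPi (fun k => (X.trunc k).tw) ⟶ DGMod.natPi (fun k => (X.trunc k).tw) :=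
  DGHom.ofGr (natLift fun k => natProj (fun k => (X.trunc k).tw) k -
      (X.restr k).gr.comp (natProj (fun k => (X.trunc k).tw) (k + 1)))
    fun m => natPi_ext fun k => by
      simp [DGHom.gr_d]

/-- The correction term of the retraction from the cone of `milnorMap`. -/
def milnorCorr : ∀ n, GrHom 1 (DGMod.natPi (fun k => (X.trunc k).tw)).toGrMod (T n).toGrMod
  | 0 => 0
  | n + 1 => (X.δ n).comp (((X.trunc n).pr n).comp (natProj (fun k => (X.trunc k).tw) n) :
      GrHom 0 _ _)

/-- A twisted product of contraacyclic modules is contraacyclic. -/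
theorem acCtr (hT : ∀ n, AcCtr A (T n)) : AcCtr A X.tw := by
  have hP : AcCtr A (DGMod.natPi fun k => (X.trunc k).tw) := AcCtr.natPi (X.acCtr_trunc hT)
  have hc : AcCtr A X.milnorMap.cone := hP.cone _ hP
  refine AcCtr.of_shift (k := 1) ?_
  let res : GrHom 0 X.tw.toGrMod (DGMod.natPi fun k => (X.trunc k).tw).toGrMod :=
    natLift fun k => (X.trunc k).lift fun n => keep (n ≤ k) (X.pr n)
  have hres : ∀ m, (DGMod.natPi fun k => (X.trunc k).tw).d (res m) = res (X.tw.d m) := by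
    intro m
    refine natPi_ext fun k => ?_
    simp only [natProj_d, res, natProj_lift]
    refine (X.trunc k).ext_pr fun n => ?_
    rcases n with _ | n
    · simp [keep_pos]
    · rw [pr_succ_d]
      simp only [pr_lift]
      by_cases h : n + 1 ≤ k
      · rw [keep_pos _ h, keep_pos _ h, keep_pos _ (by omega), pr_succ_d,
          X.trunc_δ_of_lt (by omega)]
      · rw [keep_neg _ h, keep_neg _ h, map_zero, zero_add, X.trunc_δ_of_le (by omega)]
  have hm : ∀ m, X.milnorMap.gr (res m) = 0 := by
    intro m
    refine natPi_ext fun k => (X.trunc k).ext_pr fun n => ?_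
    simp only [milnorMap, DGHom.gr_ofGr, natProj_lift, GrHom.sub_apply, GrHom.comp_apply, restr,
      map_sub, pr_lift, res, map_zero]
    by_cases h : n ≤ k
    · rw [keep_pos _ h, keep_pos _ h, pr_lift, keep_pos _ (by omega), sub_self]
    · rw [keep_neg _ h, keep_neg _ h, sub_zero]
  let i : GrHom 0 (X.tw.shift 1).toGrMod X.milnorMap.cone.toGrMod :=
    (coneInl _).comp (res.comp (X.tw.ofShift 1) : GrHom 1 _ _)
  let r : GrHom 0 X.milnorMap.cone.toGrMod (X.tw.shift 1).toGrMod :=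
    (X.tw.toShift 1).comp (X.lift fun n =>
      (((X.trunc n).pr n).comp ((natProj (fun k => (X.trunc k).tw) n).comp (coneFst _) :
        GrHom 1 _ _) - (X.milnorCorr n).comp (coneSnd _) : GrHom 1 _ _))
  refine AcCtr.of_retract hc (DGHom.ofGr i fun m => cone_ext ?_ ?_)
    (DGHom.ofGr r fun x => X.tw.ofShift_injective 1 (X.ext_pr fun n => ?_)) fun m =>
      X.tw.ofShift_injective 1 (X.ext_pr fun n => ?_)
  · simp [i, DGMod.ofShift_d, hres]
  · simp [i, hm]
  · rw [DGMod.ofShift_d]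
    rcases n with _ | n
    · simp [r, milnorCorr]
    · simp only [r, GrHom.comp_apply, DGMod.ofShift_toShift, pr_lift, GrHom.sub_apply, coneFst_d,
        coneSnd_d, map_add, map_neg, natProj_d, pr_succ_d, milnorCorr, map_zsmul, map_sub, X.d_δ,
        X.δ_pr_d]
      rw [X.trunc_δ_of_lt (by omega)]
      have hm2 : ∀ x, X.δ n ((X.trunc n).pr n (natProj (fun k => (X.trunc k).tw) n
          (X.milnorMap.gr x))) = X.δ n ((X.trunc n).pr n (natProj (fun k => (X.trunc k).tw) n x)) -
            X.δ n ((X.trunc (n + 1)).pr n (natProj (fun k => (X.trunc k).tw) (n + 1) x)) := by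
        intro x
        simp only [milnorMap, DGHom.gr_ofGr, natProj_lift, GrHom.sub_apply, GrHom.comp_apply,
          restr, map_sub, pr_lift]
        rw [keep_pos _ le_rfl]
      rw [hm2]
      rcases n with _ | n
      · simp
        abel
      · simp [X.δ_δ]
        abel
  · rcases n with _ | n
    · simp [r, i, res, milnorCorr, keep_pos]
    · simp [r, i, res, milnorCorr, keep_pos]

end TwData

end Twisted

/-! ## Free graded modules -/

section FreeModules

variable {𝕜 : Type v} [RCLike 𝕜] {A : DGAlg.{v, u} 𝕜}

theorem GrMod.smul_act (X : GrMod A) (c : 𝕜) (m : X) (a : A) : (c • m) <• a = c • (m <• a) := by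
  rw [← smul_one_smul Aᵐᵒᵖ c m, smul_smul, mul_smul_comm, mul_one, smul_assoc]

theorem GrMod.act_smul (X : GrMod A) (c : 𝕜) (m : X) (a : A) : m <• (c • a) = c • (m <• a) := by
  rw [MulOpposite.op_smul, smul_assoc]

/-- The action as a bilinear map. -/
def GrMod.actₗ (X : GrMod A) : X →ₗ[𝕜] A →ₗ[𝕜] X :=
  LinearMap.mk₂ 𝕜 (fun m a => m <• a) (fun _ _ _ => smul_add _ _ _)
    (fun c m a => X.smul_act c m a)
    (fun m a b => by rw [MulOpposite.op_add, add_smul]) (fun c m a => X.act_smul c m a)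

theorem GrMod.continuous_actₗ (X : GrMod A) : Continuous fun z : X × A => X.actₗ z.1 z.2 :=
  (MulOpposite.continuous_op.comp continuous_snd).smul continuous_fst

/-- The graded-free module `W ⊗̂ A^#`. -/
noncomputable def freeGr (W : GrSpace.{v, u} 𝕜) (A : DGAlg.{v, u} 𝕜) : GrMod A :=
  letI := CTensor.moduleOp (⊥ : Submodule 𝕜 (W ⊗[𝕜] A)) rightStable_bot
  { carrier := CTensor₀ 𝕜 W A
    deg := W.deg.tensor A.deg
    tower := CTensor.tower_op ⊥ rightStable_bot
    continuousAct := CTensor.continuousSMul_op ⊥ rightStable_bot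
    act_homog := fun i j z a hz ha => by
      refine Grading.tensor_map_homog W.deg A.deg (W.deg.tensor A.deg) j
        (CTensor.right ⊥ rightStable_bot a) (fun i' j' w b hw hb => ?_) i z hz
      rw [CTensor.right_tmul, add_assoc]
      exact Grading.tensor_homog _ _ hw (A.mul_homog j' j b a hb ha) }

variable {W W' : GrSpace.{v, u} 𝕜} {M N X Y : GrMod A} {k l : ℤ}

/-- Pure tensors in `W ⊗̂ A^#`. -/
noncomputable def ftmul (w : W) (a : A) : freeGr W A := CTensor.tmul ⊥ w a

@[simp] theorem ftmul_act (w : W) (a b : A) : (ftmul w a : freeGr W A) <• b = ftmul w (a * b) :=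
  CTensor.right_tmul rightStable_bot b w a

theorem ftmul_one_act (w : W) (a : A) : (ftmul w 1 : freeGr W A) <• a = ftmul w a := by
  rw [ftmul_act, one_mul]

theorem ftmul_homog {i j : ℤ} {w : W} {a : A} (hw : W.deg.Homog i w) (ha : A.deg.Homog j a) :
    (freeGr W A).deg.Homog (i + j) (ftmul w a) := Grading.tensor_homog _ _ hw ha

theorem free_ext_clm {G : Type u} [AddCommGroup G] [Module 𝕜 G] [UniformSpace G] [T2Space G]
    (f g : freeGr W A →L[𝕜] G)
    (h : ∀ (w : W) (a : A), f (ftmul w a) = g (ftmul w a)) (z : freeGr W A) : f z = g z :=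
  CTensor.ext (K := (⊥ : Submodule 𝕜 (W ⊗[𝕜] A))) f g h z

/-- Homogeneous maps out of a free module are determined by the generators. -/
theorem free_ext (f g : GrHom k (freeGr W A) X)
    (h : ∀ w : W, f (ftmul w 1) = g (ftmul w 1)) (z : freeGr W A) : f z = g z :=
  free_ext_clm f.toContinuousLinearMap g.toContinuousLinearMap (fun w a => by
    rw [GrHom.coe_clm, GrHom.coe_clm, ← ftmul_one_act, f.act, g.act, h]) z

/-- The inclusion of the generators of a free module. -/
noncomputable def freeUnit (W : GrSpace.{v, u} 𝕜) (A : DGAlg.{v, u} 𝕜) : W →L[𝕜] freeGr W A :=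
  CTensor.inl (⊥ : Submodule 𝕜 (W ⊗[𝕜] A)) 1

@[simp] theorem freeUnit_apply (w : W) : freeUnit W A w = ftmul w 1 := rfl

theorem freeUnit_homog (i : ℤ) (w : W) (hw : W.deg.Homog i w) :
    (freeGr W A).deg.Homog i (freeUnit W A w) := by
  have := ftmul_homog (A := A) hw A.one_homog
  rwa [add_zero] at this

/-- The map of free modules induced by a map of the spaces of generators. -/
noncomputable def freeMap (f : W →L[𝕜] W')
    (hf : ∀ i w, W.deg.Homog i w → W'.deg.Homog (i + k) (f w)) :
    GrHom k (freeGr W A) (freeGr W' A) :=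
  GrHom.of (tmap f (ContinuousLinearMap.id 𝕜 A) : CTensor₀ 𝕜 W A →L[𝕜] CTensor₀ 𝕜 W' A)
    (fun z a => CTensor.ext (K := (⊥ : Submodule 𝕜 (W ⊗[𝕜] A)))
      ((tmap f (ContinuousLinearMap.id 𝕜 A)).comp (CTensor.right ⊥ rightStable_bot a))
      ((CTensor.right ⊥ rightStable_bot a).comp (tmap f (ContinuousLinearMap.id 𝕜 A)))
      (fun w b => by simp) z)
    (fun i z hz => Grading.tensor_map_homog W.deg A.deg (W'.deg.tensor A.deg) k _
      (fun i j w a hw ha => by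
        rw [CTensor.map_tmul, add_right_comm]
        exact Grading.tensor_homog _ _ (hf i w hw) ha) i z hz)

@[simp] theorem freeMap_ftmul (f : W →L[𝕜] W')
    (hf : ∀ i w, W.deg.Homog i w → W'.deg.Homog (i + k) (f w)) (w : W) (a : A) :
    freeMap f hf (ftmul w a : freeGr W A) = ftmul (f w) a := CTensor.map_tmul _ _ _ _ _

/-- The action map `X ⊗̂ A^# → X`. -/
noncomputable def GrMod.actHom (X : GrMod A) : GrHom 0 (freeGr X.toGrSpace A) X :=
  GrHom.of (CTensor.lift ⊥ X.actₗ X.continuous_actₗ bot_le : CTensor₀ 𝕜 X A →L[𝕜] X)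
    (fun z a => CTensor.ext (K := (⊥ : Submodule 𝕜 (X ⊗[𝕜] A)))
      ((CTensor.lift ⊥ X.actₗ X.continuous_actₗ bot_le).comp (CTensor.right ⊥ rightStable_bot a))
      ({ X.actₗ.flip a with cont := continuous_const_smul (MulOpposite.op a) } ∘L
        (CTensor.lift ⊥ X.actₗ X.continuous_actₗ bot_le))
      (fun w b => by
        rw [ContinuousLinearMap.comp_apply, ContinuousLinearMap.comp_apply,
          CTensor.right_tmul, CTensor.lift_tmul, CTensor.lift_tmul]
        change w <• (b * a) = (w <• b) <• a
        rw [MulOpposite.op_mul, mul_smul]) z)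
    (fun i z hz => Grading.tensor_map_homog X.deg A.deg X.deg 0 _
      (fun i j w a hw ha => by
        rw [CTensor.lift_tmul, add_zero]
        exact X.act_homog i j w a hw ha) i z hz)

@[simp] theorem GrMod.actHom_ftmul (X : GrMod A) (x : X) (a : A) :
    X.actHom (ftmul x a : freeGr X.toGrSpace A) = x <• a := CTensor.lift_tmul _ _ _ _ _ _

theorem GrMod.actHom_map (f : GrHom k X Y) (z : freeGr X.toGrSpace A) :
    Y.actHom (freeMap f.toContinuousLinearMap (fun _ _ h => f.homog h) z) = f (X.actHom z) :=
  free_ext (Y.actHom.comp (freeMap f.toContinuousLinearMap (fun _ _ h => f.homog h)) : GrHom k _ _)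
    (f.comp X.actHom) (fun w => by
      simp) z

/-- The homogeneous map out of a free module with given values on the generators. -/
noncomputable def freeLift (f : W →L[𝕜] X)
    (hf : ∀ i w, W.deg.Homog i w → X.deg.Homog (i + k) (f w)) : GrHom k (freeGr W A) X :=
  X.actHom.comp (freeMap (W' := X.toGrSpace) f hf)

@[simp] theorem freeLift_ftmul (f : W →L[𝕜] X)
    (hf : ∀ i w, W.deg.Homog i w → X.deg.Homog (i + k) (f w)) (w : W) (a : A) :
    freeLift f hf (ftmul w a : freeGr W A) = f w <• a := by
  simp [freeLift]

/-- The action map has a homogeneous `A^#`-linear section. -/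
def GrMod.HasSection (M : GrMod A) : Prop :=
  ∃ i : GrHom 0 M (freeGr M.toGrSpace A), ∀ m, M.actHom (i m) = m

/-- The lifting property in all degrees. -/
theorem GrMod.HasSection.exists_lift (hM : M.HasSection) (p : GrHom 0 X Y) (s : Y →L[𝕜] X)
    (hs : ∀ n y, Y.deg.Homog n y → X.deg.Homog n (s y)) (hps : ∀ y, p (s y) = y)
    (g : GrHom k M Y) : ∃ l : GrHom k M X, ∀ m, p (l m) = g m := by
  obtain ⟨i, hi⟩ := hM
  have hsg : ∀ i w, M.deg.Homog i w → X.deg.Homog (i + k) (s.comp g.toContinuousLinearMap w) :=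
    fun i w hw => hs _ _ (g.homog hw)
  let L : GrHom k (freeGr M.toGrSpace A) X := freeLift (s.comp g.toContinuousLinearMap) hsg
  refine ⟨L.comp i, fun m => ?_⟩
  have h := free_ext (p.comp L : GrHom k _ _) (g.comp M.actHom) (fun w => by
    simp only [L, GrHom.comp_apply]
    rw [freeLift_ftmul]
    simp [hps]) (i m)
  simp only [GrHom.comp_apply, hi] at h
  exact h

theorem GrMod.isGradedProjective_iff : M.IsGradedProjective ↔ M.HasSection := by
  constructor
  · intro h
    exact h _ _ M.actHom (GrHom.id M) ⟨freeUnit M.toGrSpace A, freeUnit_homog, fun y => by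
      change M.actHom (freeUnit M.toGrSpace A y) = y
      simp⟩
  · rintro h X Y p g ⟨s, hs, hps⟩
    exact h.exists_lift p s hs hps g

theorem GrMod.HasSection.retract (hN : N.HasSection) (j : GrHom k M N) (r : GrHom l N M)
    (hkl : k + l = 0) (h : ∀ m, r (j m) = m) : M.HasSection := by
  obtain ⟨i, hi⟩ := hN
  refine ⟨(freeMap r.toContinuousLinearMap (fun _ _ h => r.homog h)).comp
    (i.comp j (n := k)), fun m => ?_⟩
  simp only [GrHom.comp_apply]
  rw [GrMod.actHom_map, hi, h]

theorem hasSection_freeGr (W : GrSpace.{v, u} 𝕜) (A : DGAlg.{v, u} 𝕜) : (freeGr W A).HasSection :=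
  ⟨freeMap (W' := (freeGr W A).toGrSpace) (freeUnit W A)
    (fun i w hw => by rw [add_zero]; exact freeUnit_homog i w hw),
    free_ext ((freeGr W A).actHom.comp (freeMap (W' := (freeGr W A).toGrSpace) (freeUnit W A)
      (fun i w hw => by rw [add_zero]; exact freeUnit_homog i w hw))) (GrHom.id _)
      (fun w => by simp)⟩

namespace GradedFree

variable {N : DGMod A} (φ : GradedFree W N)

theorem iso_tensor_homog (i : ℤ) (z : freeGr W A) (hz : (freeGr W A).deg.Homog i z) :
    N.deg.Homog (i + 0) (φ.iso z) :=
  Grading.tensor_map_homog W.deg A.deg N.deg 0 φ.iso.toContinuousLinearMap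
    (fun i j w a hw ha => by
      rw [add_zero]
      exact φ.iso_homog i j w a hw ha) i z hz

/-- The isomorphism `W ⊗̂ A^# → N^#`. -/
noncomputable def ofFree : GrHom 0 (freeGr W A) N.toGrMod :=
  GrHom.of (φ.iso.toContinuousLinearMap : CTensor₀ 𝕜 W A →L[𝕜] N) (fun z a => φ.iso_right a z)
    φ.iso_tensor_homog

/-- The isomorphism `N^# → W ⊗̂ A^#`. -/
noncomputable def toFree : GrHom 0 N.toGrMod (freeGr W A) :=
  GrHom.of (φ.iso.symm.toContinuousLinearMap : N →L[𝕜] CTensor₀ 𝕜 W A)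
    (fun n a => φ.symm_act n a) (fun i n hn => by
      have h1 := Grading.proj_map (W.deg.tensor A.deg) N.deg φ.iso.toContinuousLinearMap 0
        φ.iso_tensor_homog i (φ.iso.symm n)
      rw [add_zero] at h1 ⊢
      refine φ.iso.injective (h1.symm.trans ?_)
      change N.deg.proj i (φ.iso (φ.iso.symm n)) = φ.iso (φ.iso.symm n)
      rw [ContinuousLinearEquiv.apply_symm_apply]
      exact hn)

theorem ofFree_toFree (n : N) : φ.ofFree (φ.toFree n) = n := φ.iso.apply_symm_apply n

theorem toFree_ofFree (z : freeGr W A) : φ.toFree (φ.ofFree z) = z := φ.iso.symm_apply_apply z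

end GradedFree

theorem GradedFree.hasSection {N : DGMod A} (φ : GradedFree W N) : N.toGrMod.HasSection :=
  (hasSection_freeGr W A).retract φ.toFree φ.ofFree rfl φ.ofFree_toFree

end FreeModules

section Sections

variable {𝕜 : Type v} [RCLike 𝕜] {A : DGAlg.{v, u} 𝕜} {M N : DGMod A}

theorem hasSection_shift (h : M.toGrMod.HasSection) (k : ℤ) : (M.shift k).toGrMod.HasSection :=
  h.retract (M.ofShift k) (M.toShift k) (by omega) (fun _ => rfl)

theorem hasSection_cone (hM : M.toGrMod.HasSection) (hN : N.toGrMod.HasSection) (f : M ⟶ N) :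
    f.cone.toGrMod.HasSection := by
  obtain ⟨i, hi⟩ := hM
  obtain ⟨j, hj⟩ := hN
  refine ⟨((freeMap (coneInl f).toContinuousLinearMap fun _ _ h => (coneInl f).homog h).comp
      (i.comp (coneFst f) : GrHom 1 _ _)) +
    ((freeMap (coneInr f).toContinuousLinearMap fun _ _ h => (coneInr f).homog h).comp
      (j.comp (coneSnd f) : GrHom 0 _ _)), fun x => ?_⟩
  simp only [GrHom.add_apply, GrHom.comp_apply, map_add, GrMod.actHom_map, hi, hj, cone_eta]

variable {T : ℕ → DGMod A}

/-- The inclusion of a factor of a product. -/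
def natSingle (T : ℕ → DGMod A) (n : ℕ) : GrHom 0 (T n).toGrMod (DGMod.natPi T).toGrMod :=
  GrHom.of (ContinuousLinearMap.single 𝕜 (fun i => T i) n)
    (fun m a => by
      refine natPi_ext fun l => ?_
      change (Pi.single n (m <• a) : ∀ i, T i) l = (Pi.single n m : ∀ i, T i) l <• a
      by_cases h : l = n
      · subst h; simp
      · simp [h])
    (fun i m hm => by
      rw [add_zero]
      refine natPi_ext fun l => ?_
      change (T l).deg.proj i ((Pi.single n m : ∀ i, T i) l) = (Pi.single n m : ∀ i, T i) l
      by_cases h : l = n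
      · subst h
        simp only [Pi.single_eq_same]
        exact hm
      · simp [h])

theorem natSingle_same (n : ℕ) (x : T n) : natProj T n (natSingle T n x) = x :=
  Pi.single_eq_same (M := fun i => T i) n x

theorem natSingle_ne {n l : ℕ} (h : l ≠ n) (x : T n) : natProj T l (natSingle T n x) = 0 :=
  Pi.single_eq_of_ne (M := fun i => T i) h x

/-- A product of graded-projective modules is graded-projective. -/
theorem hasSection_natPi (h : ∀ n, (T n).toGrMod.HasSection) :
    (DGMod.natPi T).toGrMod.HasSection := by
  choose i hi using h
  let P := DGMod.natPi T
  let F : ℕ → GrHom 0 P.toGrMod (freeGr P.toGrSpace A) := fun n =>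
    (freeMap (natSingle T n).toContinuousLinearMap fun _ _ h => (natSingle T n).homog h).comp
      ((i n).comp (natProj T n) : GrHom 0 _ _)
  have hF : LocFinite fun n => (F n).toContinuousLinearMap := by
    intro r hr
    obtain ⟨p, q, hp, -, hpq⟩ := CTensor.exists_seminorm_tmul (⊥ : Submodule 𝕜 (P ⊗[𝕜] A)) r hr
    obtain ⟨S, hS⟩ := pi_exists_finset (E := fun i => T i) p hp
    refine ⟨S, fun n hn x => ?_⟩
    let G : GrHom 0 (freeGr (T n).toGrSpace A) (freeGr P.toGrSpace A) :=
      freeMap (natSingle T n).toContinuousLinearMap fun _ _ h => (natSingle T n).homog h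
    refine CTensor.seminorm_eq_zero (K := (⊥ : Submodule 𝕜 (T n ⊗[𝕜] A)))
      (r.comp G.toContinuousLinearMap.toLinearMap)
      (hr.comp G.toContinuousLinearMap.continuous) (fun w a => ?_) (i n (natProj T n x))
    have h1 : r (ftmul (natSingle T n w) a) = 0 := by
      refine hpq _ _ (Or.inl (hS _ fun l hl => ?_))
      refine natSingle_ne (T := T) ?_ w
      rintro rfl
      exact hn hl
    have h2 : G (ftmul w a) = ftmul (natSingle T n w) a := freeMap_ftmul _ _ w a
    rw [← h2] at h1
    exact h1
  have hsum : ∀ x, HasSum (fun n => F n x) (hF.sum x) := fun x => hF.hasSum x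
  let I : GrHom 0 P.toGrMod (freeGr P.toGrSpace A) := GrHom.of hF.sum
    (fun m a => by
      have h1 := hsum (m <• a)
      simp only [(F _).act] at h1
      exact h1.unique ((hsum m).const_smul (MulOpposite.op a)))
    (fun k m hm => by
      have h1 := (hsum m).mapL ((freeGr P.toGrSpace A).deg.proj (k + 0))
      have h2 : ∀ n, (freeGr P.toGrSpace A).deg.proj (k + 0) (F n m) = F n m := fun n =>
        (F n).homog hm
      simp only [h2] at h1
      exact h1.unique (hsum m))
  refine ⟨I, fun m => ?_⟩
  have h1 := (hsum m).mapL P.actHom.toContinuousLinearMap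
  have h2 : ∀ n, P.actHom (F n m) = natSingle T n (natProj T n m) := fun n => by
    simp only [F, GrHom.comp_apply]
    rw [GrMod.actHom_map, hi]
  simp only [GrHom.coe_clm, h2] at h1
  refine natPi_ext fun l => ?_
  have h3 := h1.mapL (natProj T l).toContinuousLinearMap
  refine (h3.unique (hasSum_single l fun n hn => ?_)).trans ?_
  · exact natSingle_ne hn.symm _
  · exact natSingle_same _ _

end Sections

/-! ## Orthogonality of graded-projective and contraacyclic modules -/

section Orthogonality

variable {𝕜 : Type v} [RCLike 𝕜] {A : DGAlg.{v, u} 𝕜} {P M N : DGMod A}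

/-- The complex `Hom_A(P, M)` is acyclic. -/
def Orth (P M : DGMod A) : Prop :=
  ∀ k l : ℤ, l + 1 = k → ∀ f : GrHom k P.toGrMod M.toGrMod,
    (∀ m, M.d (f m) = (k.negOnePow : ℤ) • f (P.d m)) →
    ∃ h : GrHom l P.toGrMod M.toGrMod, ∀ m, M.d (h m) + (k.negOnePow : ℤ) • h (P.d m) = f m

theorem negOnePow_mul_self (k : ℤ) : (k.negOnePow : ℤ) * k.negOnePow = 1 := by
  rw [← Units.val_mul, ← Int.negOnePow_add, Int.negOnePow_even _ ⟨k, rfl⟩]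
  rfl

theorem negOnePow_succ' (k : ℤ) : ((k + 1).negOnePow : ℤ) = -(k.negOnePow : ℤ) := by
  rw [Int.negOnePow_succ]
  rfl

theorem Orth.of_contractible (hM : M.Contractible) : Orth P M := by
  obtain ⟨c, hc⟩ := hM
  intro k l hkl f hf
  refine ⟨c.comp f, fun m => ?_⟩
  simp only [GrHom.comp_apply]
  rw [← map_zsmul, ← hf, hc]

theorem Orth.shift (hM : Orth P M) (j : ℤ) : Orth P (M.shift j) := by
  intro k l hkl f hf
  have hjk : ((k + j).negOnePow : ℤ) = k.negOnePow * j.negOnePow := by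
    rw [Int.negOnePow_add]
    rfl
  have hj := negOnePow_mul_self j
  obtain ⟨h, hh⟩ := hM (k + j) (l + j) (by omega) ((M.ofShift j).comp f) (fun m => by
    have h1 := congrArg (M.ofShift j) (hf m)
    rw [DGMod.ofShift_d, map_zsmul] at h1
    have h2 := congrArg (fun x => (j.negOnePow : ℤ) • x) h1
    simp only [smul_smul, hj, one_smul] at h2
    simp only [GrHom.comp_apply]
    rw [h2, hjk, mul_comm])
  refine ⟨(j.negOnePow : ℤ) • (M.toShift j).comp h (n := l), fun m => M.ofShift_injective j ?_⟩
  have h3 := hh m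
  rw [hjk] at h3
  simp only [GrHom.comp_apply] at h3
  rw [map_add, DGMod.ofShift_d, ← h3]
  simp only [GrHom.zsmul_apply, GrHom.comp_apply, map_zsmul, DGMod.ofShift_toShift, smul_smul, hj,
    one_smul]

theorem Orth.cone (hM : Orth P M) (hN : Orth P N) (g : M ⟶ N) : Orth P g.cone := by
  intro k l hkl f hf
  have hf1 : ∀ m, M.d (coneFst g (f m)) = -((k.negOnePow : ℤ) • coneFst g (f (P.d m))) := by
    intro m
    have := congrArg (coneFst g) (hf m)
    rw [coneFst_d, map_zsmul] at this
    rw [← this, neg_neg]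
  have hf2 : ∀ m, g.gr (coneFst g (f m)) + N.d (coneSnd g (f m)) =
      (k.negOnePow : ℤ) • coneSnd g (f (P.d m)) := by
    intro m
    have := congrArg (coneSnd g) (hf m)
    rwa [coneSnd_d, map_zsmul] at this
  obtain ⟨α, hα⟩ := hM (k + 1) k rfl ((coneFst g).comp f) (fun m => by
    rw [negOnePow_succ', neg_smul]
    exact hf1 m)
  simp only [negOnePow_succ', neg_smul, GrHom.comp_apply] at hα
  obtain ⟨β, hβ⟩ := hN k l hkl ((coneSnd g).comp f + g.gr.comp α) (fun m => by
    have h1 := congrArg g.gr (hα m)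
    have h2 := hf2 m
    simp only [map_add, map_neg, map_zsmul, g.gr_d] at h1
    simp only [GrHom.add_apply, GrHom.comp_apply, map_add]
    linear_combination (norm := module) h1 + h2)
  simp only [GrHom.add_apply, GrHom.comp_apply] at hβ
  refine ⟨(coneInr g).comp β - (coneInl g).comp α, fun m => cone_ext ?_ ?_⟩
  · simp only [GrHom.sub_apply, GrHom.comp_apply, map_add, map_sub, map_zsmul, coneFst_d,
      coneFst_inl, coneFst_inr, map_zero]
    linear_combination (norm := module) hα m
  · simp only [GrHom.sub_apply, GrHom.comp_apply, map_add, map_sub, map_zsmul, coneSnd_d,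
      coneFst_inl, coneFst_inr, coneSnd_inl, coneSnd_inr, map_zero]
    linear_combination (norm := module) hβ m

theorem Orth.pi {ι : Type u} {M : ι → DGMod A} (h : ∀ i, Orth P (M i)) : Orth P (DGMod.pi M) := by
  intro k l hkl f hf
  let pr : ∀ i, GrHom 0 (DGMod.pi M).toGrMod (M i).toGrMod := fun i =>
    GrHom.of (ContinuousLinearMap.proj (R := 𝕜) (φ := fun i => M i) i) (fun _ _ => rfl)
      (fun n m hm => by
        rw [add_zero]
        exact congrFun hm i)
  choose c hc using fun i => h i k l hkl ((pr i).comp f) (fun m => congrFun (hf m) i)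
  refine ⟨GrHom.of (ContinuousLinearMap.pi (φ := fun i => M i) fun i =>
      (c i).toContinuousLinearMap) (fun m a => funext fun i => (c i).act m a)
      (fun n m hm => funext fun i => (c i).homog hm), fun m => funext fun i => hc i m⟩

theorem Orth.of_homotopy_retract (hN : Orth P N) (i : M ⟶ N) (r : N ⟶ M)
    (h : DGHomotopic A (i ≫ r) (𝟙 M)) : Orth P M := by
  obtain ⟨H, hH⟩ := (dgHomotopic_iff _ _).1 h
  intro k l hkl f hf
  obtain ⟨c, hc⟩ := hN k l hkl (i.gr.comp f) (fun m => by
    simp only [GrHom.comp_apply]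
    rw [← i.gr_d, hf, map_zsmul])
  refine ⟨r.gr.comp c - H.comp f, fun m => ?_⟩
  have h1 := hH (f m)
  have h2 := congrArg r.gr (hc m)
  rw [hf, map_zsmul] at h1
  simp only [DGHom.gr_comp, DGHom.gr_id] at h1
  simp only [GrHom.comp_apply, map_add, map_zsmul, r.gr_d] at h2
  simp only [GrHom.sub_apply, GrHom.comp_apply, map_sub]
  linear_combination (norm := module) h2 + h1

theorem Orth.of_isSplitExact (hP : P.toGrMod.HasSection) {K L M : DGMod A} (i : K ⟶ L) (q : L ⟶ M)
    (h : IsSplitExact i q) (c : i.cone ⟶ M) (hc : ∀ x, c.gr x = q.gr (coneSnd i x)) :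
    Orth P c.cone := by
  obtain ⟨hqi, r, s, hr, hs, hri, hqs, hirsq⟩ := h
  have hqi' : ∀ x, q.gr (i.gr x) = 0 := hqi
  have hri' : ∀ x, r (i.gr x) = x := hri
  have hirsq' : ∀ x, i.gr (r x) + s (q.gr x) = x := hirsq
  have hinj : ∀ x y, i.gr x = i.gr y → x = y := fun x y h => by
    rw [← hri' x, h, hri']
  intro k l hkl f hf
  let a : GrHom (k + 2) P.toGrMod K.toGrMod := (coneFst i).comp ((coneFst c).comp f : GrHom (k + 1) _ _)
  let b : GrHom (k + 1) P.toGrMod L.toGrMod := (coneSnd i).comp ((coneFst c).comp f : GrHom (k + 1) _ _)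
  let e : GrHom k P.toGrMod M.toGrMod := (coneSnd c).comp f
  have hb : ∀ m, i.gr (a m) + L.d (b m) = -((k.negOnePow : ℤ) • b (P.d m)) := by
    intro m
    have := congrArg (fun x => coneSnd i (coneFst c x)) (hf m)
    simp only [coneFst_d, map_neg, coneSnd_d, map_zsmul] at this
    exact neg_eq_iff_eq_neg.1 this
  have he : ∀ m, q.gr (b m) + M.d (e m) = (k.negOnePow : ℤ) • e (P.d m) := by
    intro m
    have := congrArg (coneSnd c) (hf m)
    rwa [coneSnd_d, map_zsmul, hc] at this
  obtain ⟨γ, hγ⟩ := hP.exists_lift q.gr s hs hqs e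
  let b' : P → L := fun m => b m + L.d (γ m) - (k.negOnePow : ℤ) • γ (P.d m)
  have hqb : ∀ m, q.gr (b' m) = 0 := by
    intro m
    simp only [b', map_add, map_sub, map_zsmul, q.gr_d, hγ]
    linear_combination (norm := module) he m
  have hirb : ∀ m, i.gr (r (b' m)) = b' m := by
    intro m
    have := hirsq' (b' m)
    rwa [hqb, map_zero, add_zero] at this
  let B : P →L[𝕜] L := b.toContinuousLinearMap + L.d.comp γ.toContinuousLinearMap -
    (k.negOnePow : ℤ) • γ.toContinuousLinearMap.comp P.d
  have hB : ∀ m, B m = b' m := fun m => rfl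
  have hbact : ∀ n m (x : A), P.deg.Homog n m → b' (m <• x) = b' m <• x := by
    intro n m x hm
    have hγm := γ.homog hm
    have hs : ((n + k).negOnePow : ℤ) = n.negOnePow * k.negOnePow := by
      rw [Int.negOnePow_add]; rfl
    simp only [b', b.act, γ.act, L.leibniz _ _ _ hγm, P.leibniz _ _ _ hm, map_add, Units.smul_def,
      map_zsmul, hs, smul_add, smul_sub]
    rw [smul_comm (MulOpposite.op x) (k.negOnePow : ℤ)]
    generalize (b m <• x) = y1
    generalize (L.d (γ m) <• x) = y2
    generalize (γ (P.d m) <• x) = y3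
    generalize (γ m <• A.d x) = y4
    module
  have hbact' : ∀ m (x : A), b' (m <• x) = b' m <• x := by
    intro m x
    refine P.deg.ext_fun (B.comp (GradedFree.actL P x)) ((GradedFree.actL L x).comp B)
      (fun n m hm => ?_) m
    exact hbact n m x hm
  have hbhom : ∀ n m, P.deg.Homog n m → L.deg.Homog (n + (k + 1)) (b' m) := by
    intro n m hm
    have h1 := b.homog hm
    have h2 := L.d_homog _ _ (γ.homog hm)
    have h3 := γ.homog (P.d_homog _ _ hm)
    rw [show n + k + 1 = n + (k + 1) by omega] at h2
    rw [show n + 1 + k = n + (k + 1) by omega] at h3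
    have := (h1.add h2).add (h3.zsmul (k.negOnePow : ℤ)).neg
    rwa [← sub_eq_add_neg] at this
  let β : GrHom (k + 1) P.toGrMod K.toGrMod := GrHom.of (r.comp B)
    (fun m x => hinj _ _ (by
      change i.gr (r (b' (m <• x))) = i.gr (r (b' m) <• x)
      rw [i.gr.act, hirb, hirb, hbact']))
    (fun n m hm => hr _ _ (hbhom n m hm))
  have hβ : ∀ m, i.gr (β m) = b' m := hirb
  refine ⟨(coneInl c).comp ((coneInr i).comp γ - (coneInl i).comp β : GrHom k _ _),
    fun m => cone_ext (cone_ext (hinj _ _ ?_) ?_) ?_⟩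
  · simp only [GrHom.comp_apply, GrHom.sub_apply, map_add, map_sub, map_zsmul, coneFst_d, coneFst_inl,
      map_neg, coneFst_inr, hβ, i.gr_d, map_zero]
    have h1 := hb m
    change _ = i.gr (a m)
    simp only [b', map_add, map_sub, map_zsmul, DGMod.d_d', smul_sub, smul_add, map_zero, smul_zero]
    linear_combination (norm := module) (-1 : ℤ) • h1
  · simp only [GrHom.comp_apply, GrHom.sub_apply, map_add, map_sub, map_zsmul, coneFst_d, coneSnd_d,
      coneFst_inl, coneSnd_inl, coneSnd_inr,
      map_neg, coneFst_inr, hβ, map_zero]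
    change _ = b m
    simp only [b']
    module
  · simp only [GrHom.comp_apply, GrHom.sub_apply, map_add, map_sub, map_zsmul, coneSnd_d,
      coneFst_inl, coneSnd_inl, hc, coneSnd_inr, hγ, map_zero]
    change _ = e m
    module

theorem Orth.tot (hP : P.toGrMod.HasSection) {K L M : DGMod A} (i : K ⟶ L) (q : L ⟶ M)
    (h : IsSplitExact i q) : Orth P (DGHom.tot i q h.1) :=
  Orth.of_isSplitExact hP i q h (DGHom.coneDesc i q h.1) fun _ => rfl

/-- Graded-projective modules are orthogonal to `Ac^ctr(A)`. -/
theorem AcCtr.orth (hM : AcCtr A M) (hP : P.toGrMod.HasSection) : Orth P M := by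
  induction hM with
  | tot i q h => exact Orth.tot hP i q h
  | shift M k _ ih => exact ih.shift k
  | cone f _ _ ih ih' => exact ih.cone ih' f
  | retract M N hr _ ih =>
    obtain ⟨⟨i, r, hir⟩⟩ := hr
    obtain ⟨i, rfl⟩ := (Quotient.functor (DGHomotopic A)).map_surjective i
    obtain ⟨r, rfl⟩ := (Quotient.functor (DGHomotopic A)).map_surjective r
    refine ih.of_homotopy_retract i r ((ho_map_eq_iff _ _).1 ?_)
    rw [Functor.map_comp, hir]
    exact (CategoryTheory.Functor.map_id _ _).symm
  | pi M _ ih => exact Orth.pi ih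

theorem exists_lift_of_orth_cone {X Y : DGMod A} {f : X ⟶ Y} (h : Orth P f.cone) (φ : P ⟶ Y) :
    ∃ ψ : P ⟶ X, DGHomotopic A (ψ ≫ f) φ := by
  obtain ⟨c, hc⟩ := h 0 (-1) rfl ((coneInr f).comp φ.gr) (fun m => by
    simp [φ.gr_d])
  have h1 : ∀ m, coneFst f (c (P.d m)) = X.d (coneFst f (c m)) := by
    intro m
    have := congrArg (coneFst f) (hc m)
    simp only [map_add, coneFst_d, GrHom.comp_apply, coneFst_inr, Int.negOnePow_zero,
      Units.val_one, one_smul] at this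
    rwa [neg_add_eq_zero, eq_comm] at this
  refine ⟨DGHom.ofGr ((coneFst f).comp c) h1, (dgHomotopic_iff _ _).2
    ⟨-(coneSnd f).comp c, fun m => ?_⟩⟩
  have := congrArg (coneSnd f) (hc m)
  simp only [map_add, coneSnd_d, GrHom.comp_apply, coneSnd_inr, Int.negOnePow_zero,
    Units.val_one, one_smul] at this
  have h2 : (DGHom.ofGr ((coneFst f).comp c) h1).gr m = coneFst f (c m) := rfl
  simp only [DGHom.gr_comp, h2, GrHom.comp_apply, GrHom.neg_apply, map_neg, ← this]
  abel

theorem homotopic_of_orth_cone {X Y : DGMod A} {f : X ⟶ Y} (h : Orth P f.cone) (φ ψ : P ⟶ X)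
    (hφ : DGHomotopic A (φ ≫ f) (ψ ≫ f)) : DGHomotopic A φ ψ := by
  obtain ⟨H, hH⟩ := (dgHomotopic_iff _ _).1 hφ
  simp only [DGHom.gr_comp] at hH
  have hs : (((-1 : ℤ).negOnePow : ℤˣ) : ℤ) = -1 := by simp
  obtain ⟨c, hc⟩ := h (-1) (-2) rfl ((coneInl f).comp (φ.gr - ψ.gr) - (coneInr f).comp H)
    (fun m => by
      have h1 := congrArg (coneInr f) (hH m)
      simp only [map_sub, map_add] at h1
      rw [hs]
      simp only [GrHom.sub_apply, GrHom.comp_apply, map_sub, cone_d_inl, cone_d_inr, φ.gr_d,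
        ψ.gr_d]
      linear_combination (norm := module) h1)
  refine (dgHomotopic_iff _ _).2 ⟨-(coneFst f).comp c, fun m => ?_⟩
  have := congrArg (coneFst f) (hc m)
  rw [hs] at this
  simp only [GrHom.sub_apply, GrHom.comp_apply, map_sub, map_add, map_zsmul, coneFst_d,
    coneFst_inl, coneFst_inr] at this
  simp only [GrHom.neg_apply, GrHom.comp_apply, map_neg]
  linear_combination (norm := module) (-1 : ℤ) • this

end Orthogonality

/-! ## The sign operator -/

section Sign

variable {𝕜 : Type v} [RCLike 𝕜] {E : Type u} [AddCommGroup E] [Module 𝕜 E] [UniformSpace E]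
  [Clct 𝕜 E] (g : Grading 𝕜 E)

theorem Grading.locFinite_sign : LocFinite fun n : ℤ => (n.negOnePow : ℤ) • g.proj n := by
  intro r hr
  obtain ⟨S, hS, -⟩ := g.exists_finset_proj r hr
  refine ⟨S, fun n hn x => ?_⟩
  change r ((n.negOnePow : ℤ) • g.proj n x) = 0
  rcases Int.units_eq_one_or n.negOnePow with h | h <;> simp [h, hS n hn x]

/-- The operator `x ↦ (-1)^n x` on elements of degree `n`. -/
noncomputable def Grading.sign : E →L[𝕜] E := g.locFinite_sign.sum

theorem Grading.sign_apply {n : ℤ} {x : E} (hx : g.Homog n x) :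
    g.sign x = (n.negOnePow : ℤ) • x := by
  refine (LocFinite.sum_eq_of _ x n fun m hm => ?_).trans ?_
  · change (m.negOnePow : ℤ) • g.proj m x = 0
    rw [hx.proj_eq, if_neg hm, smul_zero]
  · change (n.negOnePow : ℤ) • g.proj n x = _
    rw [hx.proj_eq, if_pos rfl]

end Sign

/-! ## The free resolution of a dg-module -/

section FreeDG

variable {𝕜 : Type v} [RCLike 𝕜] {A : DGAlg.{v, u} 𝕜}

theorem CTensor.zsmul_tmul {E F : Type u} [AddCommGroup E] [Module 𝕜 E] [AddCommGroup F]
    [Module 𝕜 F] [UniformSpace E] [UniformSpace F] [IsUniformAddGroup E]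
    (K : Submodule 𝕜 (E ⊗[𝕜] F)) (c : ℤ) (x : E) (y : F) :
    CTensor.tmul K (c • x) y = c • CTensor.tmul K x y := map_zsmul (CTensor.inl K y) c x

theorem CTensor.tmul_zsmul {E F : Type u} [AddCommGroup E] [Module 𝕜 E] [AddCommGroup F]
    [Module 𝕜 F] [UniformSpace E] [UniformSpace F] [IsUniformAddGroup F]
    (K : Submodule 𝕜 (E ⊗[𝕜] F)) (c : ℤ) (x : E) (y : F) :
    CTensor.tmul K x (c • y) = c • CTensor.tmul K x y := map_zsmul (CTensor.inr K x) c y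

variable (X : DGMod A)

/-- The differential of `X ⊗̂ A`. -/
noncomputable def freeD : CTensor₀ 𝕜 X A →L[𝕜] CTensor₀ 𝕜 X A :=
  tmap X.d (ContinuousLinearMap.id 𝕜 A) + tmap X.deg.sign A.d

theorem freeD_tmul {i : ℤ} {x : X} (hx : X.deg.Homog i x) (a : A) :
    freeD X (CTensor.tmul ⊥ x a) =
      CTensor.tmul ⊥ (X.d x) a + (i.negOnePow : ℤ) • CTensor.tmul ⊥ x (A.d a) := by
  rw [freeD, add_apply, CTensor.map_tmul, CTensor.map_tmul, X.deg.sign_apply hx,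
    CTensor.zsmul_tmul]
  rfl

theorem freeD_right (z : CTensor₀ 𝕜 X A) (a : A) :
    freeD X (CTensor.right ⊥ rightStable_bot a z) =
      CTensor.right ⊥ rightStable_bot a (freeD X z) +
        CTensor.right ⊥ rightStable_bot (A.d a) ((X.deg.tensor A.deg).sign z) := by
  refine CTensor.ext_homog X.deg A.deg ((freeD X).comp (CTensor.right ⊥ rightStable_bot a))
    ((CTensor.right ⊥ rightStable_bot a).comp (freeD X) +
      (CTensor.right ⊥ rightStable_bot (A.d a)).comp (X.deg.tensor A.deg).sign)
    (fun i j x b hx hb => ?_) z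
  have hxb := Grading.tensor_homog X.deg A.deg hx hb
  have hs : ((i + j).negOnePow : ℤ) = i.negOnePow * j.negOnePow := by
    rw [Int.negOnePow_add]; rfl
  rw [ContinuousLinearMap.comp_apply, add_apply, ContinuousLinearMap.comp_apply,
    ContinuousLinearMap.comp_apply, CTensor.right_tmul, freeD_tmul X hx, freeD_tmul X hx,
    Grading.sign_apply _ hxb, A.leibniz _ _ _ hb, map_add, map_zsmul, map_zsmul,
    CTensor.right_tmul, CTensor.right_tmul, CTensor.right_tmul, CTensor.tmul_add, Units.smul_def,
    CTensor.tmul_zsmul, hs]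
  module

theorem freeD_leibniz {i : ℤ} {z : CTensor₀ 𝕜 X A} (hz : (X.deg.tensor A.deg).Homog i z) (a : A) :
    freeD X (CTensor.right ⊥ rightStable_bot a z) =
      CTensor.right ⊥ rightStable_bot a (freeD X z) +
        (i.negOnePow : ℤ) • CTensor.right ⊥ rightStable_bot (A.d a) z := by
  rw [freeD_right, Grading.sign_apply _ hz, map_zsmul]

theorem lift_freeD (z : CTensor₀ 𝕜 X A) :
    CTensor.lift ⊥ X.actₗ X.continuous_actₗ bot_le (freeD X z) =
      X.d (CTensor.lift ⊥ X.actₗ X.continuous_actₗ bot_le z) := by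
  refine CTensor.ext_homog X.deg A.deg
    ((CTensor.lift ⊥ X.actₗ X.continuous_actₗ bot_le).comp (freeD X))
    (X.d.comp (CTensor.lift ⊥ X.actₗ X.continuous_actₗ bot_le)) (fun i j x a hx _ => ?_) z
  rw [ContinuousLinearMap.comp_apply, freeD_tmul X hx, map_add, map_zsmul,
    ContinuousLinearMap.comp_apply, CTensor.lift_tmul, CTensor.lift_tmul, CTensor.lift_tmul]
  exact (X.leibniz i x a hx).symm

/-- The dg-module `X ⊗̂ A`. -/
noncomputable def freeDG : DGMod A where
  toGrMod := freeGr X.toGrSpace A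
  d := (freeD X : CTensor₀ 𝕜 X A →L[𝕜] CTensor₀ 𝕜 X A)
  d_homog := Grading.tensor_map_homog X.deg A.deg (X.deg.tensor A.deg) 1 (freeD X)
    (fun i j x a hx ha => by
      rw [freeD_tmul X hx]
      have h1 := Grading.tensor_homog X.deg A.deg (X.d_homog i x hx) ha
      have h2 := Grading.tensor_homog X.deg A.deg hx (A.d_homog j a ha)
      rw [add_right_comm] at h1
      rw [← add_assoc] at h2
      exact h1.add (h2.zsmul _))
  d_d z := by
    refine CTensor.ext_homog X.deg A.deg (K := (⊥ : Submodule 𝕜 (X ⊗[𝕜] A)))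
      ((freeD X).comp (freeD X)) 0 (fun i j x a hx _ => ?_) z
    rw [ContinuousLinearMap.comp_apply, freeD_tmul X hx, map_add, map_zsmul, freeD_tmul X hx,
      freeD_tmul X (X.d_homog i x hx), X.d_d, A.d_d, CTensor.zero_tmul, CTensor.tmul_zero,
      negOnePow_succ', zero_apply]
    module
  leibniz i z a hz := freeD_leibniz X hz a

/-- The action map `X ⊗̂ A → X`, as a morphism of dg-modules. -/
noncomputable def actDG : freeDG X ⟶ X :=
  DGHom.ofGr (M := freeDG X) X.toGrMod.actHom (lift_freeD X)

theorem actDG_freeUnit (x : X) : (actDG X).gr (freeUnit X.toGrSpace A x) = x := by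
  change X.toGrMod.actHom (ftmul x 1) = x
  simp

theorem hasSection_freeDG : (freeDG X).toGrMod.HasSection :=
  hasSection_freeGr X.toGrSpace A

end FreeDG

section Kernel

variable {𝕜 : Type v} [RCLike 𝕜] {A : DGAlg.{v, u} 𝕜} {L M : DGMod A} (q : L ⟶ M)

/-- The kernel of a closed morphism, as a submodule. -/
def kerSub : Submodule Aᵐᵒᵖ L where
  carrier := {x | q.gr x = 0}
  add_mem' {x y} hx hy := by
    change q.gr (x + y) = 0
    rw [map_add, show q.gr x = 0 from hx, show q.gr y = 0 from hy, add_zero]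
  zero_mem' := map_zero q.gr
  smul_mem' a x hx := by
    have h := q.gr.act x a.unop
    rw [show q.gr x = 0 from hx, smul_zero] at h
    exact h

instance : IsUniformAddGroup (kerSub q) :=
  inferInstanceAs (IsUniformAddGroup (kerSub q).toAddSubgroup)

instance : PolynormableSpace 𝕜 (kerSub q) :=
  inferInstanceAs (PolynormableSpace 𝕜 ((kerSub q).restrictScalars 𝕜))

instance : CompleteSpace (kerSub q) :=
  (isClosed_eq q.gr.toContinuousLinearMap.continuous continuous_const).completeSpace_coe

instance : Clct 𝕜 (kerSub q) where

theorem DGHom.gr_proj (n : ℤ) (x : L) : M.deg.proj n (q.gr x) = q.gr (L.deg.proj n x) := by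
  have h := L.deg.proj_map M.deg q.gr.toContinuousLinearMap 0 (fun _ _ h => q.gr.homog h) n x
  rw [add_zero] at h
  exact h

/-- The inclusion of the kernel. -/
def kerVal : kerSub q →L[𝕜] L where
  toFun x := x.1
  map_add' _ _ := rfl
  map_smul' _ _ := rfl
  cont := continuous_subtype_val

/-- A continuous linear map into the kernel. -/
def kerCod {E : Type u} [AddCommGroup E] [Module 𝕜 E] [UniformSpace E] (f : E →L[𝕜] L)
    (hf : ∀ x, q.gr (f x) = 0) : E →L[𝕜] kerSub q where
  toFun x := ⟨f x, hf x⟩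
  map_add' x y := Subtype.ext (map_add f x y)
  map_smul' c x := Subtype.ext (map_smul f c x)
  cont := f.continuous.subtype_mk _

/-- The grading of the kernel. -/
def kerGrading : Grading 𝕜 (kerSub q) where
  proj n := kerCod q ((L.deg.proj n).comp (kerVal q)) fun x => by
    change q.gr (L.deg.proj n x.1) = 0
    rw [← q.gr_proj, show q.gr x.1 = 0 from x.2, map_zero]
  proj_proj i j x := Subtype.ext (by
    refine (L.deg.proj_proj i j x.1).trans ?_
    split_ifs <;> rfl)
  inducing := by
    refine IsInducing.of_comp (g := fun (y : ℤ → kerSub q) (n : ℤ) => (y n).1)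
      (continuous_pi fun n => (kerCod q _ _).continuous) (by fun_prop) ?_
    exact L.deg.inducing.comp IsInducing.subtypeVal

/-- The kernel of a closed morphism. -/
def DGHom.ker : DGMod A where
  carrier := kerSub q
  deg := kerGrading q
  act_homog i j m a hm ha := Subtype.ext (L.act_homog i j m.1 a (congrArg Subtype.val hm) ha)
  d := kerCod q (L.d.comp (kerVal q)) fun x => by
    change q.gr (L.d x.1) = 0
    rw [q.gr_d, show q.gr x.1 = 0 from x.2, map_zero]
  d_homog i m hm := Subtype.ext (L.d_homog i m.1 (congrArg Subtype.val hm))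
  d_d m := Subtype.ext (L.d_d m.1)
  leibniz i m a hm := Subtype.ext (by
    refine (L.leibniz i m.1 a (congrArg Subtype.val hm)).trans ?_
    simp only [Units.smul_def]
    rfl)

/-- The inclusion of the kernel. -/
def DGHom.kerIncl : q.ker ⟶ L :=
  DGHom.ofGr (GrHom.of (M := q.ker.toGrMod) (kerVal q) (fun _ _ => rfl) (fun i m hm => by
    rw [add_zero]
    exact congrArg Subtype.val hm)) fun _ => rfl

theorem isSplitExact_ker (s : M →L[𝕜] L) (hs : ∀ n x, M.deg.Homog n x → L.deg.Homog n (s x))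
    (hqs : ∀ x, q.gr (s x) = x) : IsSplitExact q.kerIncl q := by
  have hker : ∀ x : kerSub q, q.gr x.1 = 0 := fun x => x.2
  let r : L →L[𝕜] L := ContinuousLinearMap.id 𝕜 L - s.comp q.gr.toContinuousLinearMap
  have hr : ∀ x, r x = x - s (q.gr x) := fun _ => rfl
  refine ⟨hker, (kerCod q r fun x => by rw [hr, map_sub, hqs, sub_self] :
    L →L[𝕜] kerSub q), s, fun n x hx => Subtype.ext ?_, hs,
    fun (x : kerSub q) => Subtype.ext ?_, hqs,
    fun x => ?_⟩
  · have h1 := q.gr.homog hx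
    rw [add_zero] at h1
    have h2 := hx.add (hs _ _ h1).neg
    rw [← sub_eq_add_neg] at h2
    exact h2
  · change r x.1 = x.1
    rw [hr, hker, map_zero, sub_zero]
  · exact sub_add_cancel x (s (q.gr x))

end Kernel

/-! ## The total object of a resolution -/

section Resolution

variable {𝕜 : Type v} [RCLike 𝕜] {A : DGAlg.{v, u} 𝕜}

theorem negOnePow_natSucc (n : ℕ) :
    (((n + 1 : ℕ) : ℤ).negOnePow : ℤ) = -((n : ℤ).negOnePow : ℤ) := by
  push_cast
  exact negOnePow_succ' n

section Totalization

variable {K L M : DGMod A} {i : K ⟶ L} {c : i.cone ⟶ M} {n : ℤ}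

/-- The component of degree `n + 2` of the shifted totalization. -/
def totFst (c : i.cone ⟶ M) (n : ℤ) : GrHom (n + 2) (c.cone.shift n).toGrMod K.toGrMod :=
  (coneFst i).comp ((coneFst c).comp (c.cone.ofShift n) : GrHom (n + 1) _ _)

/-- The component of degree `n + 1` of the shifted totalization. -/
def totSnd (c : i.cone ⟶ M) (n : ℤ) : GrHom (n + 1) (c.cone.shift n).toGrMod L.toGrMod :=
  (coneSnd i).comp ((coneFst c).comp (c.cone.ofShift n) : GrHom (n + 1) _ _)

/-- The component of degree `n` of the shifted totalization. -/
def totThd (c : i.cone ⟶ M) (n : ℤ) : GrHom n (c.cone.shift n).toGrMod M.toGrMod :=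
  (coneSnd c).comp (c.cone.ofShift n)

/-- The map to the shifted totalization with given components. -/
def totMk (c : i.cone ⟶ M) (n : ℤ) {X : GrMod A} {k a b e : ℤ} (x : GrHom a X K.toGrMod)
    (y : GrHom b X L.toGrMod) (z : GrHom e X M.toGrMod) (ha : k + n + 2 = a := by omega)
    (hb : k + n + 1 = b := by omega) (he : k + n = e := by omega) :
    GrHom k X (c.cone.shift n).toGrMod :=
  (c.cone.toShift n).comp ((coneInl c).comp
    ((coneInl i).comp x + (coneInr i).comp y : GrHom (k + n + 1) _ _) +
      (coneInr c).comp z : GrHom (k + n) _ _)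

section

variable {X : GrMod A} {k a b e : ℤ} (x : GrHom a X K.toGrMod)
    (y : GrHom b X L.toGrMod) (z : GrHom e X M.toGrMod) (ha : k + n + 2 = a)
    (hb : k + n + 1 = b) (he : k + n = e) (m : X)

@[simp] theorem totFst_mk : totFst c n (totMk c n x y z ha hb he m) = x m := by
  simp [totFst, totMk]

@[simp] theorem totSnd_mk : totSnd c n (totMk c n x y z ha hb he m) = y m := by
  simp [totSnd, totMk]

@[simp] theorem totThd_mk : totThd c n (totMk c n x y z ha hb he m) = z m := by
  simp [totThd, totMk]

end

theorem tot_ext {x y : c.cone.shift n} (h1 : totFst c n x = totFst c n y)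
    (h2 : totSnd c n x = totSnd c n y) (h3 : totThd c n x = totThd c n y) : x = y :=
  c.cone.ofShift_injective n (cone_ext (cone_ext h1 h2) h3)

theorem totFst_d (x : c.cone.shift n) :
    totFst c n ((c.cone.shift n).d x) = (n.negOnePow : ℤ) • K.d (totFst c n x) := by
  simp only [totFst, GrHom.comp_apply, DGMod.ofShift_d, map_zsmul, coneFst_d, map_neg, neg_neg]

theorem totSnd_d (x : c.cone.shift n) : totSnd c n ((c.cone.shift n).d x) =
    (n.negOnePow : ℤ) • -(i.gr (totFst c n x) + L.d (totSnd c n x)) := by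
  simp only [totFst, totSnd, GrHom.comp_apply, DGMod.ofShift_d, map_zsmul, coneFst_d, coneSnd_d,
    map_neg]

theorem totThd_d {q : L ⟶ M} (hc : ∀ x, c.gr x = q.gr (coneSnd i x)) (x : c.cone.shift n) :
    totThd c n ((c.cone.shift n).d x) =
      (n.negOnePow : ℤ) • (q.gr (totSnd c n x) + M.d (totThd c n x)) := by
  simp only [totThd, totSnd, GrHom.comp_apply, DGMod.ofShift_d, map_zsmul, coneSnd_d, hc]

end Totalization

/-- A resolution of the dg-module `Z 0`, given by exact sequences
`0 → Z (n + 1) → G n → Z n → 0`. -/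
structure ResData (A : DGAlg.{v, u} 𝕜) where
  Z : ℕ → DGMod A
  G : ℕ → DGMod A
  i : ∀ n, Z (n + 1) ⟶ G n
  q : ∀ n, G n ⟶ Z n
  exact : ∀ n, IsSplitExact (i n) (q n)

namespace ResData

variable (R : ResData A)

theorem q_i (n : ℕ) (x : R.Z (n + 1)) : (R.q n).gr ((R.i n).gr x) = 0 := (R.exact n).1 x

/-- The components of the twist of the total object. -/
def N (n : ℕ) : GrHom 1 (DGMod.natPi fun n => (R.G n).shift n).toGrMod
    ((R.G n).shift n).toGrMod :=
  ((R.G n).toShift n).comp ((R.i n).gr.comp ((R.q (n + 1)).gr.comp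
    (((R.G (n + 1)).ofShift (n + 1 : ℕ)).comp (natProj _ (n + 1)) :
      GrHom (n + 1) _ _) : GrHom (n + 1) _ _) : GrHom (n + 1) _ _)

/-- The total object of the resolution. -/
def P : DGMod A :=
  (DGMod.natPi fun n => (R.G n).shift n).twist (natLift R.N) (fun m => natPi_ext fun n => by
    refine ((R.G n).ofShift_injective n) ?_
    simp only [map_add, natProj_d, DGMod.ofShift_d, natProj_lift, N, GrHom.comp_apply,
      DGMod.ofShift_toShift, map_zsmul, DGHom.gr_d, R.q_i, map_zero, negOnePow_natSucc]
    module)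

/-- The projections of the total object. -/
def pr (n : ℕ) : GrHom n R.P.toGrMod (R.G n).toGrMod :=
  ((R.G n).ofShift n).comp (natProj (fun n => (R.G n).shift n) n)

theorem ext_pr {x y : R.P} (h : ∀ n, R.pr n x = R.pr n y) : x = y := funext h

/-- The map to the total object with given components. -/
def lift {X : GrMod A} {k : ℤ} (f : ∀ n : ℕ, GrHom (k + n) X (R.G n).toGrMod) :
    GrHom k X R.P.toGrMod :=
  natLift fun n => ((R.G n).toShift n).comp (f n)

@[simp] theorem pr_lift {X : GrMod A} {k : ℤ} (f : ∀ n : ℕ, GrHom (k + n) X (R.G n).toGrMod)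
    (x : X) (n : ℕ) : R.pr n (R.lift f x) = f n x := rfl

theorem pr_d (x : R.P) (n : ℕ) : R.pr n (R.P.d x) =
    ((n : ℤ).negOnePow : ℤ) • (R.G n).d (R.pr n x) +
      (R.i n).gr ((R.q (n + 1)).gr (R.pr (n + 1) x)) := rfl

theorem pr_zero_d (x : R.P) : R.pr 0 (R.P.d x) =
    (R.G 0).d (R.pr 0 x) + (R.i 0).gr ((R.q 1).gr (R.pr 1 x)) := by
  rw [R.pr_d]
  simp

theorem hasSection (h : ∀ n, (R.G n).toGrMod.HasSection) : R.P.toGrMod.HasSection :=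
  hasSection_natPi (T := fun n => (R.G n).shift n) fun n => hasSection_shift (h n) n

/-- The augmentation of the resolution. -/
def aug : R.P ⟶ R.Z 0 :=
  DGHom.ofGr ((R.q 0).gr.comp (R.pr 0) (n := 0)) fun x => by
    simp only [GrHom.comp_apply, pr_zero_d, map_add, R.q_i, DGHom.gr_d, add_zero]

theorem aug_gr (x : R.P) : R.aug.gr x = (R.q 0).gr (R.pr 0 x) := rfl

/-- The map from the cone of `i n` to `Z n`. -/
def c (n : ℕ) : (R.i n).cone ⟶ R.Z n := DGHom.coneDesc (R.i n) (R.q n) (R.exact n).1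

theorem c_gr (n : ℕ) (x : (R.i n).cone) : (R.c n).gr x = (R.q n).gr (coneSnd (R.i n) x) := rfl

/-- The twisted product of totalizations. -/
def X : TwData fun n => (R.c n).cone.shift n where
  δ n := totMk (R.c (n + 1)) (n + 1 : ℕ) (a := n + 4) (b := n + 3) 0 0 (totFst (R.c n) n)
  d_δ n x := tot_ext
    (by simp only [totFst_d, totFst_mk, GrHom.zero_apply, map_zero, smul_zero, map_neg, neg_zero])
    (by simp only [totSnd_d, totSnd_mk, totFst_mk, GrHom.zero_apply, map_zero, smul_zero, map_neg,
      neg_zero, add_zero])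
    (by
      simp only [totThd_d (R.c_gr (n + 1)), totThd_mk, totSnd_mk, totFst_d, GrHom.zero_apply,
        map_zero, map_neg, zero_add, negOnePow_natSucc]
      module)
  δ_δ n x := tot_ext (by simp) (by simp) (by simp)

theorem acCtr_tw : AcCtr A R.X.tw :=
  R.X.acCtr fun n => (AcCtr.tot (R.i n) (R.q n) (R.exact n)).shift _ n

theorem totFst_δ (n : ℕ) (x : (R.c n).cone.shift n) :
    totFst (R.c (n + 1)) (n + 1 : ℕ) (R.X.δ n x) = 0 :=
  totFst_mk 0 0 (totFst (R.c n) n) (by omega) (by omega) (by omega) x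

theorem totSnd_δ (n : ℕ) (x : (R.c n).cone.shift n) :
    totSnd (R.c (n + 1)) (n + 1 : ℕ) (R.X.δ n x) = 0 :=
  totSnd_mk 0 0 (totFst (R.c n) n) (by omega) (by omega) (by omega) x

theorem totThd_δ (n : ℕ) (x : (R.c n).cone.shift n) :
    totThd (R.c (n + 1)) (n + 1 : ℕ) (R.X.δ n x) = totFst (R.c n) n x :=
  totThd_mk 0 0 (totFst (R.c n) n) (by omega) (by omega) (by omega) x

/-- The components of degree `n + 2` of the twisted product. -/
def twFst (n : ℕ) : GrHom (n + 2) R.X.tw.toGrMod (R.Z (n + 1)).toGrMod :=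
  (totFst (R.c n) n).comp (R.X.pr n)

/-- The components of degree `n + 1` of the twisted product. -/
def twSnd (n : ℕ) : GrHom (n + 1) R.X.tw.toGrMod (R.G n).toGrMod :=
  (totSnd (R.c n) n).comp (R.X.pr n)

/-- The components of degree `n` of the twisted product. -/
def twThd (n : ℕ) : GrHom n R.X.tw.toGrMod (R.Z n).toGrMod :=
  (totThd (R.c n) n).comp (R.X.pr n)

theorem tw_ext {x y : R.X.tw} (h1 : ∀ n, R.twFst n x = R.twFst n y)
    (h2 : ∀ n, R.twSnd n x = R.twSnd n y) (h3 : ∀ n, R.twThd n x = R.twThd n y) : x = y :=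
  R.X.ext_pr fun n => tot_ext (h1 n) (h2 n) (h3 n)

theorem twFst_d (x : R.X.tw) (n : ℕ) :
    R.twFst n (R.X.tw.d x) = ((n : ℤ).negOnePow : ℤ) • (R.Z (n + 1)).d (R.twFst n x) := by
  rcases n with _ | n
  · exact (congrArg (totFst (R.c 0) (0 : ℕ)) (R.X.pr_zero_d x)).trans (totFst_d _)
  · refine (congrArg (totFst (R.c (n + 1)) (n + 1 : ℕ)) (R.X.pr_succ_d x n)).trans ?_
    rw [map_add, totFst_d, totFst_δ, add_zero]
    rfl

theorem twSnd_d (x : R.X.tw) (n : ℕ) : R.twSnd n (R.X.tw.d x) =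
    ((n : ℤ).negOnePow : ℤ) • -((R.i n).gr (R.twFst n x) + (R.G n).d (R.twSnd n x)) := by
  rcases n with _ | n
  · exact (congrArg (totSnd (R.c 0) (0 : ℕ)) (R.X.pr_zero_d x)).trans (totSnd_d _)
  · refine (congrArg (totSnd (R.c (n + 1)) (n + 1 : ℕ)) (R.X.pr_succ_d x n)).trans ?_
    rw [map_add, totSnd_d, totSnd_δ, add_zero]
    rfl

theorem twThd_zero_d (x : R.X.tw) : R.twThd 0 (R.X.tw.d x) =
    (R.q 0).gr (R.twSnd 0 x) + (R.Z 0).d (R.twThd 0 x) := by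
  refine (congrArg (totThd (R.c 0) (0 : ℕ)) (R.X.pr_zero_d x)).trans ?_
  rw [totThd_d (R.c_gr 0)]
  exact one_smul ℤ _

theorem twThd_succ_d (x : R.X.tw) (n : ℕ) : R.twThd (n + 1) (R.X.tw.d x) =
    -((n : ℤ).negOnePow : ℤ) • ((R.q (n + 1)).gr (R.twSnd (n + 1) x) +
      (R.Z (n + 1)).d (R.twThd (n + 1) x)) + R.twFst n x := by
  refine (congrArg (totThd (R.c (n + 1)) (n + 1 : ℕ)) (R.X.pr_succ_d x n)).trans ?_
  rw [map_add, totThd_d (R.c_gr (n + 1)), totThd_δ, negOnePow_natSucc]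
  rfl

/-- The last component of the map from the cone of the augmentation. -/
def toTwThd : ∀ n : ℕ, GrHom n R.aug.cone.toGrMod (R.Z n).toGrMod
  | 0 => coneSnd R.aug
  | _ + 1 => 0

/-- The inclusion of the cone of the augmentation. -/
def toTw : GrHom 0 R.aug.cone.toGrMod R.X.tw.toGrMod :=
  R.X.lift fun n => totMk (R.c n) n (a := n + 2) (b := n + 1)
    (((n : ℤ).negOnePow : ℤ) • (R.q (n + 1)).gr.comp
      ((R.pr (n + 1)).comp (coneFst R.aug) : GrHom (n + 2) _ _))
    ((R.pr n).comp (coneFst R.aug)) (R.toTwThd n)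

theorem twFst_toTw (x : R.aug.cone) (n : ℕ) : R.twFst n (R.toTw x) =
    ((n : ℤ).negOnePow : ℤ) • (R.q (n + 1)).gr (R.pr (n + 1) (coneFst R.aug x)) :=
  totFst_mk _ _ _ (by omega) (by omega) (by omega) _

theorem twSnd_toTw (x : R.aug.cone) (n : ℕ) :
    R.twSnd n (R.toTw x) = R.pr n (coneFst R.aug x) :=
  totSnd_mk _ _ _ (by omega) (by omega) (by omega) _

theorem twThd_zero_toTw (x : R.aug.cone) : R.twThd 0 (R.toTw x) = coneSnd R.aug x :=
  totThd_mk _ _ (R.toTwThd 0) (by omega) (by omega) (by omega) _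

theorem twThd_succ_toTw (x : R.aug.cone) (n : ℕ) : R.twThd (n + 1) (R.toTw x) = 0 :=
  totThd_mk _ _ (R.toTwThd (n + 1)) (by omega) (by omega) (by omega) _

/-- The retraction to the cone of the augmentation. -/
def ofTw : GrHom 0 R.X.tw.toGrMod R.aug.cone.toGrMod :=
  (coneInl R.aug).comp (R.lift fun n =>
    ((R.twSnd n + ((n : ℤ).negOnePow : ℤ) • (R.i n).gr.comp (R.twThd (n + 1) :
      GrHom (n + 1) _ _)).comp (GrHom.id _) : GrHom (1 + n) _ _) : GrHom 1 _ _) +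
  (coneInr R.aug).comp (R.twThd 0 : GrHom 0 _ _)

theorem pr_ofTw (x : R.X.tw) (n : ℕ) : R.pr n (coneFst R.aug (R.ofTw x)) =
    R.twSnd n x + ((n : ℤ).negOnePow : ℤ) • (R.i n).gr (R.twThd (n + 1) x) := by
  simp [ofTw]

theorem coneSnd_ofTw (x : R.X.tw) : coneSnd R.aug (R.ofTw x) = R.twThd 0 x := by
  simp [ofTw]

theorem acCtr_cone_aug : AcCtr A R.aug.cone := by
  have hs : ∀ (n : ℕ), ((n : ℤ).negOnePow : ℤ) * (n : ℤ).negOnePow = 1 :=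
    fun n => negOnePow_mul_self n
  refine AcCtr.of_retract R.acCtr_tw (DGHom.ofGr R.toTw fun x => R.tw_ext (fun n => ?_)
    (fun n => ?_) fun n => ?_) (DGHom.ofGr R.ofTw fun x => cone_ext (R.ext_pr fun n => ?_) ?_)
    fun x => cone_ext (R.ext_pr fun n => ?_) ?_
  · simp only [twFst_d, twFst_toTw, coneFst_d, map_neg, R.pr_d, map_add, R.q_i, map_zsmul,
      DGHom.gr_d, smul_smul, hs, negOnePow_natSucc, smul_add, smul_neg, neg_smul, smul_zero]
    module
  · simp only [twSnd_d, twFst_toTw, twSnd_toTw, coneFst_d, map_neg, R.pr_d, map_zsmul, smul_add,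
      smul_neg, smul_smul, hs]
    module
  · rcases n with _ | n
    · simp only [twThd_zero_d, twThd_zero_toTw, twSnd_toTw, coneSnd_d, aug_gr]
    · simp only [twThd_succ_d, twThd_succ_toTw, twSnd_toTw, twFst_toTw, map_zero]
      module
  · simp only [pr_ofTw, coneFst_d, map_neg, R.pr_d, twSnd_d, twThd_succ_d, map_add, map_zsmul,
      DGHom.gr_d, R.q_i, smul_add, smul_smul, hs, map_zero, smul_neg, mul_neg]
    module
  · simp only [coneSnd_ofTw, coneSnd_d, twThd_zero_d, aug_gr, pr_ofTw, map_add, map_zsmul, R.q_i,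
      smul_zero, add_zero]
  · change R.pr n (coneFst R.aug (R.ofTw (R.toTw x))) = _
    rw [pr_ofTw, twSnd_toTw, twThd_succ_toTw, map_zero, smul_zero, add_zero]
  · exact (R.coneSnd_ofTw _).trans (R.twThd_zero_toTw x)

end ResData

/-- The syzygies of the free resolution of a dg-module. -/
noncomputable def syzygy (M : DGMod A) : ℕ → DGMod A
  | 0 => M
  | n + 1 => (actDG (syzygy M n)).ker

/-- The free resolution of a dg-module. -/
noncomputable def ResData.free (M : DGMod A) : ResData A where
  Z := syzygy M
  G n := freeDG (syzygy M n)
  i n := (actDG (syzygy M n)).kerIncl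
  q n := actDG (syzygy M n)
  exact n := isSplitExact_ker (actDG (syzygy M n)) (freeUnit _ A) freeUnit_homog (actDG_freeUnit _)

/-- Every dg-module has a graded-projective resolution with contraacyclic cone. -/
theorem exists_resolution (M : DGMod A) :
    ∃ (P : DGMod A) (f : P ⟶ M), P.toGrMod.HasSection ∧ AcCtr A f.cone :=
  ⟨(ResData.free M).P, (ResData.free M).aug, (ResData.free M).hasSection fun _ =>
    hasSection_freeDG _, (ResData.free M).acCtr_cone_aug⟩

end Resolution

/-! ## Extension of scalars of graded-projective modules -/

section ZeroFree

variable {𝕜 : Type v} [RCLike 𝕜] {A : DGAlg.{v, u} 𝕜}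

/-- The graded `A⁰`-module `W ⊗̂ A⁰`. -/
noncomputable def zeroFree (W : GrSpace.{v, u} 𝕜) (A : DGAlg.{v, u} 𝕜) : GrMod A.zeroPart :=
  tensorZeroPart W.deg ⊥ rightStable_bot fun _ => bot_le

/-- The grading of `W ⊗̂ A⁰`. -/
noncomputable abbrev zeroGrading (W : GrSpace.{v, u} 𝕜) (A : DGAlg.{v, u} 𝕜) :
    Grading 𝕜 (CTensor₀ 𝕜 W A.zeroPart) :=
  CTensor.grading W.deg ⊥ fun _ => bot_le

variable (W : GrSpace.{v, u} 𝕜)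

theorem zeroGrading_tmul (n : ℤ) (w : W) (s : A.zeroPart) :
    (zeroGrading W A).proj n (CTensor.tmul ⊥ w s) = CTensor.tmul ⊥ (W.deg.proj n w) s :=
  CTensor.map_tmul _ _ _ _ _

theorem tensor_proj_zeroPart (n : ℤ) (z : CTensor₀ 𝕜 W A.zeroPart) :
    (W.deg.tensor A.zeroPart.deg).proj n z = (zeroGrading W A).proj n z := by
  refine CTensor.ext_homog W.deg A.zeroPart.deg _ _ (fun i j w s hw _ => ?_) z
  have h := Grading.tensor_homog W.deg A.zeroPart.deg hw (DGAlg.zeroPart_homog_zero s)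
  rw [h.proj_eq, zeroGrading_tmul, hw.proj_eq, add_zero]
  split_ifs
  · rfl
  · rw [CTensor.zero_tmul]

theorem hasSection_zeroFree : (zeroFree W A).HasSection := by
  refine (hasSection_freeGr W A.zeroPart).retract (k := 0) (l := 0)
    (GrHom.of (M := zeroFree W A) (N := freeGr W A.zeroPart)
      (ContinuousLinearMap.id 𝕜 (CTensor₀ 𝕜 W A.zeroPart)) (fun _ _ => rfl) fun i m hm => ?_)
    (GrHom.of (M := freeGr W A.zeroPart) (N := zeroFree W A)
      (ContinuousLinearMap.id 𝕜 (CTensor₀ 𝕜 W A.zeroPart)) (fun _ _ => rfl) fun i m hm => ?_)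
    rfl fun _ => rfl
  · rw [add_zero]
    exact (tensor_proj_zeroPart W i _).trans hm
  · rw [add_zero]
    exact (tensor_proj_zeroPart W i _).symm.trans hm

theorem toZero_tmul (w : W) (a : A) :
    W.toZero A (CTensor.tmul ⊥ w a) = CTensor.tmul ⊥ w (A.pi₀ a) := CTensor.map_tmul _ _ _ _ _

theorem ofZero_tmul (w : W) (s : A.zeroPart) :
    W.ofZero A (CTensor.tmul ⊥ w s) = CTensor.tmul ⊥ w (A.incl s) := CTensor.map_tmul _ _ _ _ _

theorem zeroGrading_toZero (n : ℤ) (z : CTensor₀ 𝕜 W A) :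
    (zeroGrading W A).proj n (W.toZero A z) = W.toZero A ((W.deg.tensor A.deg).proj n z) := by
  refine CTensor.ext_homog W.deg A.deg (((zeroGrading W A).proj n).comp (W.toZero A))
    ((W.toZero A).comp ((W.deg.tensor A.deg).proj n)) (fun i j w a hw ha => ?_) z
  rw [ContinuousLinearMap.comp_apply, ContinuousLinearMap.comp_apply, toZero_tmul,
    zeroGrading_tmul, (Grading.tensor_homog W.deg A.deg hw ha).proj_eq, hw.proj_eq]
  by_cases hj : j = 0
  · subst hj
    rw [add_zero]
    split_ifs
    · rw [toZero_tmul]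
    · rw [map_zero, CTensor.zero_tmul]
  · rw [DGAlg.pi₀_eq_zero ha hj, CTensor.tmul_zero]
    split_ifs
    · rw [toZero_tmul, DGAlg.pi₀_eq_zero ha hj, CTensor.tmul_zero]
    · rw [map_zero]

theorem tensor_proj_ofZero (n : ℤ) (z : CTensor₀ 𝕜 W A.zeroPart) :
    (W.deg.tensor A.deg).proj n (W.ofZero A z) = W.ofZero A ((zeroGrading W A).proj n z) := by
  refine CTensor.ext_homog W.deg A.zeroPart.deg (((W.deg.tensor A.deg).proj n).comp (W.ofZero A))
    ((W.ofZero A).comp ((zeroGrading W A).proj n)) (fun i j w s hw _ => ?_) z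
  rw [ContinuousLinearMap.comp_apply, ContinuousLinearMap.comp_apply, ofZero_tmul,
    zeroGrading_tmul, (Grading.tensor_homog W.deg A.deg hw (DGAlg.incl_homog s)).proj_eq,
    hw.proj_eq, add_zero, ofZero_tmul]
  split_ifs
  · rfl
  · rw [CTensor.zero_tmul]

theorem zeroGrading_right (n : ℤ) (s : A.zeroPart) (z : CTensor₀ 𝕜 W A.zeroPart) :
    (zeroGrading W A).proj n (CTensor.right ⊥ rightStable_bot s z) =
      CTensor.right ⊥ rightStable_bot s ((zeroGrading W A).proj n z) :=
  CTensor.ext (((zeroGrading W A).proj n).comp (CTensor.right ⊥ rightStable_bot s))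
    ((CTensor.right ⊥ rightStable_bot s).comp ((zeroGrading W A).proj n))
    (fun w t => by
      rw [ContinuousLinearMap.comp_apply, ContinuousLinearMap.comp_apply, CTensor.right_tmul,
        zeroGrading_tmul, zeroGrading_tmul, CTensor.right_tmul]) z

end ZeroFree

section ExtendFree

variable {𝕜 : Type v} [RCLike 𝕜] {A : DGAlg.{v, u} 𝕜} (hA : A.NonNeg) {M : DGMod A}

theorem relations_tmul (M : GrMod A) (m : M) (a : A) (s : A.zeroPart) :
    CTensor.tmul M.relations (m <• a) s = CTensor.tmul M.relations m (A.pi₀ a * s) := by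
  let L : A →L[𝕜] M := { M.actₗ m with
    cont := (MulOpposite.continuous_op).smul continuous_const }
  let R : M → A →L[𝕜] CTensor M.relations := fun m =>
    (CTensor.inr M.relations m).comp ((mulRightL s).comp A.pi₀)
  refine A.deg.ext_fun ((CTensor.inl M.relations s).comp L) (R m) (fun j a ha => ?_) a
  let L' : M →L[𝕜] M := { M.actₗ.flip a with cont := continuous_const_smul (MulOpposite.op a) }
  refine M.deg.ext_fun ((CTensor.inl M.relations s).comp L')
    (CTensor.inl M.relations (A.pi₀ a * s)) (fun i m hm => ?_) m
  change CTensor.tmul M.relations (m <• a) s = CTensor.tmul M.relations m (A.pi₀ a * s)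
  have h : PTensor.mk M.relations ((m <• a) ⊗ₜ[𝕜] s - m ⊗ₜ[𝕜] (A.pi₀ a * s)) = 0 :=
    (Submodule.Quotient.mk_eq_zero _).2 (Submodule.subset_span ⟨i, j, m, a, s, hm, ha, rfl⟩)
  rw [map_sub, sub_eq_zero] at h
  exact congrArg (fun v : PTensor M.relations => (v : CTensor M.relations)) h

variable {W : GrSpace.{v, u} 𝕜} (j : GrHom 0 M.toGrMod (freeGr W A))

/-- The continuous linear map `M → W ⊗̂ A⁰` given by `j : M → W ⊗̂ A`. -/
noncomputable def zeroMap : M →L[𝕜] CTensor₀ 𝕜 W A.zeroPart :=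
  (W.toZero A).comp (j.toContinuousLinearMap : M →L[𝕜] CTensor₀ 𝕜 W A)

theorem zeroMap_act (hA : A.NonNeg) (m : M) (a : A) :
    zeroMap j (m <• a) = CTensor.right ⊥ rightStable_bot (A.pi₀ a) (zeroMap j m) := by
  refine Eq.trans ?_ (GradedFree.toZero_right hA a _)
  exact congrArg (W.toZero A) (j.act m a)

theorem zeroMap_proj (n : ℤ) (m : M) :
    (zeroGrading W A).proj n (zeroMap j m) = zeroMap j (M.deg.proj n m) := by
  refine (zeroGrading_toZero W n _).trans (congrArg (W.toZero A) ?_)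
  have h := M.deg.proj_map (freeGr W A).deg j.toContinuousLinearMap 0 (fun _ _ h => j.homog h) n m
  rw [add_zero] at h
  exact h

/-- The bilinear map `(m, s) ↦ j(m) s`. -/
noncomputable def extendBil : M →ₗ[𝕜] A.zeroPart →ₗ[𝕜] CTensor₀ 𝕜 W A.zeroPart :=
  (CTensor.rightₗ (⊥ : Submodule 𝕜 (W ⊗[𝕜] A.zeroPart)) rightStable_bot).flip.comp
    (zeroMap j).toLinearMap

theorem extendBil_apply (m : M) (s : A.zeroPart) :
    extendBil j m s = CTensor.right ⊥ rightStable_bot s (zeroMap j m) := rfl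

theorem continuous_extendBil : Continuous fun z : M × A.zeroPart => extendBil j z.1 z.2 := by
  have h : Continuous fun z : M × A.zeroPart => (z.2, zeroMap j z.1) :=
    continuous_snd.prodMk ((zeroMap j).continuous.comp continuous_fst)
  have h' := (CTensor.continuous_right (⊥ : Submodule 𝕜 (W ⊗[𝕜] A.zeroPart)) rightStable_bot).comp h
  refine h'.congr fun z => ?_
  exact (extendBil_apply j z.1 z.2).symm

theorem right_right (s t : A.zeroPart) (z : CTensor₀ 𝕜 W A.zeroPart) :
    CTensor.right ⊥ rightStable_bot s (CTensor.right ⊥ rightStable_bot t z) =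
      CTensor.right ⊥ rightStable_bot (t * s) z :=
  CTensor.ext ((CTensor.right ⊥ rightStable_bot s).comp (CTensor.right ⊥ rightStable_bot t))
      (CTensor.right ⊥ rightStable_bot (t * s)) (fun w t => by simp [mul_assoc]) z

theorem relations_le_ker (hA : A.NonNeg) :
    M.relations ≤ LinearMap.ker (TensorProduct.lift (extendBil j)) := by
  refine Submodule.span_le.2 ?_
  rintro _ ⟨i, k, m, a, s, hm, ha, rfl⟩
  rw [SetLike.mem_coe, LinearMap.mem_ker, map_sub, TensorProduct.lift.tmul,
    TensorProduct.lift.tmul, sub_eq_zero, extendBil_apply, extendBil_apply, zeroMap_act j hA,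
    right_right]

/-- The map `M ⊗̂_A A⁰ → W ⊗̂ A⁰` induced by `j : M → W ⊗̂ A`, as a continuous linear map. -/
noncomputable def extendLiftL : CTensor M.relations →L[𝕜] CTensor₀ 𝕜 W A.zeroPart :=
  CTensor.lift M.relations (extendBil j) (continuous_extendBil j) (relations_le_ker j hA)

theorem extendLiftL_tmul (m : M) (s : A.zeroPart) :
    extendLiftL hA j (CTensor.tmul M.relations m s) =
      CTensor.right ⊥ rightStable_bot s (zeroMap j m) := CTensor.lift_tmul _ _ _ _ _ _

/-- The map `M ⊗̂_A A⁰ → W ⊗̂ A⁰` induced by `j : M → W ⊗̂ A`. -/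
noncomputable def extendLift : GrHom 0 (M.extend hA).toGrMod (zeroFree W A) :=
  GrHom.of (M := (M.extend hA).toGrMod) (N := zeroFree W A) (extendLiftL hA j)
    (fun z s => CTensor.ext
      ((extendLiftL hA j).comp (CTensor.right M.relations M.relations_right s))
      ((CTensor.right ⊥ rightStable_bot s).comp (extendLiftL hA j)) (fun m t => by
        rw [ContinuousLinearMap.comp_apply, ContinuousLinearMap.comp_apply, CTensor.right_tmul,
          extendLiftL_tmul, extendLiftL_tmul, right_right]) z)
    (fun n z hz => by
      rw [add_zero]
      refine Eq.trans ?_ (congrArg (extendLiftL hA j) hz)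
      exact CTensor.ext (((zeroGrading W A).proj n).comp (extendLiftL hA j))
        ((extendLiftL hA j).comp
          ((CTensor.grading M.deg M.relations M.relations_proj).proj n)) (fun m s => by
          have h : (CTensor.grading M.deg M.relations M.relations_proj).proj n
            (CTensor.tmul M.relations m s) = CTensor.tmul M.relations (M.deg.proj n m) s :=
              CTensor.map_tmul _ _ _ _ _
          rw [ContinuousLinearMap.comp_apply, ContinuousLinearMap.comp_apply, h,
            extendLiftL_tmul, extendLiftL_tmul, zeroGrading_right, zeroMap_proj]) z)

/-- The map `W ⊗̂ A⁰ → M ⊗̂_A A⁰` induced by `f : W → M`. -/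
noncomputable def extendOfL (f : W →L[𝕜] M) :
    CTensor₀ 𝕜 W A.zeroPart →L[𝕜] CTensor M.relations :=
  CTensor.map ⊥ M.relations f (ContinuousLinearMap.id 𝕜 _) bot_le

theorem extendOfL_tmul (f : W →L[𝕜] M) (w : W) (s : A.zeroPart) :
    extendOfL f (CTensor.tmul ⊥ w s) = CTensor.tmul M.relations (f w) s :=
  CTensor.map_tmul _ _ _ _ _

/-- The map `W ⊗̂ A⁰ → M ⊗̂_A A⁰` of graded `A⁰`-modules induced by `f : W → M`. -/
noncomputable def extendOf (f : W →L[𝕜] M) (hf : ∀ i w, W.deg.Homog i w → M.deg.Homog i (f w)) :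
    GrHom 0 (zeroFree W A) (M.extend hA).toGrMod :=
  GrHom.of (M := zeroFree W A) (N := (M.extend hA).toGrMod) (extendOfL f)
    (fun z s => CTensor.ext ((extendOfL f).comp (CTensor.right ⊥ rightStable_bot s))
      ((CTensor.right M.relations M.relations_right s).comp (extendOfL f)) (fun w t => by
        rw [ContinuousLinearMap.comp_apply, ContinuousLinearMap.comp_apply, CTensor.right_tmul,
          extendOfL_tmul, extendOfL_tmul, CTensor.right_tmul]) z)
    (fun n z hz => by
      rw [add_zero]
      refine Eq.trans ?_ (congrArg (extendOfL f) hz)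
      refine CTensor.ext
        (((CTensor.grading M.deg M.relations M.relations_proj).proj n).comp (extendOfL f))
        ((extendOfL f).comp ((zeroGrading W A).proj n)) (fun w s => ?_) z
      have h1 := W.deg.proj_map M.deg f 0 (fun i w h => by rw [add_zero]; exact hf i w h) n w
      rw [add_zero] at h1
      have h : (CTensor.grading M.deg M.relations M.relations_proj).proj n
        (CTensor.tmul M.relations (f w) s) = CTensor.tmul M.relations (M.deg.proj n (f w)) s :=
          CTensor.map_tmul _ _ _ _ _
      rw [ContinuousLinearMap.comp_apply, ContinuousLinearMap.comp_apply, zeroGrading_tmul,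
        extendOfL_tmul, extendOfL_tmul, h, h1])

/-- `W ⊗̂ A⁰ → M ⊗̂_A A⁰` after `W ⊗̂ A → W ⊗̂ A⁰`. -/
theorem extendOfL_right_toZero (f : W →L[𝕜] M)
    (hf : ∀ i w, W.deg.Homog i w → M.deg.Homog (i + 0) (f w)) (s : A.zeroPart)
    (z : CTensor₀ 𝕜 W A) :
    extendOfL f (CTensor.right ⊥ rightStable_bot s (W.toZero A z)) =
      CTensor.tmul M.relations (freeLift (A := A) (X := M.toGrMod) f hf z) s := by
  refine CTensor.ext ((extendOfL f).comp ((CTensor.right ⊥ rightStable_bot s).comp (W.toZero A)))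
    ((CTensor.inl M.relations s).comp (freeLift (A := A) (X := M.toGrMod) f
      hf).toContinuousLinearMap : CTensor₀ 𝕜 W A →L[𝕜] CTensor M.relations) (fun w a => ?_) z
  have h : freeLift (A := A) (X := M.toGrMod) f hf (ftmul w a : freeGr W A) = f w <• a :=
    freeLift_ftmul _ _ _ _
  refine Eq.trans ?_ (congrArg (CTensor.inl M.relations s) h.symm)
  refine Eq.trans ?_ (relations_tmul M.toGrMod (f w) a s).symm
  rw [ContinuousLinearMap.comp_apply, ContinuousLinearMap.comp_apply, toZero_tmul,
    CTensor.right_tmul, extendOfL_tmul]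

/-- If `j` is a section of the map `W ⊗̂ A → M` given by `f`, then `M ⊗̂_A A⁰` is a retract of
`W ⊗̂ A⁰`. -/
theorem extendOfL_extendLiftL (f : W →L[𝕜] M)
    (hf : ∀ i w, W.deg.Homog i w → M.deg.Homog (i + 0) (f w))
    (h : ∀ m, freeLift (A := A) (X := M.toGrMod) f hf (j m) = m) (z : CTensor M.relations) :
    extendOfL f (extendLiftL hA j z) = z := by
  refine CTensor.ext ((extendOfL f).comp (extendLiftL hA j)) (ContinuousLinearMap.id 𝕜 _)
    (fun m s => ?_) z
  rw [ContinuousLinearMap.comp_apply, extendLiftL_tmul]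
  refine (extendOfL_right_toZero f hf s (j m)).trans ?_
  rw [h]
  rfl

theorem freeLift_id (M : GrMod A) (z : freeGr M.toGrSpace A) :
    freeLift (W := M.toGrSpace) (k := 0) (ContinuousLinearMap.id 𝕜 M)
      (fun i w h => by rw [add_zero]; exact h) z = M.actHom z :=
  free_ext _ _ (fun w => by simp) z

theorem hasSection_extend (hM : M.toGrMod.HasSection) : (M.extend hA).toGrMod.HasSection := by
  obtain ⟨i, hi⟩ := hM
  exact (hasSection_zeroFree M.toGrSpace).retract (extendLift hA i)
    (extendOf hA (W := M.toGrSpace) (ContinuousLinearMap.id 𝕜 M) fun _ _ h => h) rfl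
    (extendOfL_extendLiftL hA i _ (fun i w h => by rw [add_zero]; exact h)
      fun m => (freeLift_id _ _).trans (hi m))

end ExtendFree

/-! ## Detecting contractibility after extension of scalars -/

section Low

variable {𝕜 : Type v} [RCLike 𝕜] {A : DGAlg.{v, u} 𝕜}

/-- The projection of `A` onto degrees `0, …, k - 1`. -/
def DGAlg.low (A : DGAlg.{v, u} 𝕜) (k : ℕ) : A →L[𝕜] A :=
  ∑ n ∈ Finset.range k, A.deg.proj n

theorem DGAlg.low_of_lt {k : ℕ} {l : ℤ} {a : A} (ha : A.deg.Homog l a) (h0 : 0 ≤ l) (h : l < k) :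
    A.low k a = a := by
  obtain ⟨n, rfl⟩ := Int.eq_ofNat_of_zero_le h0
  rw [DGAlg.low, sum_apply, Finset.sum_eq_single n]
  · exact ha
  · intro m _ hm
    rw [ha.proj_eq, if_neg (by exact_mod_cast hm)]
  · intro hn
    exact absurd (Finset.mem_range.2 (by exact_mod_cast h)) hn

theorem DGAlg.low_of_le {k : ℕ} {l : ℤ} {a : A} (ha : A.deg.Homog l a) (h : k ≤ l) :
    A.low k a = 0 := by
  rw [DGAlg.low, sum_apply]
  refine Finset.sum_eq_zero fun m hm => ?_
  have := Finset.mem_range.1 hm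
  rw [ha.proj_eq, if_neg (by omega)]

theorem DGAlg.low_one (a : A) : A.low 1 a = A.incl (A.pi₀ a) := by
  simp [DGAlg.low, DGAlg.incl_pi₀]

theorem DGAlg.low_zero (a : A) : A.low 0 a = 0 := by
  simp [DGAlg.low]

/-- A continuous seminorm vanishes on the elements of high degree. -/
theorem DGAlg.exists_low (hA : A.NonNeg) (q : Seminorm 𝕜 A) (hq : Continuous q) :
    ∃ J : ℕ, ∀ j, J ≤ j → ∀ a, q (a - A.low j a) = 0 := by
  obtain ⟨S, -, hS⟩ := A.deg.exists_finset_proj q hq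
  refine ⟨S.sup Int.toNat + 1, fun j hj a => hS _ fun n hn => ?_⟩
  have hnj : n.toNat < j := (Nat.lt_succ_of_le (Finset.le_sup hn)).trans_le hj
  rcases lt_or_ge n 0 with h0 | h0
  · exact hA n h0 _
  · obtain ⟨m, rfl⟩ := Int.eq_ofNat_of_zero_le h0
    rw [map_sub, DGAlg.low, sum_apply, map_sum, Finset.sum_eq_single m, A.deg.proj_proj, if_pos rfl,
      sub_self]
    · intro k _ hk
      rw [A.deg.proj_proj, if_neg (by exact_mod_cast hk.symm)]
    · intro h
      exact absurd (Finset.mem_range.2 (by simpa using hnj)) h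

variable {W W' : GrSpace.{v, u} 𝕜}

/-- The map `1 ⊗ low k`. -/
noncomputable def lowT (W : GrSpace.{v, u} 𝕜) (A : DGAlg.{v, u} 𝕜) (k : ℕ) :
    freeGr W A →L[𝕜] freeGr W A :=
  (tmap (ContinuousLinearMap.id 𝕜 W) (A.low k) : CTensor₀ 𝕜 W A →L[𝕜] CTensor₀ 𝕜 W A)

theorem lowT_tmul (k : ℕ) (w : W) (a : A) :
    lowT W A k (ftmul w a) = ftmul w (A.low k a) := CTensor.map_tmul _ _ _ _ _

theorem free_ext_homog {G : Type u} [AddCommGroup G] [Module 𝕜 G] [UniformSpace G] [T2Space G]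
    (f g : freeGr W A →L[𝕜] G)
    (h : ∀ (w : W) (j : ℤ) (a : A), A.deg.Homog j a → f (ftmul w a) = g (ftmul w a))
    (z : freeGr W A) : f z = g z :=
  CTensor.ext_homog (K := (⊥ : Submodule 𝕜 (W ⊗[𝕜] A))) W.deg A.deg f g
    (fun _ j w a _ ha => h w j a ha) z

theorem ftmul_zero (w : W) : (ftmul w 0 : freeGr W A) = 0 := CTensor.tmul_zero _ w

/-- The action of an element of a graded algebra. -/
def GrMod.actCLM (X : GrMod A) (a : A) : X →L[𝕜] X :=
  { X.actₗ.flip a with cont := continuous_const_smul (MulOpposite.op a) }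

theorem GrMod.actCLM_apply (X : GrMod A) (a : A) (x : X) : X.actCLM a x = x <• a := rfl

theorem lowT_act (hA : A.NonNeg) {k : ℕ} {j : ℤ} {a : A} (ha : A.deg.Homog j a) (hj : k ≤ j)
    (z : freeGr W A) (hz : lowT W A 1 z = 0) : lowT W A (k + 1) (z <• a) = 0 := by
  have h : lowT W A (k + 1) (z <• a) = lowT W A (k + 1) (lowT W A 1 z <• a) := by
    refine free_ext_homog ((lowT W A (k + 1)).comp ((freeGr W A).actCLM a))
      ((lowT W A (k + 1)).comp (((freeGr W A).actCLM a).comp (lowT W A 1))) (fun w l b hb => ?_) z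
    simp only [ContinuousLinearMap.comp_apply, GrMod.actCLM_apply, lowT_tmul, ftmul_act]
    rcases lt_or_ge l 1 with hl | hl
    · rcases lt_or_ge l 0 with hl' | hl'
      · rw [hA.eq_zero hb hl', map_zero]
      · rw [DGAlg.low_of_lt (k := 1) hb hl' (by exact_mod_cast hl)]
    · rw [DGAlg.low_of_le (k := 1) hb (by exact_mod_cast hl), zero_mul, map_zero,
        DGAlg.low_of_le (A.mul_homog l j b a hb ha) (by push_cast; omega)]
  rw [h, hz, smul_zero, map_zero]

/-- An `A`-linear map which raises the filtration on generators raises it everywhere. -/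
theorem lowT_map (hA : A.NonNeg) {n : ℤ} (Φ : GrHom n (freeGr W A) (freeGr W' A))
    (hΦ : ∀ w, lowT W' A 1 (Φ (ftmul w 1)) = 0) (k : ℕ) (z : freeGr W A) (hz : lowT W A k z = 0) :
    lowT W' A (k + 1) (Φ z) = 0 := by
  have h : lowT W' A (k + 1) (Φ z) = lowT W' A (k + 1) (Φ (lowT W A k z)) := by
    refine free_ext_homog ((lowT W' A (k + 1)).comp Φ.toContinuousLinearMap)
      ((lowT W' A (k + 1)).comp (Φ.toContinuousLinearMap.comp (lowT W A k)))
      (fun w j a ha => ?_) z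
    simp only [ContinuousLinearMap.comp_apply, lowT_tmul, GrHom.coe_clm]
    rcases lt_or_ge j k with hj | hj
    · rcases lt_or_ge j 0 with hj' | hj'
      · rw [hA.eq_zero ha hj', map_zero]
      · rw [DGAlg.low_of_lt ha hj' hj]
    · rw [DGAlg.low_of_le ha hj, ftmul_zero, map_zero, map_zero, ← ftmul_one_act, Φ.act]
      exact lowT_act hA ha hj _ (hΦ w)
  rw [h, hz, map_zero, map_zero]

theorem lowT_zero (z : freeGr W A) : lowT W A 0 z = 0 :=
  free_ext_clm (lowT W A 0) 0 (fun w a => by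
    rw [lowT_tmul, DGAlg.low_zero, ftmul_zero, zero_apply]) z

theorem lowT_one (z : CTensor₀ 𝕜 W A) : lowT W A 1 z = W.ofZero A (W.toZero A z) :=
  CTensor.ext (lowT W A 1 : CTensor₀ 𝕜 W A →L[𝕜] CTensor₀ 𝕜 W A)
    ((W.ofZero A).comp (W.toZero A)) (fun w a => by
      refine (lowT_tmul 1 w a).trans (Eq.symm ?_)
      change W.ofZero A (W.toZero A (CTensor.tmul ⊥ w a)) = CTensor.tmul ⊥ w (A.low 1 a)
      rw [toZero_tmul, ofZero_tmul, ← DGAlg.low_one]) z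

/-- A continuous seminorm on a free module vanishes on high filtration steps. -/
theorem exists_lowT (hA : A.NonNeg) (r : Seminorm 𝕜 (freeGr W A)) (hr : Continuous r) :
    ∃ J : ℕ, ∀ j, J ≤ j → ∀ z, lowT W A j z = 0 → r z = 0 := by
  obtain ⟨p, q, -, hq, hpq⟩ := CTensor.exists_seminorm_tmul (⊥ : Submodule 𝕜 (W ⊗[𝕜] A)) r hr
  obtain ⟨J, hJ⟩ := DGAlg.exists_low hA q hq
  refine ⟨J, fun j hj z hz => ?_⟩
  let D : freeGr W A →L[𝕜] freeGr W A := ContinuousLinearMap.id 𝕜 _ - lowT W A j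
  have hD : ∀ z, D z = z - lowT W A j z := fun _ => rfl
  have h := CTensor.seminorm_eq_zero (K := (⊥ : Submodule 𝕜 (W ⊗[𝕜] A)))
    (r.comp D.toLinearMap) (hr.comp D.continuous) (fun w a => by
      change r (D (ftmul w a)) = 0
      have h2 : D (ftmul w a) = ftmul w (a - A.low j a) := by
        rw [hD, lowT_tmul]
        exact (map_sub (CTensor.inr (⊥ : Submodule 𝕜 (W ⊗[𝕜] A)) w) a (A.low j a)).symm
      rw [h2]
      exact hpq _ _ (Or.inr (hJ j hj a))) z
  change r (D z) = 0 at h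
  rwa [hD, hz, sub_zero] at h

end Low

section GeometricSeries

variable {𝕜 : Type v} [RCLike 𝕜] {A : DGAlg.{v, u} 𝕜} {M : DGMod A}

/-- If `1 - (d h + h d)` is topologically nilpotent, then the module is contractible. -/
theorem DGMod.contractible_of_locFinite (h : GrHom (-1) M.toGrMod M.toGrMod)
    (ν : GrHom 0 M.toGrMod M.toGrMod) (hν : ∀ m, ν m = m - (M.d (h m) + h (M.d m)))
    (hl : LocFinite fun j : ℕ => ν.toContinuousLinearMap ^ j) : M.Contractible := by
  have hs : ∀ (j : ℕ) (m : M), (ν.toContinuousLinearMap ^ (j + 1)) m =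
      ν ((ν.toContinuousLinearMap ^ j) m) := fun j m => by
    rw [pow_succ']
    rfl
  have hs' : ∀ (j : ℕ) (m : M), (ν.toContinuousLinearMap ^ (j + 1)) m =
      (ν.toContinuousLinearMap ^ j) (ν m) := fun j m => by
    rw [pow_succ]
    rfl
  have hact : ∀ (j : ℕ) (m : M) (a : A), (ν.toContinuousLinearMap ^ j) (m <• a) =
      (ν.toContinuousLinearMap ^ j) m <• a := by
    intro j m a
    induction j with
    | zero => simp
    | succ j ih => rw [hs, ih, ν.act, hs]
  have hhom : ∀ (j : ℕ) (n : ℤ) (m : M), M.deg.Homog n m →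
      M.deg.Homog n ((ν.toContinuousLinearMap ^ j) m) := by
    intro j n m hm
    induction j with
    | zero => simpa using hm
    | succ j ih =>
      have := ν.homog ih
      rwa [add_zero, ← hs] at this
  have hνd : ∀ m, ν (M.d m) = M.d (ν m) := fun m => by
    rw [hν, hν, M.d_d, map_zero, add_zero, map_sub, map_add, M.d_d, zero_add]
  have hd : ∀ (j : ℕ) (m : M), (ν.toContinuousLinearMap ^ j) (M.d m) =
      M.d ((ν.toContinuousLinearMap ^ j) m) := by
    intro j m
    induction j with
    | zero => simp
    | succ j ih => rw [hs, ih, hνd, hs]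
  have hsum := hl.hasSum
  let w : GrHom 0 M.toGrMod M.toGrMod := GrHom.of hl.sum
    (fun m a => by
      have h1 := hsum (m <• a)
      simp only [hact] at h1
      exact h1.unique ((hsum m).const_smul (MulOpposite.op a)))
    (fun n m hm => by
      rw [add_zero]
      have h1 := (hsum m).mapL (M.deg.proj n)
      have h2 : ∀ j : ℕ, M.deg.proj n ((ν.toContinuousLinearMap ^ j) m) =
        (ν.toContinuousLinearMap ^ j) m := fun j => hhom j n m hm
      simp only [h2] at h1
      exact h1.unique (hsum m))
  have hw : ∀ m, HasSum (fun j : ℕ => (ν.toContinuousLinearMap ^ j) m) (w m) := hsum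
  refine DGMod.contractible_of_left_inverse h w (fun m => ?_) fun m => ?_
  · have h1 := hw (M.d m)
    simp only [hd] at h1
    exact h1.unique ((hw m).mapL M.d)
  · have h1 : M.d (h m) + h (M.d m) = m - ν m := by
      rw [hν, sub_sub_cancel]
    have h2 := hw (ν m)
    simp only [← hs'] at h2
    have h3 := HasSum.zero_add (f := fun j : ℕ => (ν.toContinuousLinearMap ^ j) m) h2
    rw [h1, map_sub, ← h3.unique (hw m)]
    simp

end GeometricSeries

section Key

variable {𝕜 : Type v} [RCLike 𝕜] {A : DGAlg.{v, u} 𝕜} (hA : A.NonNeg) {P : DGMod A}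

/-- The map `m ↦ m ⊗ 1`. -/
noncomputable def toExtend (P : DGMod A) : P →L[𝕜] P.extend hA := CTensor.inl P.relations 1

theorem toExtend_d (m : P) : toExtend hA P (P.d m) = (P.extend hA).d (toExtend hA P m) :=
  (CTensor.map_tmul P.d (ContinuousLinearMap.id 𝕜 _) (P.relations_d hA) m 1).symm

theorem toExtend_homog (n : ℤ) (m : P) (hm : P.deg.Homog n m) :
    (P.extend hA).deg.Homog n (toExtend hA P m) :=
  (CTensor.map_tmul (P.deg.proj n) (ContinuousLinearMap.id 𝕜 _) (P.relations_proj n) m 1).trans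
    (congrArg (toExtend hA P) hm)

theorem toExtend_act (m : P) (a : A) :
    toExtend hA P (m <• a) = toExtend hA P m <• A.pi₀ a := by
  refine (relations_tmul P.toGrMod m a 1).trans ?_
  refine Eq.trans ?_ (CTensor.right_tmul P.relations_right (A.pi₀ a) m 1).symm
  rw [mul_one, one_mul]

theorem toExtend_actHom_ofZero (t : CTensor₀ 𝕜 P A.zeroPart) :
    toExtend hA P (P.toGrMod.actHom (P.ofZero A t)) =
      extendOfL (M := P) (W := P.toGrSpace) (ContinuousLinearMap.id 𝕜 P) t := by
  let act : CTensor₀ 𝕜 P A →L[𝕜] P := P.toGrMod.actHom.toContinuousLinearMap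
  let pr : P →L[𝕜] CTensor P.relations := CTensor.inl P.relations 1
  have hact : ∀ (m : P) (a : A), act (CTensor.tmul ⊥ m a) = m <• a := P.toGrMod.actHom_ftmul
  refine CTensor.ext (pr.comp (act.comp (P.ofZero A)))
    (extendOfL (M := P) (W := P.toGrSpace) (ContinuousLinearMap.id 𝕜 P)) (fun m s => ?_) t
  rw [extendOfL_tmul, ContinuousLinearMap.comp_apply, ContinuousLinearMap.comp_apply, ofZero_tmul,
    hact]
  refine (relations_tmul P.toGrMod m _ 1).trans ?_
  rw [DGAlg.pi₀_incl, mul_one]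
  rfl

/-- The action after the inclusion `P ⊗̂ A⁰ → P ⊗̂ A`. -/
noncomputable def actZero (P : DGMod A) : CTensor₀ 𝕜 P A.zeroPart →L[𝕜] P :=
  (P.toGrMod.actHom.toContinuousLinearMap : CTensor₀ 𝕜 P A →L[𝕜] P).comp (P.ofZero A)

variable {hA}

theorem exists_extend_section (i : GrHom 0 P.toGrMod (freeGr P.toGrSpace A))
    (hi : ∀ m, P.toGrMod.actHom (i m) = m) :
    ∃ σ : P.extend hA →L[𝕜] P, (∀ n z, (P.extend hA).deg.Homog n z → P.deg.Homog n (σ z)) ∧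
      ∀ z, toExtend hA P (σ z) = z := by
  refine ⟨(actZero P).comp (extendLiftL hA i : CTensor P.relations →L[𝕜] _), fun n z hz => ?_,
    fun z => ?_⟩
  · have h1 := (extendLift hA i).homog hz
    rw [add_zero] at h1
    have h2 := (tensor_proj_ofZero (A := A) P.toGrSpace n (extendLiftL hA i z)).trans
      (congrArg (P.ofZero A) h1)
    have h3 := P.toGrMod.actHom.homog (i := n) (m := P.ofZero A (extendLiftL hA i z)) h2
    rw [add_zero] at h3
    exact h3
  · exact (toExtend_actHom_ofZero hA _).trans (extendOfL_extendLiftL hA i _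
      (fun i w h => by rw [add_zero]; exact h) (fun m => (freeLift_id _ _).trans (hi m)) z)

/-- A contraction of the extension of scalars lifts to an `A^#`-linear map. -/
theorem exists_lift_contraction (hP : P.toGrMod.HasSection)
    (h₀ : GrHom (-1) (P.extend hA).toGrMod (P.extend hA).toGrMod) :
    ∃ h : GrHom (-1) P.toGrMod P.toGrMod, ∀ m, toExtend hA P (h m) = h₀ (toExtend hA P m) := by
  obtain ⟨i, hi⟩ := hP
  obtain ⟨σ, hσ, hprσ⟩ := exists_extend_section (hA := hA) i hi
  let f : P →L[𝕜] P := σ.comp (h₀.toContinuousLinearMap.comp (toExtend hA P))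
  have hf : ∀ n m, P.deg.Homog n m → P.deg.Homog (n + -1) (f m) := fun n m hm =>
    hσ _ _ (h₀.homog (toExtend_homog hA _ _ hm))
  have hprf : ∀ m, toExtend hA P (f m) = h₀ (toExtend hA P m) := fun m => hprσ _
  let F : GrHom (-1) (freeGr P.toGrSpace A) P.toGrMod := freeLift (W := P.toGrSpace) f hf
  have hF : ∀ m (a : A), F (ftmul m a) = f m <• a := freeLift_ftmul f hf
  refine ⟨F.comp i, fun m => ?_⟩
  have h := free_ext_clm ((toExtend hA P).comp F.toContinuousLinearMap)
    (h₀.toContinuousLinearMap.comp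
      ((toExtend hA P).comp P.toGrMod.actHom.toContinuousLinearMap))
    (fun m a => by
      simp only [ContinuousLinearMap.comp_apply, GrHom.coe_clm, GrMod.actHom_ftmul, hF,
        toExtend_act, h₀.act, hprf]) (i m)
  simp only [ContinuousLinearMap.comp_apply, GrHom.coe_clm, hi] at h
  exact h

theorem lowT_of_toExtend (i : GrHom 0 P.toGrMod (freeGr P.toGrSpace A)) (m : P)
    (hm : toExtend hA P m = 0) : lowT P.toGrSpace A 1 (i m) = 0 := by
  refine (lowT_one (W := P.toGrSpace) (i m)).trans ?_
  have h1 : CTensor.right ⊥ rightStable_bot 1 (zeroMap i m) = 0 :=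
    (extendLiftL_tmul hA i m 1).symm.trans
      ((congrArg (extendLiftL hA i) hm).trans (map_zero (extendLiftL hA i)))
  have h2 : zeroMap i m = 0 := by
    refine Eq.trans ?_ h1
    exact (CTensor.ext (CTensor.right ⊥ rightStable_bot 1) (ContinuousLinearMap.id 𝕜 _)
        (fun w s => by simp) _).symm
  exact (congrArg (P.ofZero A) h2).trans (map_zero (P.ofZero A))

/-- The differential of an `A^#`-linear map of degree `-1`. -/
def GrHom.boundary (h : GrHom (-1) P.toGrMod P.toGrMod) : GrHom 0 P.toGrMod P.toGrMod :=
  GrHom.of (P.d.comp h.toContinuousLinearMap + h.toContinuousLinearMap.comp P.d)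
    (fun m a => by
      refine P.deg.ext_fun
        ((P.d.comp h.toContinuousLinearMap + h.toContinuousLinearMap.comp P.d).comp (P.actCLM a))
        ((P.actCLM a).comp (P.d.comp h.toContinuousLinearMap + h.toContinuousLinearMap.comp P.d))
        (fun n m hm => ?_) m
      change P.d (h (m <• a)) + h (P.d (m <• a)) = (P.d (h m) + h (P.d m)) <• a
      rw [h.act, P.leibniz _ _ _ hm, P.leibniz _ _ _ (h.homog hm), map_add, h.act, Units.smul_def,
        Units.smul_def, map_zsmul, h.act, smul_add,
        show (((n + -1).negOnePow : ℤˣ) : ℤ) = -(n.negOnePow : ℤ) by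
          rw [← neg_eq_iff_eq_neg, ← negOnePow_succ']; congr 2; omega]
      generalize P.d (h m) <• a = y1
      generalize h m <• A.d a = y2
      generalize h (P.d m) <• a = y3
      module)
    (fun n m hm => by
      have h1 := P.d_homog _ _ (h.homog hm)
      have h2 := h.homog (P.d_homog _ _ hm)
      rw [neg_add_cancel_right] at h1
      rw [add_neg_cancel_right] at h2
      rw [add_zero]
      exact h1.add h2)

theorem GrHom.boundary_apply (h : GrHom (-1) P.toGrMod P.toGrMod) (m : P) :
    h.boundary m = P.d (h m) + h (P.d m) := rfl

/-- Endomorphisms which vanish on `P ⊗̂_A A⁰` are topologically nilpotent. -/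
theorem locFinite_pow (hP : P.toGrMod.HasSection) (ν : GrHom 0 P.toGrMod P.toGrMod)
    (hν : ∀ m, toExtend hA P (ν m) = 0) :
    LocFinite fun j : ℕ => ν.toContinuousLinearMap ^ j := by
  obtain ⟨i, hi⟩ := hP
  let Φ : GrHom 0 (freeGr P.toGrSpace A) (freeGr P.toGrSpace A) :=
    i.comp (ν.comp P.toGrMod.actHom : GrHom 0 _ _)
  have hΦ : ∀ z, Φ z = i (ν (P.toGrMod.actHom z)) := fun _ => rfl
  have hlow : ∀ (k : ℕ) m, lowT P.toGrSpace A k (i ((ν.toContinuousLinearMap ^ k) m)) = 0 := by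
    intro k m
    induction k with
    | zero => exact lowT_zero _
    | succ k ih =>
      have h1 := lowT_map hA Φ (fun m => by
        rw [hΦ]
        exact lowT_of_toExtend i _ (hν _)) k _ ih
      rw [hΦ, hi] at h1
      rw [pow_succ']
      exact h1
  intro p hp
  obtain ⟨J, hJ⟩ := exists_lowT (W := P.toGrSpace) hA
    (p.comp P.toGrMod.actHom.toContinuousLinearMap.toLinearMap)
    (hp.comp P.toGrMod.actHom.toContinuousLinearMap.continuous)
  refine ⟨Finset.range J, fun j hj m => ?_⟩
  have h1 := hJ j (by simpa using hj) _ (hlow j m)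
  change p (P.toGrMod.actHom (i _)) = 0 at h1
  rwa [hi] at h1

/-- A graded-projective module is contractible if its extension of scalars to `A⁰` is. -/
theorem contractible_of_extend (hP : P.toGrMod.HasSection) (hE : (P.extend hA).Contractible) :
    P.Contractible := by
  obtain ⟨h₀, hh₀⟩ := hE
  obtain ⟨h, hh⟩ := exists_lift_contraction hP h₀
  refine DGMod.contractible_of_locFinite h (GrHom.id _ - h.boundary)
    (fun m => by rw [GrHom.sub_apply, GrHom.id_apply, GrHom.boundary_apply])
    (locFinite_pow (hA := hA) hP _ fun m => ?_)
  rw [GrHom.sub_apply, GrHom.id_apply, GrHom.boundary_apply, map_sub, map_add, toExtend_d, hh, hh,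
    toExtend_d, hh₀, sub_self]

end Key

/-! ## Extension of scalars of contractible, conical and graded-free modules -/

section ExtendApi

variable {𝕜 : Type v} [RCLike 𝕜] {A : DGAlg.{v, u} 𝕜} (hA : A.NonNeg) {M N : DGMod A} {k : ℤ}

/-- The class of `m ⊗ s` in `M ⊗̂_A A⁰`. -/
noncomputable def etmul (m : M) (s : A.zeroPart) : M.extend hA := CTensor.tmul M.relations m s

theorem extend_ext {G : Type u} [AddCommGroup G] [Module 𝕜 G] [UniformSpace G] [T2Space G]
    (f g : M.extend hA →L[𝕜] G)
    (h : ∀ (m : M) (s : A.zeroPart), f (etmul hA m s) = g (etmul hA m s)) (z : M.extend hA) :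
    f z = g z := CTensor.ext (K := M.relations) f g h z

theorem extend_d_etmul (m : M) (s : A.zeroPart) :
    (M.extend hA).d (etmul hA m s) = etmul hA (M.d m) s := CTensor.map_tmul _ _ _ _ _

theorem extend_etmul (f : GrHom k M.toGrMod N.toGrMod) (m : M) (s : A.zeroPart) :
    f.extend hA (etmul hA m s) = etmul hA (f m) s := CTensor.map_tmul _ _ _ _ _

theorem extendZ_etmul (f : M ⟶ N) (m : M) (s : A.zeroPart) :
    DGHom.gr ((extendZ hA).map f) (etmul hA m s) = etmul hA (f.gr m) s :=
  CTensor.map_tmul _ _ _ _ _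

theorem etmul_add (m n : M) (s : A.zeroPart) :
    etmul hA (m + n) s = etmul hA m s + etmul hA n s := map_add (CTensor.inl M.relations s) m n

theorem etmul_neg (m : M) (s : A.zeroPart) : etmul hA (-m) s = -etmul hA m s :=
  map_neg (CTensor.inl M.relations s) m

variable {hA}

theorem DGMod.Contractible.extend (h : M.Contractible) : (M.extend hA).Contractible := by
  obtain ⟨c, hc⟩ := h
  refine ⟨c.extend hA, extend_ext hA
    ((M.extend hA).d.comp (c.extend hA).toContinuousLinearMap +
      (c.extend hA).toContinuousLinearMap.comp (M.extend hA).d) (ContinuousLinearMap.id 𝕜 _)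
    fun m s => ?_⟩
  simp only [add_apply, ContinuousLinearMap.comp_apply, GrHom.coe_clm, extend_etmul,
    extend_d_etmul, ContinuousLinearMap.id_apply]
  rw [← etmul_add, hc]

/-- Extension of scalars commutes with cones. -/
theorem contractible_extend_cone (f : M ⟶ N) (F : M.extend hA ⟶ N.extend hA)
    (hF : ∀ m s, F.gr (etmul hA m s) = etmul hA (f.gr m) s) (h : F.cone.Contractible) :
    (f.cone.extend hA).Contractible := by
  let i : GrHom 0 (f.cone.extend hA).toGrMod F.cone.toGrMod :=
    (coneInl F).comp ((coneFst f).extend hA) + (coneInr F).comp ((coneSnd f).extend hA)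
  let r : GrHom 0 F.cone.toGrMod (f.cone.extend hA).toGrMod :=
    ((coneInl f).extend hA).comp (coneFst F) + ((coneInr f).extend hA).comp (coneSnd F)
  have hr1 : ∀ x : M.extend hA, (coneInl f).extend hA ((M.extend hA).d x) =
      -(f.cone.extend hA).d ((coneInl f).extend hA x) + (coneInr f).extend hA (F.gr x) :=
    extend_ext hA (((coneInl f).extend hA).toContinuousLinearMap.comp (M.extend hA).d)
      (-(f.cone.extend hA).d.comp ((coneInl f).extend hA).toContinuousLinearMap +
        ((coneInr f).extend hA).toContinuousLinearMap.comp F.gr.toContinuousLinearMap)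
      fun m s => by
        simp only [add_apply, neg_apply, ContinuousLinearMap.comp_apply, GrHom.coe_clm, hF,
          extend_etmul, extend_d_etmul]
        rw [← etmul_neg, ← etmul_add, cone_d_inl, neg_add, neg_neg, neg_add_cancel_right]
  have hr2 : ∀ x : N.extend hA, (coneInr f).extend hA ((N.extend hA).d x) =
      (f.cone.extend hA).d ((coneInr f).extend hA x) :=
    extend_ext hA (((coneInr f).extend hA).toContinuousLinearMap.comp (N.extend hA).d)
      ((f.cone.extend hA).d.comp ((coneInr f).extend hA).toContinuousLinearMap)
      fun m s => by
        simp only [ContinuousLinearMap.comp_apply, GrHom.coe_clm, extend_etmul, extend_d_etmul,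
          cone_d_inr]
  have hi1 : ∀ x : f.cone.extend hA, (coneFst f).extend hA ((f.cone.extend hA).d x) =
      -(M.extend hA).d ((coneFst f).extend hA x) :=
    extend_ext hA (((coneFst f).extend hA).toContinuousLinearMap.comp (f.cone.extend hA).d)
      (-(M.extend hA).d.comp ((coneFst f).extend hA).toContinuousLinearMap)
      fun m s => by
        simp only [neg_apply, ContinuousLinearMap.comp_apply, GrHom.coe_clm, extend_etmul,
          extend_d_etmul, coneFst_d, etmul_neg]
  have hi2 : ∀ x : f.cone.extend hA, (coneSnd f).extend hA ((f.cone.extend hA).d x) =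
      F.gr ((coneFst f).extend hA x) + (N.extend hA).d ((coneSnd f).extend hA x) :=
    extend_ext hA (((coneSnd f).extend hA).toContinuousLinearMap.comp (f.cone.extend hA).d)
      (F.gr.toContinuousLinearMap.comp ((coneFst f).extend hA).toContinuousLinearMap +
        (N.extend hA).d.comp ((coneSnd f).extend hA).toContinuousLinearMap)
      fun m s => by
        simp only [add_apply, ContinuousLinearMap.comp_apply, GrHom.coe_clm, extend_etmul,
          extend_d_etmul, coneSnd_d, hF, etmul_add]
  have hri : ∀ x : f.cone.extend hA, (coneInl f).extend hA ((coneFst f).extend hA x) +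
      (coneInr f).extend hA ((coneSnd f).extend hA x) = x :=
    extend_ext hA (((coneInl f).extend hA).toContinuousLinearMap.comp
        ((coneFst f).extend hA).toContinuousLinearMap +
      ((coneInr f).extend hA).toContinuousLinearMap.comp
        ((coneSnd f).extend hA).toContinuousLinearMap) (ContinuousLinearMap.id 𝕜 _)
      fun m s => by
        simp only [add_apply, ContinuousLinearMap.comp_apply, GrHom.coe_clm, extend_etmul,
          ContinuousLinearMap.id_apply]
        rw [← etmul_add, cone_eta]
  refine h.retract (DGHom.ofGr i fun x => cone_ext ?_ ?_) (DGHom.ofGr r fun x => ?_) fun x => ?_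
  · simp only [i, GrHom.add_apply, GrHom.comp_apply, map_add, coneFst_inl, coneFst_inr, coneFst_d,
      add_zero, hi1, map_zero, neg_zero]
  · simp only [i, GrHom.add_apply, GrHom.comp_apply, map_add, coneSnd_inl, coneSnd_inr, coneSnd_d,
      zero_add, hi2, coneFst_inl, coneFst_inr, map_zero, add_zero]
  · simp only [r, GrHom.add_apply, GrHom.comp_apply, map_add, coneFst_d, coneSnd_d, map_neg, hr1,
      hr2]
    abel
  · refine Eq.trans ?_ (hri x)
    simp only [i, r, DGHom.gr_ofGr, GrHom.add_apply, GrHom.comp_apply, map_add, coneFst_inl,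
      coneFst_inr, coneSnd_inl, coneSnd_inr, add_zero, zero_add, map_zero]

end ExtendApi

section Reduction

variable {𝕜 : Type v} [RCLike 𝕜] {A : DGAlg.{v, u} 𝕜} (hA : A.NonNeg) {W : GrSpace.{v, u} 𝕜}
  {N : DGMod A} (φ : GradedFree W N)

namespace GradedFree

/-- The generators of a graded-free module. -/
noncomputable def gen : W →L[𝕜] N := φ.ofFree.toContinuousLinearMap.comp (freeUnit W A)

theorem gen_homog (i : ℤ) (w : W) (hw : W.deg.Homog i w) : N.deg.Homog i (φ.gen w) := by
  have := φ.ofFree.homog (freeUnit_homog (A := A) i w hw)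
  rwa [add_zero] at this

theorem gen_homog' (i : ℤ) (w : W) (hw : W.deg.Homog i w) : N.deg.Homog (i + 0) (φ.gen w) := by
  rw [add_zero]
  exact φ.gen_homog i w hw

theorem freeLift_gen (z : freeGr W A) :
    freeLift (A := A) (X := N.toGrMod) φ.gen φ.gen_homog' z = φ.ofFree z :=
  free_ext _ _ (fun w => by
    rw [freeLift_ftmul, MulOpposite.op_one, one_smul]
    rfl) z

theorem toZero_toFree_gen (w : W) : zeroMap φ.toFree (φ.gen w) = CTensor.tmul ⊥ w 1 := by
  refine (congrArg (W.toZero A) (φ.toFree_ofFree (freeUnit W A w))).trans ?_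
  refine (toZero_tmul W w 1).trans ?_
  rw [DGAlg.pi₀_one]

theorem extendLiftL_extendOfL (z : CTensor₀ 𝕜 W A.zeroPart) :
    extendLiftL hA φ.toFree (extendOfL φ.gen z) = z := by
  refine CTensor.ext ((extendLiftL hA φ.toFree).comp (extendOfL φ.gen))
    (ContinuousLinearMap.id 𝕜 _) (fun w s => ?_) z
  rw [ContinuousLinearMap.comp_apply, extendOfL_tmul, extendLiftL_tmul, toZero_toFree_gen,
    CTensor.right_tmul, one_mul]
  rfl

theorem extendOfL_extendLiftL (z : CTensor N.relations) :
    extendOfL φ.gen (extendLiftL hA φ.toFree z) = z :=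
  _root_.extendOfL_extendLiftL hA φ.toFree φ.gen φ.gen_homog'
    (fun m => (φ.freeLift_gen _).trans (φ.ofFree_toFree m)) z

theorem extendLiftL_d (z : CTensor N.relations) :
    extendLiftL hA φ.toFree ((N.extend hA).d z) = φ.d₀ (extendLiftL hA φ.toFree z) := by
  refine CTensor.ext ((extendLiftL hA φ.toFree).comp
    ((N.extend hA).d : CTensor N.relations →L[𝕜] CTensor N.relations))
    (φ.d₀.comp (extendLiftL hA φ.toFree)) (fun n s => ?_) z
  have h1 : extendLiftL hA φ.toFree ((N.extend hA).d (CTensor.tmul N.relations n s)) =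
      CTensor.right ⊥ rightStable_bot s (zeroMap φ.toFree (N.d n)) :=
    (congrArg (extendLiftL hA φ.toFree) (extend_d_etmul hA n s)).trans
      (extendLiftL_tmul hA φ.toFree (N.d n) s)
  refine h1.trans ?_
  rw [ContinuousLinearMap.comp_apply, extendLiftL_tmul, φ.d₀_right hA]
  refine congrArg (CTensor.right ⊥ rightStable_bot s) ?_
  refine Eq.trans ?_ (φ.d₀_toZero hA (φ.iso.symm n)).symm
  rw [ContinuousLinearEquiv.apply_symm_apply]
  rfl

/-- The comparison `N ⊗̂_A A⁰ → (W ⊗̂ A⁰, d₀)`. -/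
noncomputable def toReduction : N.extend hA ⟶ φ.reduction hA :=
  DGHom.ofGr (N := φ.reduction hA) (extendLift hA φ.toFree) (φ.extendLiftL_d hA)

/-- The comparison `(W ⊗̂ A⁰, d₀) → N ⊗̂_A A⁰`. -/
noncomputable def ofReduction : φ.reduction hA ⟶ N.extend hA :=
  DGHom.ofGr (M := φ.reduction hA) (extendOf hA φ.gen φ.gen_homog) fun z =>
    (congrArg (extendOfL φ.gen) ((φ.extendLiftL_d hA (extendOfL φ.gen z)).trans
      (congrArg φ.d₀ (φ.extendLiftL_extendOfL hA z))).symm).trans (φ.extendOfL_extendLiftL hA _)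

theorem reduction_contractible_iff :
    (φ.reduction hA).Contractible ↔ (N.extend hA).Contractible :=
  ⟨fun h => h.retract (φ.toReduction hA) (φ.ofReduction hA) (φ.extendOfL_extendLiftL hA),
    fun h => h.retract (φ.ofReduction hA) (φ.toReduction hA) (φ.extendLiftL_extendOfL hA)⟩

theorem hasSection_reduction : (φ.reduction hA).toGrMod.HasSection := hasSection_zeroFree W

/-- Contractibility of a graded-free module can be tested on its reduction. -/
theorem contractible_iff_reduction : N.Contractible ↔ (φ.reduction hA).Contractible :=
  ⟨fun h => (φ.reduction_contractible_iff hA).2 h.extend,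
    fun h => contractible_of_extend φ.hasSection ((φ.reduction_contractible_iff hA).1 h)⟩

end GradedFree

end Reduction

/-! ## Coreflections and localization -/

section Coreflection

variable {C : Type*} [Category* C] {D : Type*} [Category* D]

/-- If every object of `D` receives a morphism in `W` from an object of the full subcategory `C`,
and the morphisms in `W` induce bijections on morphisms from objects of `C`, then `C` is equivalent
to the localization of `D` with respect to `W`. -/
theorem isEquivalence_comp_Q (F : C ⥤ D) [F.Full] [F.Faithful] (W : MorphismProperty D)
    (hW : ∀ (X : C) {Y Z : D} (f : Y ⟶ Z), W f →
      Function.Bijective (fun g : F.obj X ⟶ Y => g ≫ f))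
    (hC : ∀ Y : D, ∃ (X : C) (p : F.obj X ⟶ Y), W p) : (F ⋙ W.Q).IsEquivalence := by
  choose G p hp using hC
  let e (X : C) (Y : D) : (F.obj X ⟶ Y) ≃ (X ⟶ G Y) :=
    ((Functor.FullyFaithful.ofFullyFaithful F).homEquiv.trans
      (Equiv.ofBijective _ (hW X (p Y) (hp Y)))).symm
  have he_symm : ∀ X Y (g : X ⟶ G Y), (e X Y).symm g = F.map g ≫ p Y := fun _ _ _ => rfl
  have he : ∀ X' X Y (f : X' ⟶ X) (g : F.obj X ⟶ Y),
      e X' Y (F.map f ≫ g) = f ≫ e X Y g := by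
    intro X' X Y f g
    obtain ⟨g, rfl⟩ := (e X Y).symm.surjective g
    rw [Equiv.apply_symm_apply, ← Equiv.eq_symm_apply, he_symm, he_symm, F.map_comp,
      Category.assoc]
  let R := Adjunction.rightAdjointOfEquiv e he
  let adj : F ⊣ R := Adjunction.adjunctionOfEquivRight e he
  have hadj : ∀ X Y, adj.homEquiv X Y = e X Y := fun X Y => by
    simp [adj, Adjunction.adjunctionOfEquivRight]
  have hR : W.IsInvertedBy R := fun Y Z f hf => by
    rw [isIso_iff_yoneda_map_bijective]
    intro X
    have h : (fun x : X ⟶ R.obj Y => x ≫ R.map f) =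
        adj.homEquiv X Z ∘ (fun g : F.obj X ⟶ Y => g ≫ f) ∘ (adj.homEquiv X Y).symm := by
      funext x
      simp [Adjunction.homEquiv_naturality_right]
    rw [h]
    exact (Equiv.bijective _).comp ((hW X f hf).comp (Equiv.bijective _))
  let R' := Localization.lift R hR W.Q
  let fac : W.Q ⋙ R' ≅ R := Localization.fac R hR W.Q
  have hc : ∀ Y, adj.counit.app Y = p Y := fun Y => by
    rw [← Adjunction.homEquiv_symm_id, hadj]
    exact (he_symm _ _ _).trans (by rw [F.map_id, Category.id_comp])
  have : IsIso (Functor.whiskerRight adj.counit W.Q) := by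
    rw [NatTrans.isIso_iff_isIso_app]
    intro Y
    rw [Functor.whiskerRight_app, hc]
    exact Localization.inverts W.Q W _ (hp Y)
  let η : 𝟭 C ≅ (F ⋙ W.Q) ⋙ R' :=
    asIso adj.unit ≪≫ Functor.isoWhiskerLeft F fac.symm ≪≫ (Functor.associator _ _ _).symm
  let _ : Localization.Lifting W.Q W (R ⋙ F ⋙ W.Q) (R' ⋙ F ⋙ W.Q) :=
    ⟨(Functor.associator _ _ _).symm ≪≫ Functor.isoWhiskerRight fac (F ⋙ W.Q)⟩
  let ε : R' ⋙ F ⋙ W.Q ≅ 𝟭 _ :=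
    Localization.liftNatIso W.Q W (R ⋙ F ⋙ W.Q) W.Q (R' ⋙ F ⋙ W.Q) (𝟭 _)
      ((Functor.associator _ _ _).symm ≪≫ asIso (Functor.whiskerRight adj.counit W.Q) ≪≫
        Functor.leftUnitor _)
  exact (CategoryTheory.Equivalence.mk (F ⋙ W.Q) R' η ε).isEquivalence_functor

end Coreflection

/-! ## The contraderived category and graded-projective modules -/

section Contraderived

variable {𝕜 : Type v} [RCLike 𝕜] {A : DGAlg.{v, u} 𝕜} {M N : DGMod A}

theorem bijective_comp_of_orth_cone {P : DGMod A} {f : M ⟶ N} (h : Orth P f.cone) :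
    Function.Bijective fun φ : P.toHo ⟶ M.toHo =>
      φ ≫ (Quotient.functor (DGHomotopic A)).map f := by
  constructor
  · intro φ ψ hφ
    obtain ⟨φ, rfl⟩ := (Quotient.functor (DGHomotopic A)).map_surjective φ
    obtain ⟨ψ, rfl⟩ := (Quotient.functor (DGHomotopic A)).map_surjective ψ
    dsimp only at hφ
    rw [← Functor.map_comp, ← Functor.map_comp, ho_map_eq_iff] at hφ
    exact (ho_map_eq_iff _ _).2 (homotopic_of_orth_cone h φ ψ hφ)
  · intro φ
    obtain ⟨φ, rfl⟩ := (Quotient.functor (DGHomotopic A)).map_surjective φ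
    obtain ⟨ψ, hψ⟩ := exists_lift_of_orth_cone h φ
    refine ⟨(Quotient.functor (DGHomotopic A)).map ψ, ?_⟩
    dsimp only
    rw [← Functor.map_comp]
    exact (ho_map_eq_iff _ _).2 hψ

theorem isIso_ho_map_of_contractible_cone {f : M ⟶ N} (h : f.cone.Contractible) :
    IsIso ((Quotient.functor (DGHomotopic A)).map f) :=
  (isIso_iff_yoneda_map_bijective _).2 fun T =>
    bijective_comp_of_orth_cone (P := T.as) (Orth.of_contractible h)

theorem contractible_cone_of_isIso_ho_map {f : M ⟶ N}
    (h : IsIso ((Quotient.functor (DGHomotopic A)).map f)) : f.cone.Contractible := by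
  obtain ⟨g, h1, h2⟩ := h
  obtain ⟨g, rfl⟩ := (Quotient.functor (DGHomotopic A)).map_surjective g
  rw [← Functor.map_comp] at h1 h2
  obtain ⟨s, hs⟩ := (ho_map_eq_iff (f ≫ g) (𝟙 M)).1
    (h1.trans ((Quotient.functor (DGHomotopic A)).map_id M).symm)
  obtain ⟨t, ht⟩ := (ho_map_eq_iff (g ≫ f) (𝟙 N)).1
    (h2.trans ((Quotient.functor (DGHomotopic A)).map_id N).symm)
  exact cone_contractible g s t hs ht

/-- The homotopy category of graded-projective modules is equivalent to the contraderived
category. -/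
instance isEquivalence_gprojToDctr (A : DGAlg.{v, u} 𝕜) : (gprojToDctr A).IsEquivalence := by
  refine isEquivalence_comp_Q (gradedProjectives A).ι (ctrEquiv A) ?_ ?_
  · rintro P Y Z _ ⟨f, rfl, hf⟩
    exact bijective_comp_of_orth_cone (P := P.obj.as)
      (hf.orth (GrMod.isGradedProjective_iff.1 P.property))
  · intro Y
    obtain ⟨P, f, hP, hf⟩ := exists_resolution Y.as
    exact ⟨⟨P.toHo, GrMod.isGradedProjective_iff.2 hP⟩,
      (Quotient.functor (DGHomotopic A)).map f, f, rfl, hf⟩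

theorem isIso_of_isIso_quot_map {X Y : HoCat A} (hX : gradedProjectives A X)
    (hY : gradedProjectives A Y) (φ : X ⟶ Y) (h : IsIso ((Dctr.quot A).map φ)) : IsIso φ := by
  let φ' : (⟨X, hX⟩ : (gradedProjectives A).FullSubcategory) ⟶ ⟨Y, hY⟩ :=
    ObjectProperty.homMk φ
  have h1 : IsIso ((gprojToDctr A).map φ') := h
  have h2 := isIso_of_reflects_iso φ' (gprojToDctr A)
  exact Functor.map_isIso (gradedProjectives A).ι φ'

theorem isZero_map_of_isEquivalence {C D : Type*} [Category* C] [Category* D] (F : C ⥤ D)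
    [F.IsEquivalence] {X : C} (h : Limits.IsZero X) : Limits.IsZero (F.obj X) := by
  have h1 : Limits.IsInitial (F.obj X) := Limits.IsInitial.isInitialObj F X h.isInitial
  have h2 : Limits.IsTerminal (F.obj X) := Limits.IsTerminal.isTerminalObj F X h.isTerminal
  exact ⟨fun Y => ⟨⟨⟨h1.to Y⟩, fun _ => h1.hom_ext _ _⟩⟩,
    fun Y => ⟨⟨⟨h2.from Y⟩, fun _ => h2.hom_ext _ _⟩⟩⟩

/-- The zero morphism. -/
def DGHom.zero (M N : DGMod A) : M ⟶ N := DGHom.ofGr 0 fun _ => (map_zero N.d).symm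

theorem ho_zero_eq_id_iff : (Quotient.functor (DGHomotopic A)).map (DGHom.zero N N) = 𝟙 N.toHo ↔
    N.Contractible := by
  have h : 𝟙 N.toHo = (Quotient.functor (DGHomotopic A)).map (𝟙 N) :=
    ((Quotient.functor (DGHomotopic A)).map_id N).symm
  rw [h, eq_comm, ho_map_eq_iff, dgHomotopic_iff]
  refine exists_congr fun h => forall_congr' fun m => ?_
  rw [eq_comm, DGHom.gr_id, show (DGHom.zero N N).gr m = 0 from rfl, sub_zero]

theorem DGMod.Contractible.eq_zero_of_src (h : N.Contractible) (φ : N.toHo ⟶ M.toHo) :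
    φ = (Quotient.functor (DGHomotopic A)).map (DGHom.zero N M) := by
  obtain ⟨f, rfl⟩ := (Quotient.functor (DGHomotopic A)).map_surjective φ
  rw [← Category.id_comp ((Quotient.functor (DGHomotopic A)).map f), ← ho_zero_eq_id_iff.2 h,
    ← Functor.map_comp]
  exact congrArg _ (DGHom.ext_gr fun _ => map_zero f.gr)

theorem DGMod.Contractible.eq_zero_of_tgt (h : N.Contractible) (φ : M.toHo ⟶ N.toHo) :
    φ = (Quotient.functor (DGHomotopic A)).map (DGHom.zero M N) := by
  obtain ⟨f, rfl⟩ := (Quotient.functor (DGHomotopic A)).map_surjective φ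
  rw [← Category.comp_id ((Quotient.functor (DGHomotopic A)).map f), ← ho_zero_eq_id_iff.2 h,
    ← Functor.map_comp]
  rfl

/-- A graded-projective module is contraacyclic if and only if it is contractible. -/
theorem isContraacyclic_iff (hN : N.toGrMod.HasSection) : N.IsContraacyclic ↔ N.Contractible := by
  let X : (gradedProjectives A).FullSubcategory :=
    ⟨N.toHo, GrMod.isGradedProjective_iff.2 hN⟩
  constructor
  · intro h
    have hz : (ObjectProperty.homMk ((Quotient.functor (DGHomotopic A)).map (DGHom.zero N N)) :
        X ⟶ X) = 𝟙 X := (gprojToDctr A).map_injective (h.eq_of_src _ _)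
    exact ho_zero_eq_id_iff.1 (congrArg (gradedProjectives A).ι.map hz)
  · intro h
    have hX : Limits.IsZero X :=
      ⟨fun Y => ⟨⟨⟨ObjectProperty.homMk
          ((Quotient.functor (DGHomotopic A)).map (DGHom.zero N Y.obj.as))⟩,
          fun φ => (gradedProjectives A).ι.map_injective (h.eq_zero_of_src (M := Y.obj.as) φ.hom)⟩⟩,
        fun Y => ⟨⟨⟨ObjectProperty.homMk
          ((Quotient.functor (DGHomotopic A)).map (DGHom.zero Y.obj.as N))⟩,
          fun φ => (gradedProjectives A).ι.map_injective
            (h.eq_zero_of_tgt (M := Y.obj.as) φ.hom)⟩⟩⟩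
    exact isZero_map_of_isEquivalence (gprojToDctr A) hX

/-- Extension of scalars along `A → A⁰` reflects isomorphisms between graded-projective modules. -/
theorem reflectsIsomorphisms_extend (hA : A.NonNeg) :
    ((gradedProjectives A).ι ⋙ extendHo hA ⋙ Dctr.quot A.zeroPart).ReflectsIsomorphisms := by
  refine ⟨fun {X Y} φ hφ => ?_⟩
  have hX : X.obj.as.toGrMod.HasSection := GrMod.isGradedProjective_iff.1 X.property
  have hY : Y.obj.as.toGrMod.HasSection := GrMod.isGradedProjective_iff.1 Y.property
  obtain ⟨f, hf⟩ := (Quotient.functor (DGHomotopic A)).map_surjective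
    (X := X.obj.as) (Y := Y.obj.as) φ.hom
  have h1 : IsIso ((extendHo hA).map φ.hom) := isIso_of_isIso_quot_map
    (GrMod.isGradedProjective_iff.2 (hasSection_extend hA hX))
    (GrMod.isGradedProjective_iff.2 (hasSection_extend hA hY)) _ hφ
  rw [← hf] at h1
  have h2 := contractible_cone_of_isIso_ho_map (f := (extendZ hA).map f) h1
  have h3 := contractible_of_extend (hasSection_cone hX hY f)
    (contractible_extend_cone f ((extendZ hA).map f) (extendZ_etmul hA f) h2)
  have h4 : IsIso ((gradedProjectives A).ι.map φ) := by
    change IsIso φ.hom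
    rw [← hf]
    exact isIso_ho_map_of_contractible_cone h3
  exact isIso_of_reflects_iso φ (gradedProjectives A).ι

end Contraderived

theorem mainTheorem12 {𝕜 : Type v} [RCLike 𝕜] (A : DGAlg.{v, u} 𝕜) (hA : A.NonNeg) :
    (∃ L : Dctr A ⥤ Dctr A.zeroPart, IsDerivedExtension hA L) ∧
    (∀ L : Dctr A ⥤ Dctr A.zeroPart, IsDerivedExtension hA L → L.ReflectsIsomorphisms) ∧
    (∀ (W : GrSpace.{v, u} 𝕜) (N : DGMod A) (φ : GradedFree W N),
      N.IsContraacyclic ↔ (φ.reduction hA).IsContraacyclic) := by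
  refine ⟨⟨(gprojToDctr A).inv ⋙ (gradedProjectives A).ι ⋙ extendHo hA ⋙ Dctr.quot A.zeroPart,
    ⟨(Functor.associator _ _ _).symm ≪≫
      Functor.isoWhiskerRight (gprojToDctr A).asEquivalence.unitIso.symm _ ≪≫
      Functor.leftUnitor _⟩⟩, fun L ⟨e⟩ => ?_, fun W N φ => ?_⟩
  · have h1 : (gprojToDctr A ⋙ L).ReflectsIsomorphisms :=
      have := reflectsIsomorphisms_extend hA
      reflectsIsomorphisms_of_iso e.symm
    have e' : L ≅ (gprojToDctr A).inv ⋙ gprojToDctr A ⋙ L :=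
      (Functor.leftUnitor _).symm ≪≫
        Functor.isoWhiskerRight (gprojToDctr A).asEquivalence.counitIso.symm L ≪≫
        Functor.associator _ _ _
    exact reflectsIsomorphisms_of_iso e'.symm
  · rw [isContraacyclic_iff φ.hasSection, isContraacyclic_iff (φ.hasSection_reduction hA)]
    exact φ.contractible_iff_reduction hA
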